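/- Model. Algorithms are randomized random access programs over the natural numbers (arrays, arithmetic $+,-,\times,$ integer division and remainder, comparisons, branching, while loops, calls of a program as a subroutine on a fresh memory) with the logarithmic cost criterion: each operation costs the bit length of the numbers and addresses it handles. They may draw uniform integers from $\{0,\dots,r-1\}$ and toss a coin that shows $1$ with probability $\mu$ (a fair coin if $\mu=1/2$). "Runs in time $t$" means: for all outcomes of its random choices the program halts at total cost at most $t$, including the cost of loading the input. $\lg$ is the logarithm to base 2, and $\tilde O(T(n))$ means $T(n)\cdot n^{o(1)}$. Problem. Fix an integer $k\ge 2$, put $\ell=\binom k2$, and let $g=g(n)\ge 1$ and $b=b(n)\ge 0$ be integers with $g=o(\lg n/\lg\lg n)$ and $b=o(\lg n)$. A $(g,b)$-factored vector is $v=(v[1],\dots,v[g])$ with $v[i]\subseteq\{0,1\}^b$. Let $f=(f_b)_b$ be any family of functions $f_b:(\{0,1\}^b)^{\ell}\to\{0,1\}$. An instance of size $n$ of counting factored $f$ $k$-clique, $\#\mathrm{F}f k\mathrm{C}$, is a $k$-partite graph $G$ with parts $V_1,\dots,V_k$ of $n$ nodes each, in which each edge $\{x,y\}$ is labeled by a $(g,b)$-factored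 vector $e_{x,y}$; it is given by $n,g,b$ and, for each pair of nodes in different parts, a bit saying whether the edge is present and the $g2^b$ membership bits of its label. The task is to compute $$\sum_{(v_1,\dots,v_k)\in V_1\times\dots\times V_k}\mathrm{isClique}(v_1,\dots,v_k)\prod_{i=1}^{g}\ \sum_{w_{ac}\in e_{v_a,v_c}[i]\ (1\le a<c\le k)} f_b\big((w_{ac})_{a<c}\big).$$ Worst-case $\#\mathrm{F}f k\mathrm{C}$ can be solved in time $\tilde O(T(n))$ if there are a program, a function $\varepsilon(n)\to 0$ and a constant $C$ such that for all large $n$ the program runs on every instance of size $n$ in time $T(n)n^{\varepsilon(n)}$ and outputs the correct count with probability at least $1-C\,2^{-\lg^2 n}$. For $0<\mu<1$, the average-case problem $\#\mathrm{F}f k\mathrm{C}^{\mu}$ has as its input the complete $k$-partite graph with $n$ nodes per part in which every $\{0,1\}^b$-string belongs to every set $e_{x,y}[i]$ independently with probability $\mu$. It can be solved in time $T(n)$ with probability $\theta(n)$ if there is a program that, for all large $n$, runs in time $T(n)$ on all labelings of this complete graph and whose output is the correct count with probability at least $\theta(n)$ over the random instance and its own random choices. Uniform average-case $\#\mathrm{F}f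 k\mathrm{C}$ is defined in the same way, with all sets $e_{x,y}[i]$ independent and uniformly random among all subsets of $\{0,1\}^b$. Counting factored zero-$k$-clique is the case in which $f_b(w)=1$ iff the $\ell$ given strings, read as $b$-bit two's complement integers, sum to $0$. Theorem. Let $k,g,b$ be as above. 1. For every constant $0<\mu<1$, every $f$ and every $T$: if average-case $\#\mathrm{F}f k\mathrm{C}^{\mu}$ can be solved in time $T(n)$ with probability at least $1-\dfrac{1}{(\lg n)^{k^2g}(\lg\lg n)^{k^2g}}$, then worst-case $\#\mathrm{F}f k\mathrm{C}$ can be solved in time $\tilde O(T(n))$. 2. In part 1, success probability $1-n^{-\delta}$ for some constant $\delta>0$ suffices as well. 3. For $\mu=1/2$ the distribution of the instances of $\#\mathrm{F}f k\mathrm{C}^{\mu}$ is the uniform average-case distribution. 4. In particular, if uniform average-case counting factored zero-$k$-clique can be solved (by a program with a fair coin) in time $T(n)$ with probability at least $1-\dfrac{1}{(\lg n)^{k^2g}(\lg\lg n)^{k^2g}}$, then worst-case counting factored zero-$k$-clique can be solved in time $\tilde O(T(n))$. -/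

import Mathlib

open Filter Topology Asymptotics
open scoped NNReal

noncomputable section

namespace FactoredClique

/-! ## The machine model

Randomized random access programs over the natural numbers, with the logarithmic cost criterion:
every elementary operation is charged the bit lengths of the numbers and addresses it handles. -/

/-- Arithmetic operations (`sub` is truncated, `lt` and `eq` return `0` or `1`). -/
inductive Op
  | add | sub | mul | div | mod | lt | eq

def Op.eval : Op → ℕ → ℕ → ℕ
  | add, x, y => x + y
  | sub, x, y => x - y
  | mul, x, y => x * y
  | div, x, y => x / y
  | mod, x, y => x % y
  | lt, x, y => if x < y then 1 else 0
  | eq, x, y => if x = y then 1 else 0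

/-- The memory consists of arrays: `m a i` is the content of cell `i` of array number `a`. A program
names only finitely many arrays, the index of a cell is computed at run time. -/
abbrev Mem := ℕ → ℕ → ℕ

/-- Replace the content of cell `i` of array `a` by `v`. -/
def Mem.set (m : Mem) (a i v : ℕ) : Mem :=
  fun a' i' => if a' = a ∧ i' = i then v else m a' i'

/-- The initial memory on input `x`: the input stands in array `0`, all other cells are zero. -/
def Mem.ofInput (x : List ℕ) : Mem :=
  fun a i => if a = 0 then x.getD i 0 else 0

/-- The output of a program is the content of cell `0` of array `1` when it halts. -/
def Mem.output (m : Mem) : ℕ := m 1 0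

inductive Expr
  | const (c : ℕ)
  | read (a : ℕ) (i : Expr)
  | op (o : Op) (e₁ e₂ : Expr)

def Expr.val (m : Mem) : Expr → ℕ
  | const c => c
  | read a i => m a (i.val m)
  | op o e₁ e₂ => o.eval (e₁.val m) (e₂.val m)

/-- The cost of evaluating an expression; `Nat.size` is the bit length. -/
def Expr.cost (m : Mem) : Expr → ℕ
  | const c => 1 + c.size
  | read a i => 1 + i.cost m + (i.val m).size + (m a (i.val m)).size
  | op _ e₁ e₂ => 1 + e₁.cost m + e₂.cost m + (e₁.val m).size + (e₂.val m).size

/-- Programs.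
* `assign a i e`: `a[i] := e`;
* `rand a i e`: `a[i] :=` a uniformly random element of `{0, …, e - 1}`;
* `coin a i`: `a[i] :=` the result (`0` or `1`) of a toss of the coin of the model;
* `loop e p`: `while e ≠ 0 do p`;
* `call a i src len p`: run the program `p` on a fresh memory, on the input consisting of the first
  `len` cells of the array `src`, and put its output into `a[i]`. -/
inductive Prog
  | skip
  | assign (a : ℕ) (i e : Expr)
  | rand (a : ℕ) (i e : Expr)
  | coin (a : ℕ) (i : Expr)
  | seq (p q : Prog)
  | ite (e : Expr) (p q : Prog)
  | loop (e : Expr) (p : Prog)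
  | call (a : ℕ) (i : Expr) (src : ℕ) (len : Expr) (p : Prog)

/-- The cost of loading an input into memory. -/
def inputCost (x : List ℕ) : ℕ := (x.map fun v => 1 + v.size).sum

/-- The uniform distribution on `{0, …, r - 1}` (the point mass at `0` if `r = 0`). -/
def uniformBelow (r : ℕ) : PMF ℕ :=
  if h : 0 < r then PMF.uniformOfFinset (Finset.range r) ⟨0, Finset.mem_range.2 h⟩ else PMF.pure 0

/-- The result of a run: the final memory and the total cost, or `none` if the recursion depth of
the evaluation was exhausted. -/
abbrev Result := Option (Mem × ℕ)

/-- Add `c` to the cost of a run. -/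
def tick (c : ℕ) (r : PMF Result) : PMF Result :=
  r.map (Option.map fun s => (s.1, c + s.2))

/-- The semantics of programs with a coin distributed as `β`: `p.exec β d m` is the distribution of
the result of running `p` from memory `m`, where the evaluation may be nested at most `d` deep. If
no outcome is `none`, then the distribution does not change for larger `d`. -/
def Prog.exec (β : PMF Bool) : ℕ → Prog → Mem → PMF Result
  | 0, _, _ => PMF.pure none
  | _ + 1, skip, m => PMF.pure (some (m, 1))
  | _ + 1, assign a i e, m =>
      PMF.pure (some (m.set a (i.val m) (e.val m),
        1 + i.cost m + e.cost m + (i.val m).size + (e.val m).size))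
  | _ + 1, rand a i e, m =>
      (uniformBelow (e.val m)).map fun v => some (m.set a (i.val m) v,
        1 + i.cost m + e.cost m + (i.val m).size + (e.val m).size)
  | _ + 1, coin a i, m =>
      β.map fun v => some (m.set a (i.val m) v.toNat, 2 + i.cost m + (i.val m).size)
  | d + 1, seq p q, m =>
      (exec β d p m).bind fun r => match r with
        | none => PMF.pure none
        | some (m', c) => tick c (exec β d q m')
  | d + 1, ite e p q, m =>
      tick (1 + e.cost m) (if e.val m ≠ 0 then exec β d p m else exec β d q m)
  | d + 1, loop e p, m =>
      tick (1 + e.cost m)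
        (if e.val m ≠ 0 then exec β d (seq p (loop e p)) m else PMF.pure (some (m, 0)))
  | d + 1, call a i src len p, m =>
      let x := (List.range (len.val m)).map (m src)
      (exec β d p (Mem.ofInput x)).map (Option.map fun r =>
        (m.set a (i.val m) r.1.output,
          1 + i.cost m + (i.val m).size + len.cost m + inputCost x + r.2 + r.1.output.size))

/-- On input `x` the program `p` halts within time `t` whatever the outcomes of its random choices,
and its output has the distribution `D`. Loading the input is part of the running time. -/
def Computes (β : PMF Bool) (p : Prog) (x : List ℕ) (t : ℝ) (D : PMF ℕ) : Prop :=
  ∃ (d : ℕ) (E : PMF (Mem × ℕ)), p.exec β d (Mem.ofInput x) = E.map some ∧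
    (∀ r ∈ E.support, ((inputCost x + r.2 : ℕ) : ℝ) ≤ t) ∧
    D = E.map fun r => r.1.output

/-! ## Counting factored `f` `k`-cliques -/

/-- The set `{0,1}^b`. -/
abbrev BitString (b : ℕ) := Fin b → Bool

/-- A `(g,b)`-factored vector: `g` subsets of `{0,1}^b`. -/
abbrev FactoredVector (g b : ℕ) := Fin g → Finset (BitString b)

/-- The `k.choose 2` pairs of indices, that is, the positions of the edges of a `k`-clique. -/
abbrev Pair (k : ℕ) := {p : Fin k × Fin k // p.1 < p.2}

/-- A `k`-partite graph with `n` nodes in each part and with edges labeled by factored vectors: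
`G ⟨(a, c), _⟩ x y` is the label of the edge between node `x` of part `a` and node `y` of part `c`,
and it is `none` if there is no such edge. -/
abbrev LabeledGraph (k n g b : ℕ) := Pair k → Fin n → Fin n → Option (FactoredVector g b)

/-- The labels of the edges of a complete `k`-partite graph with `n` nodes in each part. -/
abbrev Labels (k n g b : ℕ) := Pair k → Fin n → Fin n → FactoredVector g b

/-- The complete `k`-partite graph with the given labels. -/
def completeGraph {k n g b : ℕ} (L : Labels k n g b) : LabeledGraph k n g b :=
  fun p x y => some (L p x y)

/-- The number of tuples, with one bit string from each of the given sets, that `f` accepts. -/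
def acceptCount {k b : ℕ} (f : (Pair k → BitString b) → Bool)
    (Z : Pair k → Finset (BitString b)) : ℕ :=
  ∑ w ∈ Fintype.piFinset Z, (f w).toNat

/-- The nodes `v a` (of part `a`, for each `a`) form a `k`-clique. -/
def IsClique {k n g b : ℕ} (G : LabeledGraph k n g b) (v : Fin k → Fin n) : Prop :=
  ∀ p : Pair k, G p (v p.1.1) (v p.1.2) ≠ none

open Classical in
/-- The contribution of the nodes `v` to the count: the number of tuples represented by the labels
of the edges of the clique that are accepted by `f` in each of the `g` coordinates. -/
def cliqueCount {k n g b : ℕ} (f : (Pair k → BitString b) → Bool)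
    (G : LabeledGraph k n g b) (v : Fin k → Fin n) : ℕ :=
  if IsClique G v then
    ∏ i : Fin g, acceptCount f fun p => (G p (v p.1.1) (v p.1.2)).getD (fun _ => ∅) i
  else 0

/-- The number to be computed in the counting version of factored `f` `k`-clique. -/
def count {k n g b : ℕ} (f : (Pair k → BitString b) → Bool) (G : LabeledGraph k n g b) : ℕ :=
  ∑ v : Fin k → Fin n, cliqueCount f G v

/-- The two's complement value of a bit string, the least significant bit coming first. -/
def intValue {b : ℕ} (w : BitString b) : ℤ :=
  ∑ i : Fin b, if w i then (if i.1 + 1 = b then -2 ^ i.1 else 2 ^ i.1) else 0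

/-- The function `f` of factored zero `k`-clique: the `k.choose 2` given numbers sum to zero. -/
def sumsToZero (k b : ℕ) (w : Pair k → BitString b) : Bool :=
  decide (∑ p, intValue (w p) = 0)

/-! ## Encoding of instances -/

/-- A set of bit strings is encoded by its `2 ^ b` membership bits. -/
def encodeSet {b : ℕ} (Z : Finset (BitString b)) : List ℕ :=
  (List.range (2 ^ b)).map fun s => if (fun j : Fin b => s.testBit j) ∈ Z then 1 else 0

/-- One bit tells whether the edge is present; it is followed by the `g * 2 ^ b` bits of the label
(zeros for an absent edge). -/
def encodeEdge {g b : ℕ} : Option (FactoredVector g b) → List ℕ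
  | none => 0 :: List.replicate (g * 2 ^ b) 0
  | some v => 1 :: (List.finRange g).flatMap fun i => encodeSet (v i)

def encode {k n g b : ℕ} (G : LabeledGraph k n g b) : List ℕ :=
  [n, g, b] ++ (List.finRange k).flatMap fun a => (List.finRange k).flatMap fun c =>
    if h : a < c then
      (List.finRange n).flatMap fun x => (List.finRange n).flatMap fun y =>
        encodeEdge (G ⟨(a, c), h⟩ x y)
    else []

/-! ## Random instances -/

/-- A coin that shows `true` with probability `μ`. -/
def biasedCoin (μ : ℝ≥0) (hμ : μ ≤ 1) : PMF Bool :=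
  PMF.ofFintype (fun c => if c then (μ : ENNReal) else (1 - μ : ℝ≥0)) (by
    simp only [Fintype.sum_bool, if_true, Bool.false_eq_true, if_false]
    rw [← ENNReal.coe_add, add_tsub_cancel_of_le hμ, ENNReal.coe_one])

open Classical in
/-- The distribution of a family of independent random variables with distribution `p`. -/
def iid {ι α : Type} [Fintype ι] [Fintype α] (p : PMF α) : PMF (ι → α) :=
  PMF.ofFintype (fun x => ∏ i, p (x i)) (by
    have h := Finset.prod_univ_sum (fun _ : ι => (Finset.univ : Finset α)) (fun _ a => p a)
    rw [Fintype.piFinset_univ] at h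
    rw [← h]
    have hp : ∑ a, p a = 1 := by rw [← tsum_fintype (L := .unconditional _)]; exact p.tsum_coe
    simp [hp])

/-- A random subset of `{0,1}^b` containing each bit string with probability `μ`, independently. -/
def randomSet (μ : ℝ≥0) (hμ : μ ≤ 1) (b : ℕ) : PMF (Finset (BitString b)) :=
  (iid (biasedCoin μ hμ)).map fun x => Finset.univ.filter fun w => x w = true

/-- Random labels for the complete `k`-partite graph: independent random factored vectors, each
consisting of `g` independent random sets with distribution `S`. -/
def labelsOfSets (k n g : ℕ) {b : ℕ} (S : PMF (Finset (BitString b))) : PMF (Labels k n g b) :=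
  iid (iid (iid (iid S : PMF (FactoredVector g b))))

/-- The average-case distribution with parameter `μ`. -/
def randomLabels (μ : ℝ≥0) (hμ : μ ≤ 1) (k n g b : ℕ) : PMF (Labels k n g b) :=
  labelsOfSets k n g (randomSet μ hμ b)

/-- The uniform average-case distribution: every set in every label is chosen uniformly at random
from all subsets of `{0,1}^b`. -/
def uniformLabels (k n g b : ℕ) : PMF (Labels k n g b) :=
  labelsOfSets k n g (PMF.uniformOfFintype (Finset (BitString b)))

/-! ## Average-case and worst-case algorithms -/

/-- For all large `n`, on a random instance with `n` nodes per part drawn from `dist n`, some fixed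
program runs in time `T n` and outputs the correct count with probability at least `θ n`, over
the instance and the random choices of the program. -/
def AverageCaseSolvable (β : PMF Bool) {k : ℕ} {g b : ℕ → ℕ}
    (f : (c : ℕ) → (Pair k → BitString c) → Bool)
    (dist : (n : ℕ) → PMF (Labels k n (g n) (b n))) (T θ : ℕ → ℝ) : Prop :=
  ∃ A : Prog, ∀ᶠ n in atTop, ∃ D : Labels k n (g n) (b n) → PMF ℕ,
    (∀ L, Computes β A (encode (completeGraph L)) (T n) (D L)) ∧
    θ n ≤ (((dist n).bind fun L => (D L).map fun y =>
      decide (y = count (f (b n)) (completeGraph L))) true).toReal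

/-- Some fixed program outputs, on every instance with `n` nodes per part, the correct count
with probability `1 - O(2 ^ (-lg² n))`, in time `T n * n ^ o(1)`. -/
def WorstCaseSolvable (β : PMF Bool) {k : ℕ} (g b : ℕ → ℕ)
    (f : (c : ℕ) → (Pair k → BitString c) → Bool) (T : ℕ → ℝ) : Prop :=
  ∃ (B : Prog) (ε : ℕ → ℝ) (C : ℝ), Tendsto ε atTop (𝓝 0) ∧
    ∀ᶠ n : ℕ in atTop, ∀ G : LabeledGraph k n (g n) (b n), ∃ D : PMF ℕ,
      Computes β B (encode G) (T n * (n : ℝ) ^ ε n) D ∧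
      1 - C * (2 : ℝ) ^ (-(Real.logb 2 n) ^ 2) ≤ (D (count (f (b n)) G)).toReal

/-- The success probability `1 - 1 / (lg(n) ^ (k² g) * lglg(n) ^ (k² g))`. -/
def threshold (k : ℕ) (g : ℕ → ℕ) (n : ℕ) : ℝ :=
  1 - 1 / (Real.logb 2 n ^ (k ^ 2 * g n) * Real.logb 2 (Real.logb 2 n) ^ (k ^ 2 * g n))

end FactoredClique

end

open scoped ENNReal

noncomputable section

namespace FactoredClique

variable {β : PMF Bool}

/-! ## Expectations and weakest preconditions -/

/-! The count is a polynomial in the membership bits in which every monomial takes exactly one bit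
from each of the `l * g` classes (pair of parts, coordinate), where `l` is the number of pairs of
parts. Absent edges fit in as edges with empty labels, because `g ≥ 1` (`count_eq_countPoly`).
Suppose that every bit is written modulo `2 ^ m` as a linear form `∑ j, 2 ^ (j / a) * z j` in `t = a
* m` random bits, its shares. Expanding the polynomial then gives the count modulo `2 ^ m` as a
weighted sum of the counts of `t ^ (l * g)` complete instances, one for each choice of a share index
per class (`countPoly_share`, `count_eq_sum_queries`). The modulus exceeds every possible count, so
answers to these queries determine it.

The queries must look like average-case instances. A query reads a single share of each entry, and
different entries are shared independently, so only the marginal distribution of one share matters.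
Shares are drawn level by level: given the rest `r`, draw a pattern of `a` bits whose number `K` of
ones has the parity of `r`, and continue with `(r - K) / 2`. With `a` even, even parity is realized
by `a` copies of one coin toss, and odd parity by a single one at a random position or its
complement. If the complement is chosen with probability `(a * μ - 1) / (a - 2)`, every bit has
marginal exactly `μ`. Since `μ` is an arbitrary real that is accessible only through the coin, this
probability is simulated by clamping the number of successes in many tosses (`biasProg_spec`). Upper
bounds suffice: each value of a share is at most `1 + 2 ^ (-m)` times as likely as it should be
(`patternProg_spec`, `shareProg_spec`), hence each query is, pointwise, distributed with at most `(1
+ 2 ^ (-m)) ^ N ≤ 2` times the average-case probability, `N` being the number of entries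
(`sampleLoop_agrees`).

A union bound over the queries gives one trial of small error (`sampleQuery_spec`). Eventually `a *
m ≤ lg² n`, so there are at most `(lg n) ^ (2 * l * g)` queries. As `k ^ 2 = 2 * l + k`, the
threshold leaves the room `(lg n) ^ (k * g)` for constants; and the number of queries is `n ^ o(1)`,
which yields the version with `n ^ (-δ)` and keeps the running time within `T n * n ^ o(1)`. A
majority vote over `n.size ^ 2` trials, controlled by an exponential potential, makes the error at
most `2 ^ (-lg² n)` up to a constant (`mainProg_spec`).

Programs are analysed by weakest preconditions with values in `ℝ≥0∞`. Exhausted and over-budget runs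
have the value `⊤`, so one finite bound proves termination, running time and error probability
together (`computes_of_wp_le`). -/

/-- The expectation of `h` under `p`. -/
def expect {α : Type*} (p : PMF α) (h : α → ℝ≥0∞) : ℝ≥0∞ := ∑' x, p x * h x

theorem expect_pure {α : Type*} (x : α) (h : α → ℝ≥0∞) : expect (PMF.pure x) h = h x := by
  unfold expect
  rw [tsum_eq_single x]
  · simp
  · intro y hy
    simp [PMF.pure_apply, hy]

theorem expect_bind {α β : Type*} (p : PMF α) (q : α → PMF β) (h : β → ℝ≥0∞) :
    expect (p.bind q) h = expect p fun x => expect (q x) h := by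
  unfold expect
  simp only [PMF.bind_apply, ← ENNReal.tsum_mul_right, ← ENNReal.tsum_mul_left]
  rw [ENNReal.tsum_comm]
  simp only [mul_assoc]

theorem expect_map {α β : Type*} (p : PMF α) (f : α → β) (h : β → ℝ≥0∞) :
    expect (p.map f) h = expect p fun x => h (f x) := by
  rw [PMF.map, expect_bind]
  simp only [Function.comp_apply, expect_pure]

theorem expect_mono {α : Type*} (p : PMF α) {h h' : α → ℝ≥0∞} (H : ∀ x, h x ≤ h' x) :
    expect p h ≤ expect p h' :=
  ENNReal.tsum_le_tsum fun x => mul_le_mul_right (H x) _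

theorem expect_mono_support {α : Type*} (p : PMF α) {h h' : α → ℝ≥0∞}
    (H : ∀ x ∈ p.support, h x ≤ h' x) : expect p h ≤ expect p h' := by
  refine ENNReal.tsum_le_tsum fun x => ?_
  by_cases hx : x ∈ p.support
  · exact mul_le_mul_right (H x hx) _
  · rw [PMF.mem_support_iff, not_not] at hx
    simp [hx]

theorem expect_add {α : Type*} (p : PMF α) (h h' : α → ℝ≥0∞) :
    expect p (fun x => h x + h' x) = expect p h + expect p h' := by
  simp only [expect, mul_add, ENNReal.tsum_add]

theorem expect_const_mul {α : Type*} (p : PMF α) (c : ℝ≥0∞) (h : α → ℝ≥0∞) :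
    expect p (fun x => c * h x) = c * expect p h := by
  simp only [expect, ← ENNReal.tsum_mul_left, mul_left_comm]

theorem expect_const {α : Type*} (p : PMF α) (c : ℝ≥0∞) : expect p (fun _ => c) = c := by
  simp [expect, ENNReal.tsum_mul_right, p.tsum_coe]

theorem expect_eq_sum {α : Type*} [Fintype α] (p : PMF α) (h : α → ℝ≥0∞) :
    expect p h = ∑ x, p x * h x := tsum_fintype _

theorem expect_eq_sum_support {α : Type*} (p : PMF α) (hp : p.support.Finite) (h : α → ℝ≥0∞) :
    expect p h = ∑ x ∈ hp.toFinset, p x * h x := by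
  unfold expect
  refine tsum_eq_sum fun x hx => ?_
  simp only [Set.Finite.mem_toFinset, PMF.mem_support_iff, not_not] at hx
  simp [hx]

/-- Decreasing limits need not commute with infinite sums of possibly infinite values; a finite
support reduces the exchange to finite sums. This is what allows the depth bounds of two consecutive
runs to be removed separately. -/
theorem expect_iInf {α : Type*} (p : PMF α) (hp : p.support.Finite) (h : ℕ → α → ℝ≥0∞)
    (hh : ∀ d x, h (d + 1) x ≤ h d x) :
    expect p (fun x => ⨅ d, h d x) = ⨅ d, expect p (h d) := by
  simp only [expect_eq_sum_support p hp]
  have anti : ∀ x, Antitone fun d => h d x := fun x => antitone_nat_of_succ_le fun d => hh d x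
  rw [ENNReal.iInf_sum]
  · refine Finset.sum_congr rfl fun x hx => ?_
    refine ENNReal.mul_iInf_of_ne ?_ (PMF.apply_ne_top _ _)
    simpa using hx
  · intro t i j
    refine ⟨max i j, fun x _ => ⟨?_, ?_⟩⟩
    · exact mul_le_mul_right (anti x (le_max_left _ _)) _
    · exact mul_le_mul_right (anti x (le_max_right _ _)) _

theorem lt_of_expect_ne_top {α : Type*} {p : PMF α} {h : α → ℝ≥0∞} (H : expect p h ≠ ⊤) {x : α}
    (hx : x ∈ p.support) : h x ≠ ⊤ := by
  intro e
  refine H ?_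
  refine ENNReal.tsum_eq_top_of_eq_top ⟨x, ?_⟩
  rw [e, ENNReal.mul_top]
  simpa using hx

/-- A postcondition as a function of the result of a run, infinite for exhausted evaluations. -/
def onResult (Φ : Mem → ℕ → ℝ≥0∞) : Result → ℝ≥0∞
  | none => ⊤
  | some s => Φ s.1 s.2

variable {β : PMF Bool}

/-- The expectation of `Φ` after a run nested at most `d` deep. -/
def wpDepth (β : PMF Bool) (d : ℕ) (p : Prog) (m : Mem) (Φ : Mem → ℕ → ℝ≥0∞) : ℝ≥0∞ :=
  expect (p.exec β d m) (onResult Φ)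

/-- The expectation of `Φ` after a run (infinite if the run need not halt). -/
def wp (β : PMF Bool) (p : Prog) (m : Mem) (Φ : Mem → ℕ → ℝ≥0∞) : ℝ≥0∞ :=
  ⨅ d, wpDepth β d p m Φ

/-! ### Unfolding the weakest precondition at bounded depth. -/

theorem expect_tick (c : ℕ) (r : PMF Result) (Φ : Mem → ℕ → ℝ≥0∞) :
    expect (tick c r) (onResult Φ) = expect r (onResult fun m' c' => Φ m' (c + c')) := by
  rw [tick, expect_map]
  congr 1
  funext x
  cases x <;> rfl

theorem wpDepth_seq (d : ℕ) (p q : Prog) (m : Mem) (Φ : Mem → ℕ → ℝ≥0∞) :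
    wpDepth β (d + 1) (.seq p q) m Φ =
      wpDepth β d p m fun m' c => wpDepth β d q m' fun m'' c' => Φ m'' (c + c') := by
  unfold wpDepth
  rw [Prog.exec, expect_bind]
  congr 1
  funext x
  cases x with
  | none => exact expect_pure _ _
  | some s => exact expect_tick _ _ _

theorem wpDepth_ite (d : ℕ) (e : Expr) (p q : Prog) (m : Mem) (Φ : Mem → ℕ → ℝ≥0∞) :
    wpDepth β (d + 1) (.ite e p q) m Φ =
      if e.val m ≠ 0 then wpDepth β d p m fun m' c => Φ m' (1 + e.cost m + c)
      else wpDepth β d q m fun m' c => Φ m' (1 + e.cost m + c) := by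
  unfold wpDepth
  rw [Prog.exec, expect_tick]
  split_ifs <;> rfl

theorem wpDepth_loop (d : ℕ) (e : Expr) (p : Prog) (m : Mem) (Φ : Mem → ℕ → ℝ≥0∞) :
    wpDepth β (d + 1) (.loop e p) m Φ =
      if e.val m ≠ 0 then
        wpDepth β d (.seq p (.loop e p)) m fun m' c => Φ m' (1 + e.cost m + c)
      else Φ m (1 + e.cost m + 0) := by
  unfold wpDepth
  rw [Prog.exec, expect_tick]
  split_ifs
  · rfl
  · rw [expect_pure]; rfl

/-- The input of a called program. -/
def callInput (src : ℕ) (len : Expr) (m : Mem) : List ℕ := (List.range (len.val m)).map (m src)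

theorem wpDepth_call (d a : ℕ) (i : Expr) (src : ℕ) (len : Expr) (p : Prog) (m : Mem)
    (Φ : Mem → ℕ → ℝ≥0∞) :
    wpDepth β (d + 1) (.call a i src len p) m Φ =
      wpDepth β d p (Mem.ofInput (callInput src len m)) fun m' c =>
        Φ (m.set a (i.val m) m'.output)
          (1 + i.cost m + (i.val m).size + len.cost m + inputCost (callInput src len m) + c +
            m'.output.size) := by
  unfold wpDepth
  rw [Prog.exec, expect_map]
  congr 1
  funext x
  cases x <;> rfl

theorem wpDepth_zero (p : Prog) (m : Mem) (Φ : Mem → ℕ → ℝ≥0∞) : wpDepth β 0 p m Φ = ⊤ := by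
  unfold wpDepth
  rw [Prog.exec, expect_pure]
  rfl

theorem wpDepth_mono {Φ Ψ : Mem → ℕ → ℝ≥0∞} (h : ∀ m c, Φ m c ≤ Ψ m c) (d : ℕ) (p : Prog)
    (m : Mem) : wpDepth β d p m Φ ≤ wpDepth β d p m Ψ := by
  refine expect_mono _ fun x => ?_
  cases x with
  | none => exact le_rfl
  | some s => exact h _ _

/-- More depth only replaces exhausted branches, which have the value `⊤`, by genuine results. So
the expectations decrease with the depth and their infimum is a limit. -/
theorem wpDepth_succ_le (d : ℕ) : ∀ (p : Prog) (m : Mem) (Φ : Mem → ℕ → ℝ≥0∞),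
    wpDepth β (d + 1) p m Φ ≤ wpDepth β d p m Φ := by
  induction d with
  | zero => intro p m Φ; rw [wpDepth_zero]; exact le_top
  | succ d ih =>
    intro p m Φ
    cases p with
    | skip => exact le_rfl
    | assign a i e => exact le_rfl
    | rand a i e => exact le_rfl
    | coin a i => exact le_rfl
    | seq p q =>
      rw [wpDepth_seq, wpDepth_seq]
      exact (ih _ _ _).trans (wpDepth_mono (fun _ _ => ih _ _ _) _ _ _)
    | ite e p q =>
      rw [wpDepth_ite, wpDepth_ite]
      split_ifs <;> exact ih _ _ _
    | loop e p =>
      rw [wpDepth_loop, wpDepth_loop]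
      split_ifs
      · exact ih _ _ _
      · exact le_rfl
    | call a i src len p =>
      rw [wpDepth_call, wpDepth_call]
      exact ih _ _ _

theorem wpDepth_antitone (p : Prog) (m : Mem) (Φ : Mem → ℕ → ℝ≥0∞) :
    Antitone fun d => wpDepth β d p m Φ :=
  antitone_nat_of_succ_le fun d => wpDepth_succ_le d p m Φ

/-! ### Finiteness of the random choices. -/

theorem uniformBelow_of_pos {r : ℕ} (h : 0 < r) :
    uniformBelow r = PMF.uniformOfFinset (Finset.range r) (Finset.nonempty_range_iff.2 h.ne') := by
  unfold uniformBelow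
  rw [dif_pos h]

theorem uniformBelow_zero : uniformBelow 0 = PMF.pure 0 := by
  unfold uniformBelow
  rw [dif_neg (lt_irrefl 0)]

theorem uniformBelow_support_finite (r : ℕ) : (uniformBelow r).support.Finite := by
  rcases r.eq_zero_or_pos with rfl | h
  · rw [uniformBelow_zero, PMF.support_pure]; exact Set.finite_singleton _
  · rw [uniformBelow_of_pos h, PMF.support_uniformOfFinset]; exact Finset.finite_toSet _

theorem le_of_mem_uniformBelow {r v : ℕ} (hv : v ∈ (uniformBelow r).support) : v ≤ r := by
  rcases r.eq_zero_or_pos with rfl | h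
  · rw [uniformBelow_zero, PMF.support_pure] at hv
    simpa using hv
  · rw [uniformBelow_of_pos h, PMF.support_uniformOfFinset] at hv
    simp at hv
    omega

theorem expect_uniformBelow {r : ℕ} (h : 0 < r) (F : ℕ → ℝ≥0∞) :
    expect (uniformBelow r) F = (∑ v ∈ Finset.range r, F v) / r := by
  rw [uniformBelow_of_pos h]
  unfold expect
  rw [tsum_eq_sum (s := Finset.range r)]
  · rw [div_eq_mul_inv, mul_comm, Finset.mul_sum]
    refine Finset.sum_congr rfl fun v hv => ?_
    rw [PMF.uniformOfFinset_apply_of_mem _ hv, Finset.card_range]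
  · intro v hv
    rw [PMF.uniformOfFinset_apply_of_notMem _ hv, zero_mul]

theorem tick_support_finite (c : ℕ) {r : PMF Result} (h : r.support.Finite) :
    (tick c r).support.Finite := by
  rw [tick, PMF.support_map]; exact h.image _

theorem exec_support_finite (d : ℕ) : ∀ (p : Prog) (m : Mem), (p.exec β d m).support.Finite := by
  induction d with
  | zero => intro p m; rw [Prog.exec, PMF.support_pure]; exact Set.finite_singleton _
  | succ d ih =>
    intro p m
    cases p with
    | skip => rw [Prog.exec, PMF.support_pure]; exact Set.finite_singleton _
    | assign a i e => rw [Prog.exec, PMF.support_pure]; exact Set.finite_singleton _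
    | rand a i e =>
      rw [Prog.exec, PMF.support_map]; exact (uniformBelow_support_finite _).image _
    | coin a i => rw [Prog.exec, PMF.support_map]; exact (Set.toFinite _).image _
    | seq p q =>
      rw [Prog.exec, PMF.support_bind]
      refine (ih p m).biUnion fun r _ => ?_
      cases r with
      | none => exact (PMF.support_pure (none : Result)) ▸ Set.finite_singleton _
      | some s => exact tick_support_finite _ (ih _ _)
    | ite e p q =>
      rw [Prog.exec]
      refine tick_support_finite _ ?_
      split_ifs <;> exact ih _ _
    | loop e p =>
      rw [Prog.exec]
      refine tick_support_finite _ ?_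
      split_ifs
      · exact ih _ _
      · rw [PMF.support_pure]; exact Set.finite_singleton _
    | call a i src len p =>
      rw [Prog.exec, PMF.support_map]; exact (ih _ _).image _

/-! ### Rules for the weakest precondition without a depth bound. -/

theorem wp_le_depth (d : ℕ) (p : Prog) (m : Mem) (Φ : Mem → ℕ → ℝ≥0∞) :
    wp β p m Φ ≤ wpDepth β d p m Φ := iInf_le _ d

theorem wp_mono {Φ Ψ : Mem → ℕ → ℝ≥0∞} (h : ∀ m c, Φ m c ≤ Ψ m c) (p : Prog) (m : Mem) :
    wp β p m Φ ≤ wp β p m Ψ := iInf_mono fun d => wpDepth_mono h d p m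

/-- The infimum over the depths is directed, so a common depth serves both summands. Additivity is
the source of all union bounds below. -/
theorem wp_add (p : Prog) (m : Mem) (Φ Ψ : Mem → ℕ → ℝ≥0∞) :
    wp β p m (fun m' c => Φ m' c + Ψ m' c) = wp β p m Φ + wp β p m Ψ := by
  unfold wp
  rw [ENNReal.iInf_add_iInf]
  · congr 1
    funext d
    unfold wpDepth
    rw [← expect_add]
    congr 1
    funext x
    cases x <;> simp [onResult]
  · intro i j
    exact ⟨max i j, add_le_add (wpDepth_antitone _ _ _ (le_max_left _ _))
      (wpDepth_antitone _ _ _ (le_max_right _ _))⟩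

/-- The inner infimum is pulled out of the expectation by `expect_iInf`, so the two halves may have
independent depths; `max d₁ d₂ + 1` then serves both, by antitonicity. -/
theorem wp_seq_le (p q : Prog) (m : Mem) (Φ : Mem → ℕ → ℝ≥0∞) :
    wp β (.seq p q) m Φ ≤ wp β p m fun m' c => wp β q m' fun m'' c' => Φ m'' (c + c') := by
  refine le_iInf fun d₁ => ?_
  have h : wpDepth β d₁ p m (fun m' c => wp β q m' fun m'' c' => Φ m'' (c + c')) =
      ⨅ d₂, wpDepth β d₁ p m (fun m' c => wpDepth β d₂ q m' fun m'' c' => Φ m'' (c + c')) := by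
    unfold wpDepth
    rw [← expect_iInf _ (exec_support_finite d₁ p m)]
    · congr 1
      funext x
      cases x with
      | none => simp [onResult]
      | some s => rfl
    · intro d x
      cases x with
      | none => exact le_rfl
      | some s => exact wpDepth_succ_le _ _ _ _
  rw [h]
  refine le_iInf fun d₂ => ?_
  refine (wp_le_depth (max d₁ d₂ + 1) _ _ _).trans ?_
  rw [wpDepth_seq]
  refine (wpDepth_antitone _ _ _ (le_max_left d₁ d₂)).trans (wpDepth_mono (fun m' c => ?_) _ _ _)
  exact wpDepth_antitone _ _ _ (le_max_right d₁ d₂)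

theorem wp_skip_le (m : Mem) (Φ : Mem → ℕ → ℝ≥0∞) : wp β .skip m Φ ≤ Φ m 1 := by
  refine (wp_le_depth 1 _ _ _).trans ?_
  rw [wpDepth, Prog.exec, expect_pure]
  exact le_rfl

theorem wp_assign_le (a : ℕ) (i e : Expr) (m : Mem) (Φ : Mem → ℕ → ℝ≥0∞) :
    wp β (.assign a i e) m Φ ≤ Φ (m.set a (i.val m) (e.val m))
      (1 + i.cost m + e.cost m + (i.val m).size + (e.val m).size) := by
  refine (wp_le_depth 1 _ _ _).trans ?_
  rw [wpDepth, Prog.exec, expect_pure]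
  exact le_rfl

theorem wp_rand_le (a : ℕ) (i e : Expr) (m : Mem) (Φ : Mem → ℕ → ℝ≥0∞) :
    wp β (.rand a i e) m Φ ≤ expect (uniformBelow (e.val m)) fun v => Φ (m.set a (i.val m) v)
      (1 + i.cost m + e.cost m + (i.val m).size + (e.val m).size) := by
  refine (wp_le_depth 1 _ _ _).trans ?_
  rw [wpDepth, Prog.exec, expect_map]
  exact le_rfl

theorem wp_coin_le (a : ℕ) (i : Expr) (m : Mem) (Φ : Mem → ℕ → ℝ≥0∞) :
    wp β (.coin a i) m Φ ≤ expect β fun v => Φ (m.set a (i.val m) v.toNat)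
      (2 + i.cost m + (i.val m).size) := by
  refine (wp_le_depth 1 _ _ _).trans ?_
  rw [wpDepth, Prog.exec, expect_map]
  exact le_rfl

theorem wp_ite_le (e : Expr) (p q : Prog) (m : Mem) (Φ : Mem → ℕ → ℝ≥0∞) :
    wp β (.ite e p q) m Φ ≤ if e.val m ≠ 0 then wp β p m fun m' c => Φ m' (1 + e.cost m + c)
      else wp β q m fun m' c => Φ m' (1 + e.cost m + c) := by
  split_ifs with h
  all_goals
    refine le_iInf fun d => (wp_le_depth (d + 1) _ _ _).trans ?_
    rw [wpDepth_ite]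
    simp [h]

theorem wp_loop_le (e : Expr) (p : Prog) (m : Mem) (Φ : Mem → ℕ → ℝ≥0∞) :
    wp β (.loop e p) m Φ ≤
      if e.val m ≠ 0 then wp β (.seq p (.loop e p)) m fun m' c => Φ m' (1 + e.cost m + c)
      else Φ m (1 + e.cost m + 0) := by
  split_ifs with h
  · refine le_iInf fun d => (wp_le_depth (d + 1) _ _ _).trans ?_
    rw [wpDepth_loop]
    simp [h]
  · refine (wp_le_depth 1 _ _ _).trans ?_
    rw [wpDepth_loop]
    simp [h]

theorem wp_call_le (a : ℕ) (i : Expr) (src : ℕ) (len : Expr) (p : Prog) (m : Mem)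
    (Φ : Mem → ℕ → ℝ≥0∞) :
    wp β (.call a i src len p) m Φ ≤
      wp β p (Mem.ofInput (callInput src len m)) fun m' c =>
        Φ (m.set a (i.val m) m'.output)
          (1 + i.cost m + (i.val m).size + len.cost m + inputCost (callInput src len m) + c +
            m'.output.size) := by
  refine le_iInf fun d => (wp_le_depth (d + 1) _ _ _).trans ?_
  rw [wpDepth_call]

/-! ## Outputs are not larger than the running time -/

/-- Every write is charged at least the bit length of the value written, so cells can outgrow the
old bound only by what has been paid. This limits the otherwise unknown output of a subroutine. -/
theorem size_le_of_mem_support (d : ℕ) : ∀ (p : Prog) (m : Mem) (B : ℕ), 1 ≤ B →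
    (∀ a i, (m a i).size ≤ B) → ∀ s, some s ∈ (p.exec β d m).support →
    ∀ a i, (s.1 a i).size ≤ B + s.2 := by
  have hset : ∀ (m : Mem) (B c a i v : ℕ), (∀ a i, (m a i).size ≤ B) → v.size ≤ B + c →
      ∀ a' i', (m.set a i v a' i').size ≤ B + c := by
    intro m B c a i v hm hv a' i'
    unfold Mem.set
    split_ifs
    · exact hv
    · exact (hm _ _).trans (Nat.le_add_right _ _)
  have htick : ∀ (c : ℕ) (r : PMF Result) s, some s ∈ (tick c r).support →
      ∃ s', some s' ∈ r.support ∧ s = (s'.1, c + s'.2) := by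
    intro c r s hs
    rw [tick, PMF.support_map] at hs
    obtain ⟨x, hx, hxs⟩ := hs
    cases x with
    | none => simp at hxs
    | some s' => exact ⟨s', hx, by simpa using hxs.symm⟩
  induction d with
  | zero => intro p m B _ _ s hs; simp [Prog.exec] at hs
  | succ d ih =>
    intro p m B hB hm s hs
    cases p with
    | skip =>
      rw [Prog.exec, PMF.support_pure, Set.mem_singleton_iff, Option.some_inj] at hs
      subst hs
      exact fun a i => (hm a i).trans (Nat.le_add_right _ _)
    | assign a i e =>
      rw [Prog.exec, PMF.support_pure, Set.mem_singleton_iff, Option.some_inj] at hs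
      subst hs
      exact hset _ _ _ _ _ _ hm (by dsimp only; omega)
    | rand a i e =>
      rw [Prog.exec, PMF.support_map] at hs
      obtain ⟨v, hv, hvs⟩ := hs
      rw [Option.some_inj] at hvs
      subst hvs
      refine hset _ _ _ _ _ _ hm ?_
      have := Nat.size_le_size (le_of_mem_uniformBelow hv)
      dsimp only; omega
    | coin a i =>
      rw [Prog.exec, PMF.support_map] at hs
      obtain ⟨v, hv, hvs⟩ := hs
      rw [Option.some_inj] at hvs
      subst hvs
      refine hset _ _ _ _ _ _ hm ?_
      have : v.toNat.size ≤ 1 := by cases v <;> simp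
      dsimp only; omega
    | seq p q =>
      rw [Prog.exec, PMF.support_bind] at hs
      simp only [Set.mem_iUnion] at hs
      obtain ⟨r, hr, hs⟩ := hs
      cases r with
      | none => simp at hs
      | some s' =>
        obtain ⟨s'', h1, rfl⟩ := htick _ _ _ hs
        intro a i
        have := ih q s'.1 (B + s'.2) (by omega) (ih p m B hB hm s' hr) s'' h1 a i
        dsimp only; omega
    | ite e p q =>
      rw [Prog.exec] at hs
      obtain ⟨s', h1, rfl⟩ := htick _ _ _ hs
      intro a i
      dsimp only
      split_ifs at h1
      · have := ih p m B hB hm s' h1 a i; omega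
      · have := ih q m B hB hm s' h1 a i; omega
    | loop e p =>
      rw [Prog.exec] at hs
      obtain ⟨s', h1, rfl⟩ := htick _ _ _ hs
      intro a i
      dsimp only
      split_ifs at h1
      · have := ih _ m B hB hm s' h1 a i; omega
      · rw [PMF.support_pure, Set.mem_singleton_iff, Option.some_inj] at h1
        subst h1
        have := hm a i
        dsimp only; omega
    | call a i src len p =>
      rw [Prog.exec, PMF.support_map] at hs
      obtain ⟨x, hx, hxs⟩ := hs
      cases x with
      | none => simp at hxs
      | some s' =>
        simp only [Option.map_some, Option.some_inj] at hxs
        subst hxs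
        exact hset _ _ _ _ _ _ hm (by dsimp only; omega)

theorem size_le_inputCost {x : List ℕ} {v : ℕ} (h : v ∈ x) : v.size ≤ inputCost x := by
  unfold inputCost
  have := List.single_le_sum (l := x.map fun v => 1 + v.size) (by simp) (1 + v.size)
    (List.mem_map_of_mem h)
  omega

theorem ofInput_size_le (x : List ℕ) (a i : ℕ) : (Mem.ofInput x a i).size ≤ inputCost x + 1 := by
  unfold Mem.ofInput
  split_ifs
  · rw [List.getD_eq_getElem?_getD]
    rcases h : x[i]? with _ | v
    · simp
    · have := size_le_inputCost (List.mem_of_getElem? h)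
      simp only [Option.getD_some]; omega
  · simp

/-- A program that computes `D` can be used as a subroutine. -/
theorem Computes.wp_le {p : Prog} {x : List ℕ} {t : ℝ} {D : PMF ℕ} (h : Computes β p x t D)
    (Φ : Mem → ℕ → ℝ≥0∞) (F : ℕ → ℝ≥0∞)
    (hΦ : ∀ m' c, ((inputCost x + c : ℕ) : ℝ) ≤ t → m'.output.size ≤ inputCost x + 1 + c →
      Φ m' c ≤ F m'.output) : wp β p (Mem.ofInput x) Φ ≤ expect D F := by
  obtain ⟨d, E, hE, ht, rfl⟩ := h
  refine (wp_le_depth d _ _ _).trans ?_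
  have hs := size_le_of_mem_support (β := β) d p (Mem.ofInput x) (inputCost x + 1) (by omega)
    (ofInput_size_le x)
  unfold wpDepth
  rw [hE] at hs ⊢
  rw [expect_map, expect_map]
  refine expect_mono_support _ fun r hr => hΦ _ _ (ht r hr) (hs r ?_ 1 0)
  rw [PMF.support_map]
  exact ⟨r, hr, rfl⟩

/-- The strict inequality yields a depth at which the expectation is finite. Exhausted and
over-budget outcomes carry the value `⊤`, hence none of them has positive probability. -/
theorem computes_of_wp_le {p : Prog} {x : List ℕ} {t : ℝ} {c₀ : ℕ} {F : ℕ → ℝ≥0∞} {v : ℝ≥0∞}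
    (h : wp β p (Mem.ofInput x) (fun m' c => ⨅ _ : c ≤ c₀, F m'.output) < v)
    (ht : ((inputCost x + c₀ : ℕ) : ℝ) ≤ t) :
    ∃ D, Computes β p x t D ∧ expect D F ≤ v := by
  obtain ⟨d, hd⟩ := iInf_lt_iff.1 h
  have hne := (hd.trans_le le_top).ne
  have key : ∀ r ∈ (p.exec β d (Mem.ofInput x)).support, ∃ s, r = some s ∧ s.2 ≤ c₀ := by
    intro r hr
    have h2 := lt_of_expect_ne_top hne hr
    cases r with
    | none => simp [onResult] at h2
    | some s =>
      refine ⟨s, rfl, ?_⟩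
      by_contra hc
      simp [onResult, hc] at h2
  set X := p.exec β d (Mem.ofInput x) with hX
  -- The default value is irrelevant, since `none` is not in the support of `X`.
  refine ⟨_, ⟨d, X.map fun r => r.getD (fun _ _ => 0, 0), ?_, ?_, rfl⟩, ?_⟩
  · rw [PMF.map_comp, ← hX]
    have : X.bind (fun r => PMF.pure r) = X.bind fun r =>
        PMF.pure (some (r.getD (fun _ _ => 0, 0))) := by
      ext y
      simp only [PMF.bind_apply]
      refine tsum_congr fun r => ?_
      by_cases hr : r ∈ X.support
      · obtain ⟨s, rfl, _⟩ := key r hr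
        rfl
      · rw [PMF.mem_support_iff, not_not] at hr
        simp [hr]
    rw [PMF.bind_pure] at this
    exact this
  · intro r hr
    rw [PMF.support_map] at hr
    obtain ⟨r', hr', rfl⟩ := hr
    obtain ⟨s, rfl, hs⟩ := key r' hr'
    refine le_trans ?_ ht
    exact_mod_cast Nat.add_le_add_left hs _
  · rw [expect_map, expect_map]
    refine le_trans (expect_mono_support _ fun r hr => ?_) hd.le
    obtain ⟨s, rfl, hs⟩ := key r hr
    simp [onResult, hs]

/-! ## Expressions and blocks -/

instance : Add Expr := ⟨.op .add⟩
instance : Sub Expr := ⟨.op .sub⟩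
instance : Mul Expr := ⟨.op .mul⟩
instance : Div Expr := ⟨.op .div⟩
instance : Mod Expr := ⟨.op .mod⟩
instance (n : ℕ) : OfNat Expr n := ⟨.const n⟩

/-- Cell `i` of array `a`. -/
abbrev cell (a : ℕ) (i : Expr) : Expr := .read a i

@[simp] theorem val_add (m : Mem) (x y : Expr) : (x + y).val m = x.val m + y.val m := rfl
@[simp] theorem val_sub (m : Mem) (x y : Expr) : (x - y).val m = x.val m - y.val m := rfl
@[simp] theorem val_mul (m : Mem) (x y : Expr) : (x * y).val m = x.val m * y.val m := rfl
@[simp] theorem val_div (m : Mem) (x y : Expr) : (x / y).val m = x.val m / y.val m := rfl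
@[simp] theorem val_mod (m : Mem) (x y : Expr) : (x % y).val m = x.val m % y.val m := rfl
@[simp] theorem val_ofNat (m : Mem) (n : ℕ) : (no_index (OfNat.ofNat n) : Expr).val m = n := rfl
@[simp] theorem val_const (m : Mem) (n : ℕ) : (Expr.const n).val m = n := rfl
@[simp] theorem val_read (m : Mem) (a : ℕ) (i : Expr) : (Expr.read a i).val m = m a (i.val m) := rfl
@[simp] theorem val_lt (m : Mem) (x y : Expr) :
    (Expr.op .lt x y).val m = if x.val m < y.val m then 1 else 0 := rfl
@[simp] theorem val_eq (m : Mem) (x y : Expr) :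
    (Expr.op .eq x y).val m = if x.val m = y.val m then 1 else 0 := rfl

/-- All constants in the expression are less than `2 ^ S`. -/
def Expr.Small (S : ℕ) : Expr → Prop
  | const c => c < 2 ^ S
  | read _ i => i.Small S
  | op _ x y => x.Small S ∧ y.Small S

@[simp] theorem small_add (S : ℕ) (x y : Expr) : (x + y).Small S ↔ x.Small S ∧ y.Small S := Iff.rfl
@[simp] theorem small_sub (S : ℕ) (x y : Expr) : (x - y).Small S ↔ x.Small S ∧ y.Small S := Iff.rfl
@[simp] theorem small_mul (S : ℕ) (x y : Expr) : (x * y).Small S ↔ x.Small S ∧ y.Small S := Iff.rfl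
@[simp] theorem small_div (S : ℕ) (x y : Expr) : (x / y).Small S ↔ x.Small S ∧ y.Small S := Iff.rfl
@[simp] theorem small_mod (S : ℕ) (x y : Expr) : (x % y).Small S ↔ x.Small S ∧ y.Small S := Iff.rfl
@[simp] theorem small_op (S : ℕ) (o : Op) (x y : Expr) :
    (Expr.op o x y).Small S ↔ x.Small S ∧ y.Small S := Iff.rfl
@[simp] theorem small_const (S c : ℕ) : (Expr.const c).Small S ↔ c < 2 ^ S := Iff.rfl
@[simp] theorem small_ofNat (S c : ℕ) : (no_index (OfNat.ofNat c) : Expr).Small S ↔ c < 2 ^ S := Iff.rfl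
@[simp] theorem small_read (S a : ℕ) (i : Expr) : (Expr.read a i).Small S ↔ i.Small S := Iff.rfl

/-- The size of the value of an expression, in units of the size of the memory cells. -/
def Expr.width : Expr → ℕ
  | const _ => 1
  | read _ _ => 1
  | op _ x y => x.width + y.width

/-- The cost of an expression, in units of the size of the memory cells. -/
def Expr.weight : Expr → ℕ
  | const _ => 2
  | read _ i => 2 + i.weight + i.width
  | op _ x y => 1 + x.weight + y.weight + x.width + y.width

/-- All memory cells are less than `2 ^ S`. -/
def Bdd (S : ℕ) (m : Mem) : Prop := ∀ a i, m a i < 2 ^ S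

theorem Bdd.set {S : ℕ} {m : Mem} (h : Bdd S m) (a i : ℕ) {v : ℕ} (hv : v < 2 ^ S) :
    Bdd S (m.set a i v) := by
  intro a' i'
  unfold Mem.set
  split_ifs
  · exact hv
  · exact h _ _

theorem Bdd.ofInput {S : ℕ} {x : List ℕ} (h : ∀ v ∈ x, v < 2 ^ S) : Bdd S (Mem.ofInput x) := by
  intro a i
  unfold Mem.ofInput
  split_ifs
  · rw [List.getD_eq_getElem?_getD]
    rcases hi : x[i]? with _ | v
    · simp
    · exact h v (List.mem_of_getElem? hi)
  · positivity

theorem Expr.width_pos : ∀ e : Expr, 0 < e.width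
  | const _ => Nat.one_pos
  | read _ _ => Nat.one_pos
  | op _ x _ => Nat.add_pos_left x.width_pos _

/-- Positive `A` and `B` make both powers at least two, so a sum is bounded by a product of the
powers and one additive notion of width serves all operations. -/
theorem Op.eval_lt (o : Op) {x y A B : ℕ} (hA : 0 < A) (hB : 0 < B) (hx : x < 2 ^ A)
    (hy : y < 2 ^ B) : o.eval x y < 2 ^ (A + B) := by
  have hA2 : 2 ≤ 2 ^ A := Nat.le_self_pow hA.ne' 2
  have hB2 : 2 ≤ 2 ^ B := Nat.le_self_pow hB.ne' 2
  rw [pow_add]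
  have hle : x < 2 ^ A * 2 ^ B := by nlinarith
  cases o with
  | add => show x + y < _; nlinarith
  | sub => exact lt_of_le_of_lt (Nat.sub_le _ _) hle
  | mul => exact Nat.mul_lt_mul'' hx hy
  | div => exact lt_of_le_of_lt (Nat.div_le_self _ _) hle
  | mod => exact lt_of_le_of_lt (Nat.mod_le _ _) hle
  | lt => show (if x < y then 1 else 0) < _; split_ifs <;> nlinarith
  | eq => show (if x = y then 1 else 0) < _; split_ifs <;> nlinarith

theorem Expr.val_lt_two_pow {S : ℕ} (hS : 0 < S) {m : Mem} (hm : Bdd S m) :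
    ∀ e : Expr, e.Small S → e.val m < 2 ^ (e.width * S)
  | const c, h => by simpa [Expr.width] using h
  | read a i, _ => by simpa [Expr.width] using hm a (i.val m)
  | op o x y, h => by
      rw [Expr.width, add_mul]
      exact Op.eval_lt o (Nat.mul_pos x.width_pos hS) (Nat.mul_pos y.width_pos hS)
        (val_lt_two_pow hS hm x h.1) (val_lt_two_pow hS hm y h.2)

theorem Expr.size_val_le {S : ℕ} (hS : 0 < S) {m : Mem} (hm : Bdd S m) {e : Expr}
    (h : e.Small S) : (e.val m).size ≤ e.width * S :=
  Nat.size_le.2 (e.val_lt_two_pow hS hm h)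

theorem Expr.cost_le {S : ℕ} (hS : 0 < S) {m : Mem} (hm : Bdd S m) :
    ∀ e : Expr, e.Small S → e.cost m ≤ e.weight * S
  | const c, h => by
      have : c.size ≤ S := Nat.size_le.2 h
      simp only [Expr.cost, Expr.weight]; omega
  | read a i, h => by
      have h1 := cost_le hS hm i h
      have h2 := Expr.size_val_le hS hm (e := i) h
      have h3 : (m a (i.val m)).size ≤ S := Nat.size_le.2 (hm _ _)
      simp only [Expr.cost, Expr.weight, add_mul]; omega
  | op o x y, h => by
      have h1 := cost_le hS hm x h.1
      have h2 := Expr.size_val_le hS hm (e := x) h.1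
      have h3 := cost_le hS hm y h.2
      have h4 := Expr.size_val_le hS hm (e := y) h.2
      simp only [Expr.cost, Expr.weight, add_mul]; omega

/-- Sequential composition of a list of programs. -/
def block : List Prog → Prog
  | [] => .skip
  | p :: ps => .seq p (block ps)

/-! ## Weakest preconditions with a budget -/

/-- The expectation of `F` on the final memory, infinite unless the run certainly halts at a cost of
at most `k` units, where a unit is `100 * S`. -/
def wpc (β : PMF Bool) (S : ℕ) (p : Prog) (m : Mem) (k : ℕ) (F : Mem → ℝ≥0∞) : ℝ≥0∞ :=
  wp β p m fun m' c => ⨅ _ : c ≤ k * (100 * S), F m'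

theorem wpc_mono {S : ℕ} {p : Prog} {m : Mem} {k : ℕ} {F G : Mem → ℝ≥0∞} (h : ∀ m', F m' ≤ G m') :
    wpc β S p m k F ≤ wpc β S p m k G :=
  wp_mono (fun m' _ => iInf_mono fun _ => h m') _ _

theorem wpc_budget {S : ℕ} {p : Prog} {m : Mem} {k k' : ℕ} (h : k ≤ k') {F : Mem → ℝ≥0∞}
    {v : ℝ≥0∞} (H : wpc β S p m k F ≤ v) : wpc β S p m k' F ≤ v := by
  refine le_trans (wp_mono (fun m' c => ?_) _ _) H
  refine le_iInf fun hc => iInf_le_of_le (hc.trans (Nat.mul_le_mul_right _ h)) le_rfl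

theorem wpc_add {S : ℕ} (p : Prog) (m : Mem) (k : ℕ) (F G : Mem → ℝ≥0∞) :
    wpc β S p m k (fun m' => F m' + G m') = wpc β S p m k F + wpc β S p m k G := by
  unfold wpc
  rw [← wp_add]
  congr 1
  funext m' c
  by_cases h : c ≤ k * (100 * S) <;> simp [h]

theorem wpc_seq {S : ℕ} {p q : Prog} {m : Mem} {k₁ k₂ : ℕ} {F : Mem → ℝ≥0∞} :
    wpc β S (.seq p q) m (k₁ + k₂) F ≤ wpc β S p m k₁ fun m' => wpc β S q m' k₂ F := by
  refine (wp_seq_le _ _ _ _).trans (wp_mono (fun m' c => le_iInf fun hc => ?_) _ _)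
  refine wp_mono (fun m'' c' => le_iInf fun hc' => iInf_le_of_le ?_ le_rfl) _ _
  rw [add_mul]; omega

theorem wpc_nil {S : ℕ} (hS : 0 < S) {m : Mem} {k : ℕ} {F : Mem → ℝ≥0∞} {v : ℝ≥0∞}
    (h : F m ≤ v) : wpc β S (block []) m (k + 1) F ≤ v := by
  refine (wp_skip_le _ _).trans (iInf_le_of_le ?_ h)
  nlinarith

theorem wpc_cons {S : ℕ} {p : Prog} {ps : List Prog} {m : Mem} {k₁ k₂ : ℕ} {F : Mem → ℝ≥0∞}
    {v : ℝ≥0∞} (h : wpc β S p m k₁ (fun m' => wpc β S (block ps) m' k₂ F) ≤ v) :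
    wpc β S (block (p :: ps)) m (k₂ + k₁) F ≤ v := by
  rw [add_comm]
  exact wpc_seq.trans h

/-- A purely syntactic bound on weights and widths makes an assignment cost at most one unit of `100
* S`. Running times can then be found by counting statements. -/
theorem wpc_assign_one {S : ℕ} (hS : 0 < S) {a : ℕ} {i e : Expr} {m : Mem} (hm : Bdd S m)
    (hi : i.Small S) (he : e.Small S) (hw : i.weight + e.weight + i.width + e.width < 100)
    (F : Mem → ℝ≥0∞) : wpc β S (.assign a i e) m 1 F ≤ F (m.set a (i.val m) (e.val m)) := by
  refine (wp_assign_le _ _ _ _ _).trans (iInf_le_of_le ?_ le_rfl)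
  have h1 := i.cost_le hS hm hi
  have h2 := e.cost_le hS hm he
  have h3 := Expr.size_val_le hS hm hi
  have h4 := Expr.size_val_le hS hm he
  nlinarith

theorem wpc_assign {S : ℕ} (hS : 0 < S) {a : ℕ} {i e : Expr} {ps : List Prog} {m : Mem} {k : ℕ}
    {F : Mem → ℝ≥0∞} {v : ℝ≥0∞} (i' w : ℕ) (hm : Bdd S m)
    (hw : i.weight + e.weight + i.width + e.width < 100)
    (hs : i.Small S ∧ e.Small S) (hi : i.val m = i') (he : e.val m = w) (hv : w < 2 ^ S)
    (h : Bdd S (m.set a i' w) → wpc β S (block ps) (m.set a i' w) k F ≤ v) :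
    wpc β S (block (.assign a i e :: ps)) m (k + 1) F ≤ v := by
  refine wpc_cons ((wpc_assign_one hS hm hs.1 hs.2 hw _).trans ?_)
  rw [hi, he]
  exact h (hm.set _ _ hv)

theorem wpc_coin {S : ℕ} (hS : 0 < S) {a : ℕ} {i : Expr} {ps : List Prog} {m : Mem} {k : ℕ}
    {F : Mem → ℝ≥0∞} {v : ℝ≥0∞} (i' : ℕ) (hm : Bdd S m) (hw : i.weight + i.width < 98)
    (hs : i.Small S) (hi : i.val m = i')
    (h : (∀ c : Bool, Bdd S (m.set a i' c.toNat)) →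
      expect β (fun c => wpc β S (block ps) (m.set a i' c.toNat) k F) ≤ v) :
    wpc β S (block (.coin a i :: ps)) m (k + 1) F ≤ v := by
  refine wpc_cons ((wp_coin_le _ _ _ _).trans ?_)
  rw [hi]
  refine le_trans (expect_mono _ fun c => iInf_le_of_le ?_ le_rfl) (h fun c => hm.set _ _ ?_)
  · have h1 := i.cost_le hS hm hs
    have h2 := Expr.size_val_le hS hm hs
    rw [hi] at h2
    nlinarith
  · have := Nat.pow_le_pow_right (n := 2) (by norm_num) hS
    cases c <;> simp <;> omega

theorem wpc_rand {S : ℕ} (hS : 0 < S) {a : ℕ} {i e : Expr} {ps : List Prog} {m : Mem} {k : ℕ}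
    {F : Mem → ℝ≥0∞} {v : ℝ≥0∞} (i' w : ℕ) (hm : Bdd S m)
    (hw : i.weight + e.weight + i.width + e.width < 100)
    (hs : i.Small S ∧ e.Small S) (hi : i.val m = i') (he : e.val m = w) (hv : w < 2 ^ S)
    (h0 : 0 < w)
    (h : (∀ u, u < w → Bdd S (m.set a i' u)) →
      (∑ u ∈ Finset.range w, wpc β S (block ps) (m.set a i' u) k F) / w ≤ v) :
    wpc β S (block (.rand a i e :: ps)) m (k + 1) F ≤ v := by
  refine wpc_cons ((wp_rand_le _ _ _ _ _).trans ?_)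
  rw [he, expect_uniformBelow h0, hi]
  refine le_trans ?_ (h fun u hu => hm.set _ _ (hu.trans hv))
  gcongr with u hu
  refine iInf_le_of_le ?_ le_rfl
  have h1 := i.cost_le hS hm hs.1
  have h2 := e.cost_le hS hm hs.2
  have h3 := Expr.size_val_le hS hm hs.1
  have h4 := Expr.size_val_le hS hm hs.2
  rw [hi] at h3
  rw [he] at h4
  nlinarith

theorem wpc_ite {S : ℕ} (hS : 0 < S) {e : Expr} {p q : Prog} {ps : List Prog} {m : Mem}
    {k₁ k : ℕ} {F : Mem → ℝ≥0∞} {v : ℝ≥0∞} (hm : Bdd S m) (hw : e.weight < 99)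
    (hs : e.Small S)
    (h1 : e.val m ≠ 0 → wpc β S p m k₁ (fun m' => wpc β S (block ps) m' k F) ≤ v)
    (h2 : e.val m = 0 → wpc β S q m k₁ (fun m' => wpc β S (block ps) m' k F) ≤ v) :
    wpc β S (block (.ite e p q :: ps)) m (k + (k₁ + 1)) F ≤ v := by
  refine wpc_cons ((wp_ite_le _ _ _ _ _).trans ?_)
  have hc := e.cost_le hS hm hs
  split_ifs with h
  · refine le_trans (wp_mono (fun m' c => le_iInf fun hcc => iInf_le_of_le ?_ le_rfl) _ _) (h1 h)
    nlinarith
  · rw [not_not] at h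
    refine le_trans (wp_mono (fun m' c => le_iInf fun hcc => iInf_le_of_le ?_ le_rfl) _ _) (h2 h)
    nlinarith

/-- With `j` iterations left, `I j` is an invariant and `V j` a potential that must not grow in
expectation. The infimum over `I j m'` is `⊤` where the invariant fails, so a finite bound in `H`
also forces the body to restore the invariant with certainty. -/
theorem wpc_loop_one {S : ℕ} (hS : 0 < S) {e : Expr} {p : Prog} {kb : ℕ}
    {F : Mem → ℝ≥0∞} (I : ℕ → Mem → Prop) (V : ℕ → Mem → ℝ≥0∞) (hw : e.weight < 99)
    (hs : e.Small S) (hB : ∀ j m, I j m → Bdd S m) (h0 : ∀ m, I 0 m → e.val m = 0)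
    (h1 : ∀ j m, I (j + 1) m → e.val m ≠ 0)
    (H : ∀ j m, I (j + 1) m → wpc β S p m kb (fun m' => ⨅ _ : I j m', V j m') ≤ V (j + 1) m)
    (HF : ∀ m, I 0 m → F m ≤ V 0 m) :
    ∀ N m, I N m → wpc β S (.loop e p) m (N * (kb + 1) + 1) F ≤ V N m := by
  intro N
  induction N with
  | zero =>
    intro m hI
    refine (wp_loop_le _ _ _ _).trans ?_
    rw [if_neg (not_not.2 (h0 m hI))]
    refine iInf_le_of_le ?_ (HF m hI)
    have hc := e.cost_le hS (hB _ _ hI) hs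
    nlinarith
  | succ j ih =>
    intro m hI
    refine (wp_loop_le _ _ _ _).trans ?_
    rw [if_pos (h1 j m hI)]
    refine le_trans ?_ (H j m hI)
    refine le_trans ?_ (wpc_mono (G := fun m' => ⨅ _ : I j m', V j m')
      (F := fun m' => wpc β S (.loop e p) m' (j * (kb + 1) + 1) F) fun m' => le_iInf fun h => ih m' h)
    refine le_trans ?_ wpc_seq
    refine wp_mono (fun m' c => le_iInf fun hcc => iInf_le_of_le ?_ le_rfl) _ _
    have hc := e.cost_le hS (hB _ _ hI) hs
    nlinarith

theorem wpc_loop {S : ℕ} (hS : 0 < S) {e : Expr} {p : Prog} {ps : List Prog} {kb k N : ℕ}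
    {m : Mem} {F : Mem → ℝ≥0∞} (I : ℕ → Mem → Prop) (V : ℕ → Mem → ℝ≥0∞) (hw : e.weight < 99)
    (hs : e.Small S) (hB : ∀ j m, I j m → Bdd S m) (h0 : ∀ m, I 0 m → e.val m = 0)
    (h1 : ∀ j m, I (j + 1) m → e.val m ≠ 0)
    (H : ∀ j m, I (j + 1) m → wpc β S p m kb (fun m' => ⨅ _ : I j m', V j m') ≤ V (j + 1) m)
    (HF : ∀ m, I 0 m → wpc β S (block ps) m k F ≤ V 0 m) (hI : I N m) :
    wpc β S (block (.loop e p :: ps)) m (k + (N * (kb + 1) + 1)) F ≤ V N m :=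
  wpc_cons (wpc_loop_one hS I V hw hs hB h0 h1 H HF N m hI)

theorem inputCost_le {S : ℕ} (hS : 0 < S) {x : List ℕ} (h : ∀ v ∈ x, v < 2 ^ S) :
    inputCost x ≤ x.length * (2 * S) := by
  unfold inputCost
  refine (List.sum_le_card_nsmul _ (2 * S) ?_).trans ?_
  · intro c hc
    obtain ⟨v, hv, rfl⟩ := List.mem_map.1 hc
    have := Nat.size_le.2 (h v hv)
    omega
  · simp

/-- The callee works on its own memory, about which nothing is assumed; only its output must be
small, as it is charged on return and stored. -/
theorem wpc_call {S : ℕ} (hS : 0 < S) {a : ℕ} {i : Expr} {src : ℕ} {len : Expr} {p : Prog}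
    {ps : List Prog} {m : Mem} {kp k : ℕ} {F : Mem → ℝ≥0∞} {v : ℝ≥0∞} (i' n : ℕ) (x : List ℕ)
    (hm : Bdd S m) (hw : i.weight + i.width + len.weight < 97)
    (hs : i.Small S ∧ len.Small S) (hi : i.val m = i') (hn : len.val m = n)
    (hx : (List.range n).map (m src) = x)
    (h : (∀ y, y < 2 ^ S → Bdd S (m.set a i' y)) → wpc β S p (Mem.ofInput x) kp
      (fun m' => ⨅ _ : m'.output < 2 ^ S, wpc β S (block ps) (m.set a i' m'.output) k F) ≤ v) :
    wpc β S (block (.call a i src len p :: ps)) m (k + (kp + n + 1)) F ≤ v := by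
  refine wpc_cons ((wp_call_le _ _ _ _ _ _ _).trans ?_)
  have hxx : callInput src len m = x := by rw [callInput, hn, hx]
  have hxc : inputCost x ≤ n * (2 * S) := by
    have := inputCost_le hS (x := x) (by
      rw [← hx]
      intro v hv
      obtain ⟨j, -, rfl⟩ := List.mem_map.1 hv
      exact hm _ _)
    rwa [← hx, List.length_map, List.length_range, hx] at this
  rw [hxx, hi]
  refine le_trans ?_ (h fun y hy => hm.set _ _ hy)
  refine wp_mono (fun m' c => le_iInf fun hc => le_iInf fun ho => iInf_le_of_le ?_ le_rfl) _ _
  have h1 := i.cost_le hS hm hs.1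
  have h2 := len.cost_le hS hm hs.2
  have h3 := Expr.size_val_le hS hm hs.1
  rw [hi] at h3
  have h4 := Nat.size_le.2 ho
  have h5 : (i.weight + i.width + len.weight) * S ≤ 96 * S := Nat.mul_le_mul_right _ (by omega)
  have h6 : n * (2 * S) ≤ n * (100 * S) := Nat.mul_le_mul_left _ (by omega)
  simp only [add_mul] at h5 ⊢
  omega

/-- On input `x` the program `p` certainly outputs `y`, at a cost of at most `k` units. -/
def Evaluates (β : PMF Bool) (S : ℕ) (p : Prog) (x : List ℕ) (k : ℕ) (y : ℕ) : Prop :=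
  ∀ G : ℕ → ℝ≥0∞, wpc β S p (Mem.ofInput x) k (fun m' => G m'.output) ≤ G y

theorem wpc_call_of_evaluates {S : ℕ} (hS : 0 < S) {a : ℕ} {i : Expr} {src : ℕ} {len : Expr}
    {p : Prog} {ps : List Prog} {m : Mem} {kp k : ℕ} {F : Mem → ℝ≥0∞} {v : ℝ≥0∞} (i' n : ℕ)
    (x : List ℕ) (y : ℕ) (hm : Bdd S m) (hw : i.weight + i.width + len.weight < 97)
    (hs : i.Small S ∧ len.Small S) (hi : i.val m = i') (hn : len.val m = n)
    (hx : (List.range n).map (m src) = x) (hp : Evaluates β S p x kp y) (hy : y < 2 ^ S)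
    (h : Bdd S (m.set a i' y) → wpc β S (block ps) (m.set a i' y) k F ≤ v) :
    wpc β S (block (.call a i src len p :: ps)) m (k + (kp + n + 1)) F ≤ v := by
  refine wpc_call hS i' n x hm hw hs hi hn hx fun hB => ?_
  refine (hp fun y => ⨅ _ : y < 2 ^ S, wpc β S (block ps) (m.set a i' y) k F).trans ?_
  exact iInf_le_of_le hy (h (hB y hy))

/-! ## Deterministic subroutines -/

theorem lt_two_pow_of_le_hundred {S : ℕ} (hS : 7 ≤ S) (c : ℕ) (h : c ≤ 100) : c < 2 ^ S :=
  lt_of_lt_of_le (by omega : c < 2 ^ 7) (Nat.pow_le_pow_right (by norm_num) hS)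

theorem ofInput_zero (x : List ℕ) (i : ℕ) : Mem.ofInput x 0 i = x.getD i 0 := by
  simp [Mem.ofInput]

theorem ofInput_ne_zero (x : List ℕ) {a : ℕ} (ha : a ≠ 0) (i : ℕ) : Mem.ofInput x a i = 0 := by
  simp [Mem.ofInput, ha]

theorem Mem.set_apply (m : Mem) (a i v a' i' : ℕ) :
    m.set a i v a' i' = if a' = a ∧ i' = i then v else m a' i' := rfl

/-- Input `[x, e]`, output `x ^ e`. -/
def powProg : Prog := block
  [.assign 1 0 1,
   .loop (cell 0 1) (block
    [.assign 1 0 (cell 1 0 * cell 0 0),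
     .assign 0 1 (cell 0 1 - 1)])]

theorem powProg_evaluates {S : ℕ} (hS : 7 ≤ S) {x e : ℕ} (hx : x < 2 ^ S) (hx0 : 0 < x)
    (he : e < 2 ^ S) (hxe : x ^ e < 2 ^ S) :
    Evaluates β S powProg [x, e] (4 * e + 3) (x ^ e) := by
  intro G
  have h0 : 0 < S := by omega
  have hc := lt_two_pow_of_le_hundred hS
  have hB : Bdd S (Mem.ofInput [x, e]) := Bdd.ofInput (by simp [hx, he])
  refine wpc_budget (k := 1 + (e * (3 + 1) + 1) + 1) (by omega) ?_
  refine wpc_assign h0 0 1 hB (by decide) (by simp [hc]) rfl rfl (hc 1 (by norm_num)) fun hB => ?_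
  refine wpc_loop h0 (fun j m => Bdd S m ∧ m 0 0 = x ∧ m 0 1 = j ∧ m 1 0 * x ^ j = x ^ e)
    (fun _ _ => G (x ^ e)) (by decide) (by simp [hc]) (fun j m h => h.1) (fun m h => by simp [h.2.2.1])
    (fun j m h => by simp [h.2.2.1]) ?_ ?_ ?_
  · rintro j m ⟨hB, hm0, hm1, hm⟩
    -- As `x` is positive, no intermediate power exceeds the final one.
    have hle : m 1 0 * x < 2 ^ S := by
      refine lt_of_le_of_lt ?_ hxe
      rw [← hm, pow_succ']
      nlinarith [Nat.one_le_pow j x hx0, Nat.zero_le (m 1 0 * x)]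
    refine wpc_assign h0 0 (m 1 0 * x) hB (by decide) (by simp [hc]) rfl (by simp [hm0]) hle
      fun hB => ?_
    refine wpc_assign h0 1 j hB (by decide) (by simp [hc]) rfl (by simp [Mem.set_apply, hm1]) ?_
      fun hB => ?_
    · have := hB 0 1
      simp [Mem.set_apply, hm1] at this
      omega
    refine wpc_nil h0 (iInf_le_of_le ⟨hB, ?_⟩ le_rfl)
    simp [Mem.set_apply, hm0, ← hm, pow_succ']
    ring
  · rintro m ⟨hB, hm0, hm1, hm⟩
    refine wpc_nil h0 ?_
    simp at hm
    simp [Mem.output, hm]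
  · simp [Mem.set_apply, Mem.ofInput, hB]

/-- Input `[n]`, output the bit length of `n`. -/
def sizeProg : Prog := block
  [.loop (cell 0 0) (block
    [.assign 0 0 (cell 0 0 / 2),
     .assign 1 0 (cell 1 0 + 1)])]

theorem size_div_two {q j : ℕ} (h : q.size = j + 1) : (q / 2).size = j := by
  have h0 : q ≠ 0 := by rintro rfl; simp at h
  apply le_antisymm
  · rw [Nat.size_le]
    have := Nat.lt_size_self q
    rw [h, pow_succ] at this
    omega
  · by_contra hlt
    have h1 : q / 2 < 2 ^ (j - 1) := Nat.size_le.1 (by omega)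
    have h2 : q.size ≤ j := by
      rw [Nat.size_le]
      rcases j with _ | j
      · omega
      · rw [pow_succ]
        simp at h1
        omega
    omega

theorem sizeProg_evaluates {S : ℕ} (hS : 7 ≤ S) {n : ℕ} (hn : n < 2 ^ S) :
    Evaluates β S sizeProg [n] (4 * S + 2) n.size := by
  intro G
  have h0 : 0 < S := by omega
  have hc := lt_two_pow_of_le_hundred hS
  have hsz : n.size ≤ S := Nat.size_le.2 hn
  have hB : Bdd S (Mem.ofInput [n]) := Bdd.ofInput (by simp [hn])
  refine wpc_budget (k := 0 + 1 + (n.size * (3 + 1) + 1)) (by omega) ?_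
  refine wpc_loop h0 (fun j m => Bdd S m ∧ (m 0 0).size = j ∧ m 1 0 + j = n.size)
    (fun _ _ => G n.size) (by decide) (by simp [hc]) (fun j m h => h.1)
    (fun m h => by simpa [Nat.size_eq_zero] using h.2.1) (fun j m h h' => ?_) ?_ ?_ ?_
  · simp at h'
    simp [h'] at h
  · rintro j m ⟨hB, hm, hm1⟩
    refine wpc_assign h0 0 (m 0 0 / 2) hB (by decide) (by simp [hc]) rfl (by simp)
      ((Nat.div_le_self _ _).trans_lt (hB 0 0)) fun hB => ?_
    refine wpc_assign h0 0 (m 1 0 + 1) hB (by decide) (by simp [hc]) rfl (by simp [Mem.set_apply])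
      ((by omega : m 1 0 + 1 ≤ S).trans_lt Nat.lt_two_pow_self) fun hB => ?_
    refine wpc_nil h0 (iInf_le_of_le ⟨hB, ?_, ?_⟩ le_rfl)
    · simpa [Mem.set_apply] using size_div_two hm
    · simp [Mem.set_apply]; omega
  · rintro m ⟨hB, hm, hm1⟩
    refine wpc_nil h0 ?_
    simp at hm1
    simp [Mem.output, hm1]
  · simp [ofInput_ne_zero, ofInput_zero, hB]

/-- Input `[J, t, d]`, output `2` to the power of the sum of the quotients by `a` of the `d` lowest
digits of `J` in base `t`. -/
def weightProg (a : ℕ) : Prog := block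
  [.assign 2 0 2,
   .loop (cell 0 2) (block
    [.assign 2 1 (cell 2 1 + cell 0 0 % cell 0 1 / .const a),
     .assign 0 0 (cell 0 0 / cell 0 1),
     .assign 0 2 (cell 0 2 - 1)]),
   .call 1 0 2 2 powProg]

/-- Digit number `q` of `J` in base `t`. -/
def digit (t J q : ℕ) : ℕ := J / t ^ q % t

/-- The exponent of the weight of `J`. -/
def levelSum (a t d J : ℕ) : ℕ := ∑ q ∈ Finset.range d, digit t J q / a

/-- Share `j` of an entry has the coefficient `2 ^ (j / a)`. The product of the coefficients
selected by the digits of `J` therefore has the sum of the quotients as its exponent. -/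
theorem weightProg_evaluates {S : ℕ} (hS : 7 ≤ S) {a t d J : ℕ} (ha : a < 2 ^ S) (ht : t < 2 ^ S)
    (hd : d ≤ S) (hJ : J < 2 ^ S) (hw : levelSum a t d J < S) :
    Evaluates β S (weightProg a) [J, t, d] (10 * S) (2 ^ levelSum a t d J) := by
  intro G
  have h0 : 0 < S := by omega
  have hc := lt_two_pow_of_le_hundred hS
  have hd' : d < 2 ^ S := hd.trans_lt Nat.lt_two_pow_self
  have hSS : S < 2 ^ S := Nat.lt_two_pow_self
  have hB : Bdd S (Mem.ofInput [J, t, d]) := Bdd.ofInput (by simp [hJ, ht, hd'])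
  refine wpc_budget (k := 0 + 1 + ((4 * levelSum a t d J + 3) + 2 + 1) + (d * (4 + 1) + 1) + 1)
    (by omega) ?_
  refine wpc_assign h0 0 2 hB (by decide) (by simp [hc]) rfl rfl (hc 2 (by norm_num)) fun hB => ?_
  refine wpc_loop h0 (fun j m => Bdd S m ∧ m 2 0 = 2 ∧ m 0 1 = t ∧ m 0 2 = j ∧
      ∃ i, i + j = d ∧ m 0 0 = J / t ^ i ∧ m 2 1 = levelSum a t i J)
    (fun _ _ => G (2 ^ levelSum a t d J)) (by decide) (by simp [hc]) (fun j m h => h.1)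
    (fun m h => by simp [h.2.2.2.1]) (fun j m h => by simp [h.2.2.2.1]) ?_ ?_ ?_
  · rintro j m ⟨hB, hm20, hm01, hm02, i, hi, hm00, hm21⟩
    have e1 : levelSum a t (i + 1) J = levelSum a t i J + J / t ^ i % t / a := by
      rw [levelSum, Finset.sum_range_succ]; rfl
    have e2 : levelSum a t (i + 1) J ≤ levelSum a t d J :=
      Finset.sum_le_sum_of_subset (by simpa using by omega)
    refine wpc_assign h0 1 (levelSum a t (i + 1) J) hB
      (Nat.le_of_ble_eq_true rfl) (by simp [hc, ha]) rfl
      (by simp [hm21, hm00, hm01, e1]) (by omega) fun hB => ?_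
    refine wpc_assign h0 0 (J / t ^ (i + 1)) hB (by decide) (by simp [hc]) rfl
      (by simp [Mem.set_apply, hm00, hm01, Nat.div_div_eq_div_mul, pow_succ])
      ((Nat.div_le_self _ _).trans_lt hJ) fun hB => ?_
    refine wpc_assign h0 2 j hB (by decide) (by simp [hc]) rfl (by simp [Mem.set_apply, hm02])
      (by omega) fun hB => ?_
    refine wpc_nil h0 (iInf_le_of_le ⟨hB, ?_, ?_, ?_, i + 1, by omega, ?_, ?_⟩ le_rfl)
    all_goals simp [Mem.set_apply, hm20, hm01]
  · rintro m ⟨hBm, hm20, hm01, hm02, i, hi, hm00, hm21⟩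
    obtain rfl : i = d := by omega
    have hp : 2 ^ levelSum a t i J < 2 ^ S := Nat.pow_lt_pow_right (by norm_num) hw
    refine wpc_call_of_evaluates h0 0 2 [2, levelSum a t i J] (2 ^ levelSum a t i J) hBm (by decide)
      (by simp [hc]) rfl rfl (by simp [List.range_succ, hm20, hm21])
      (powProg_evaluates hS (hc 2 (by norm_num)) (by norm_num) (by omega) hp) hp fun hB => ?_
    exact wpc_nil h0 (by simp [Mem.output, Mem.set_apply])
  · refine ⟨hB, ?_, ?_, ?_, 0, ?_⟩ <;> simp [Mem.set_apply, Mem.ofInput, levelSum]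

/-- Input `[o, n, g, B, Z, J, t]`, output the entry at offset `o` of the instance with number `J`,
where `Z` is the shared entry at offset `o`. -/
def entryProg : Prog := block
  [.assign 2 0 (1 + cell 0 2 * cell 0 3),
   .assign 3 0 (cell 0 0 % cell 2 0),
   .ite (cell 3 0) (block
    [.assign 5 0 (cell 0 6),
     .assign 5 1 (cell 0 0 / cell 2 0 / (cell 0 1 * cell 0 1) * cell 0 2 + (cell 3 0 - 1) / cell 0 3),
     .call 6 0 5 2 powProg,
     .assign 5 0 2,
     .assign 5 1 (cell 0 5 / cell 6 0 % cell 0 6),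
     .call 6 0 5 2 powProg,
     .assign 1 0 (cell 0 4 / cell 6 0 % 2)])
    (block [.assign 1 0 1])]

/-- The number of the part of the variable at offset `o`. -/
def partAt (n g B o : ℕ) : ℕ := o / (1 + g * B) / (n * n) * g + (o % (1 + g * B) - 1) / B

/-- The entry at offset `o` of the instance with number `J`. -/
def entryAt (n g B t J o Z : ℕ) : ℕ :=
  if o % (1 + g * B) = 0 then 1 else Z / 2 ^ digit t J (partAt n g B o) % 2

/-- Each edge occupies `1 + g * B` cells, headed by its presence bit. Division with remainder
recovers the class of a cell from its offset, and the digit of `J` at that class selects the share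
to read. Presence bits are always `1`, because queries are complete; for them `partAt` is
meaningless, hence the restriction in `hp`. -/
theorem entryProg_evaluates {S : ℕ} (hS : 7 ≤ S) {o n g B Z J t : ℕ} (ho : o < 2 ^ S)
    (hn : n < 2 ^ S) (hg : g < 2 ^ S) (hB0 : B < 2 ^ S) (hZ : Z < 2 ^ S) (hJ : J < 2 ^ S)
    (ht : t ≤ S) (ht0 : 0 < t) (hE : 1 + g * B < 2 ^ S)
    (hp : o % (1 + g * B) ≠ 0 → partAt n g B o ≤ S ∧ t ^ partAt n g B o < 2 ^ S) :
    Evaluates β S entryProg [o, n, g, B, Z, J, t] (10 * S + 20) (entryAt n g B t J o Z) := by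
  intro G
  have h0 : 0 < S := by omega
  have hc := lt_two_pow_of_le_hundred hS
  have hSS : S < 2 ^ S := Nat.lt_two_pow_self
  have htS : t < 2 ^ S := by omega
  have hB : Bdd S (Mem.ofInput [o, n, g, B, Z, J, t]) :=
    Bdd.ofInput (by simp [ho, hn, hg, hB0, hZ, hJ, htS])
  refine wpc_budget (k := 0 + 1 + ((8 * S + 14) + 1) + 1 + 1) (by omega) ?_
  refine wpc_assign h0 0 (1 + g * B) hB (by decide) (by simp [hc]) rfl (by simp [Mem.ofInput]) hE
    fun hB => ?_
  refine wpc_assign h0 0 (o % (1 + g * B)) hB (by decide) (by simp [hc]) rfl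
    (by simp [Mem.ofInput, Mem.set_apply]) ((Nat.mod_le _ _).trans_lt ho) fun hB => ?_
  refine wpc_ite h0 hB (by decide) (by simp [hc]) ?_ ?_
  · intro hne
    have hne : o % (1 + g * B) ≠ 0 := by simpa [Mem.set_apply] using hne
    obtain ⟨hpS, hpt⟩ := hp hne
    have hdt : digit t J (partAt n g B o) < t := Nat.mod_lt _ ht0
    have hd2 : 2 ^ digit t J (partAt n g B o) < 2 ^ S := Nat.pow_lt_pow_right (by norm_num) (by omega)
    refine wpc_budget (k := 0 + 1 + 1 + ((4 * digit t J (partAt n g B o) + 3) + 2 + 1) + 1 + 1 +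
      ((4 * partAt n g B o + 3) + 2 + 1) + 1 + 1) (by omega) ?_
    refine wpc_assign h0 0 t hB (by decide) (by simp [hc]) rfl
      (by simp [Mem.ofInput, Mem.set_apply]) htS fun hB => ?_
    refine wpc_assign h0 1 (partAt n g B o) hB (by decide) (by simp [hc]) rfl
      (by simp [Mem.ofInput, Mem.set_apply, partAt]) (by omega) fun hB => ?_
    refine wpc_call_of_evaluates h0 0 2 [t, partAt n g B o] (t ^ partAt n g B o) hB (by decide)
      (by simp [hc]) rfl rfl (by simp [List.range_succ, Mem.set_apply])
      (powProg_evaluates hS htS ht0 (by omega) hpt) hpt fun hB => ?_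
    refine wpc_assign h0 0 2 hB (by decide) (by simp [hc]) rfl rfl (hc 2 (by norm_num)) fun hB => ?_
    refine wpc_assign h0 1 (digit t J (partAt n g B o)) hB (by decide) (by simp [hc]) rfl
      (by simp [Mem.ofInput, Mem.set_apply, digit]) (by omega) fun hB => ?_
    refine wpc_call_of_evaluates h0 0 2 [2, digit t J (partAt n g B o)]
      (2 ^ digit t J (partAt n g B o)) hB (by decide)
      (by simp [hc]) rfl rfl (by simp [List.range_succ, Mem.set_apply])
      (powProg_evaluates hS (hc 2 (by norm_num)) (by norm_num) (by omega) hd2) hd2 fun hB => ?_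
    refine wpc_assign h0 0 (entryAt n g B t J o Z) hB (by decide) (by simp [hc]) rfl
      (by simp [Mem.ofInput, Mem.set_apply, entryAt, hne]) ?_ fun hB => ?_
    · rw [entryAt, if_neg hne]
      exact (Nat.mod_lt _ (by norm_num)).trans (hc 2 (by norm_num))
    refine wpc_nil h0 (wpc_nil h0 ?_)
    simp [Mem.output, Mem.set_apply]
  · intro he
    have he : o % (1 + g * B) = 0 := by simpa [Mem.set_apply] using he
    refine wpc_budget (k := 0 + 1 + 1) (by omega) ?_
    refine wpc_assign h0 0 1 hB (by decide) (by simp [hc]) rfl rfl (hc 1 (by norm_num)) fun hB => ?_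
    refine wpc_nil h0 (wpc_nil h0 ?_)
    simp [Mem.output, Mem.set_apply, entryAt, he]

/-! ## A coin with a linearly transformed bias -/

/-- The expectation of `h` of the number of successes in `j` tosses, starting the count at `K`. -/
def tossSum (β : PMF Bool) (h : ℕ → ℝ≥0∞) : ℕ → ℕ → ℝ≥0∞
  | 0, K => h K
  | j + 1, K => expect β fun c => tossSum β h j (K + c.toNat)

theorem expect_bool (β : PMF Bool) (f : Bool → ℝ≥0∞) :
    expect β f = β true * f true + β false * f false := by
  rw [expect_eq_sum, Fintype.sum_bool]

theorem coin_add (β : PMF Bool) : β true + β false = 1 := by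
  have := β.tsum_coe
  rwa [tsum_fintype, Fintype.sum_bool] at this

theorem tossSum_mono {h h' : ℕ → ℝ≥0∞} (H : ∀ K, h K ≤ h' K) (j : ℕ) :
    ∀ K, tossSum β h j K ≤ tossSum β h' j K := by
  induction j with
  | zero => exact H
  | succ j ih => exact fun K => expect_mono _ fun c => ih _

theorem tossSum_linear (h h' : ℕ → ℝ≥0∞) (x y : ℝ≥0∞) (j : ℕ) :
    ∀ K, tossSum β (fun K => x * h K + y * h' K) j K =
      x * tossSum β h j K + y * tossSum β h' j K := by
  induction j with
  | zero => exact fun K => rfl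
  | succ j ih =>
    intro K
    simp only [tossSum, ih, expect_add, expect_const_mul]

theorem tossSum_const (x : ℝ≥0∞) (j : ℕ) : ∀ K, tossSum β (fun _ => x) j K = x := by
  induction j with
  | zero => exact fun K => rfl
  | succ j ih => intro K; simp only [tossSum, ih, expect_const]

theorem tossSum_id (j : ℕ) : ∀ K, tossSum β (fun K => (K : ℝ≥0∞)) j K = K + j * β true := by
  induction j with
  | zero => intro K; simp [tossSum]
  | succ j ih =>
    intro K
    simp only [tossSum, ih, expect_add, expect_const]
    rw [expect_bool]
    have := coin_add β
    push_cast
    calc _ = (β true + β false) * K + β true + j * β true := by simp; ring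
      _ = _ := by rw [this]; ring

/-- The generating function of the binomial distribution at `1/2`; it measures the effect of
clamping. -/
theorem tossSum_pow (j : ℕ) : ∀ K, tossSum β (fun K => (2⁻¹ : ℝ≥0∞) ^ K) j K =
    2⁻¹ ^ K * (β true * 2⁻¹ + β false) ^ j := by
  induction j with
  | zero => intro K; simp [tossSum]
  | succ j ih =>
    intro K
    simp only [tossSum, ih]
    rw [expect_bool]
    simp [pow_succ]
    ring

/-- Counting failures instead of successes reduces the bound for the outcome `0` of `biasProg` to
the one for the outcome `1`. -/
theorem tossSum_map_not (h : ℕ → ℝ≥0∞) (N j : ℕ) : ∀ K, K + j ≤ N →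
    tossSum β h j K = tossSum (β.map not) (fun F => h (N - F)) j (N - K - j) := by
  induction j with
  | zero => intro K hK; simp only [tossSum]; congr 1; omega
  | succ j ih =>
    intro K hK
    simp only [tossSum, expect_map]
    congr 1
    funext c
    rw [ih _ (by cases c <;> simp <;> omega)]
    congr 1
    cases c <;> simp <;> omega

/-- The parameter `a` is large enough for the coin `β`. -/
structure Suitable (β : PMF Bool) (a : ℕ) : Prop where
  even : Even a
  four_le : 4 ≤ a
  one_le : ∀ c, 1 ≤ a * β c
  pow_le : ∀ c, 2 * (β c * 2⁻¹ + β !c) ^ a ≤ 2⁻¹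

/-- Take expectations in `H`: the linear term gives the mean `a * w * β true`, and the correction
gives `w` times the `w`-th power of `2 * (β true * 2⁻¹ + β false) ^ a ≤ 2⁻¹`. Then divide by `w`. -/
theorem tossSum_le {h : ℕ → ℝ≥0∞} {a w : ℕ} (hw : 0 < w)
    (ha : 2 * (β true * 2⁻¹ + β false) ^ a ≤ 2⁻¹)
    (H : ∀ F : ℕ, ((a - 2 : ℕ) * w : ℝ≥0∞) * h F + w ≤ F + w * 2 ^ w * 2⁻¹ ^ F) :
    ((a - 2 : ℕ) : ℝ≥0∞) * tossSum β h (a * w) 0 + 1 ≤ a * β true + 2⁻¹ ^ w := by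
  have h1 := tossSum_mono (β := β) H (a * w) 0
  have e1 := tossSum_linear (β := β) h (fun _ => (w : ℝ≥0∞)) ((a - 2 : ℕ) * w) 1 (a * w) 0
  have e2 := tossSum_linear (β := β) (fun F => (F : ℝ≥0∞)) (fun F => 2⁻¹ ^ F) 1 (w * 2 ^ w) (a * w) 0
  simp only [one_mul] at e1 e2
  rw [e1, e2, tossSum_const, tossSum_id, tossSum_pow, pow_mul] at h1
  have hw0 : (w : ℝ≥0∞) ≠ 0 := by exact_mod_cast hw.ne'
  have h2 : (2 : ℝ≥0∞) ^ w * ((β true * 2⁻¹ + β false) ^ a) ^ w ≤ 2⁻¹ ^ w := by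
    rw [← mul_pow]
    exact pow_le_pow_left' ha w
  have h3 : (w : ℝ≥0∞) * (((a - 2 : ℕ) : ℝ≥0∞) * tossSum β h (a * w) 0 + 1) ≤
      w * (a * β true + 2⁻¹ ^ w) := by
    calc _ = (a - 2 : ℕ) * w * tossSum β h (a * w) 0 + w := by ring
      _ ≤ _ := h1
      _ = w * (a * β true + 2 ^ w * ((β true * 2⁻¹ + β false) ^ a) ^ w) := by
        push_cast; simp; ring
      _ ≤ _ := by gcongr
  exact (ENNReal.mul_le_mul_iff_right hw0 (ENNReal.natCast_ne_top w)).1 h3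

/-- Input `[w]`, output `1` with a probability of about `(a μ - 1) / (a - 2)`, where `μ` is the bias
of the coin, and otherwise `0`. -/
def biasProg (a : ℕ) : Prog := block
  [.assign 2 0 (.const a * cell 0 0),
   .loop (cell 2 0) (block
    [.coin 3 0,
     .assign 1 0 (cell 1 0 + cell 3 0),
     .assign 2 0 (cell 2 0 - 1)]),
   .rand 3 0 (.const (a - 2) * cell 0 0),
   .assign 1 0 (.op .lt (cell 3 0) (cell 1 0 - cell 0 0))]

theorem sum_range_ite_lt (N k : ℕ) (x y : ℝ≥0∞) :
    ∑ u ∈ Finset.range N, (if u < k then x else y) = (min k N : ℕ) * x + (N - k : ℕ) * y := by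
  induction N with
  | zero => simp
  | succ N ih =>
    rw [Finset.sum_range_succ, ih]
    split_ifs with h
    · rw [min_eq_right (by omega), min_eq_right (by omega), show N - k = 0 by omega,
        show N + 1 - k = 0 by omega]
      push_cast; ring
    · rw [min_eq_left (by omega), min_eq_left (by omega), show N + 1 - k = N - k + 1 by omega]
      push_cast; ring

/-- Without clamping, `(K - w) / ((a - 2) * w)` for `K` successes would have exactly the mean `(a *
μ - 1) / (a - 2)`. Clamping raises the probability of the outcome `1` only for `K < w`, and that of
`0` only for fewer than `w` failures; there the excess is at most a multiple of `w * 2 ^ (w - F)`,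
whose mean is exponentially small. Only upper bounds are stated, since later only domination is
used. -/
theorem biasProg_spec {S : ℕ} (hS : 7 ≤ S) {a w : ℕ} (ha : Suitable β a) (hw : 0 < w)
    (haw : a * w < 2 ^ S) :
    ∃ p : Bool → ℝ≥0∞, p true + p false = 1 ∧
      (∀ c, ((a - 2 : ℕ) : ℝ≥0∞) * p c + 1 ≤ a * β c + 2⁻¹ ^ w) ∧
      ∀ G : ℕ → ℝ≥0∞, wpc β S (biasProg a) (Mem.ofInput [w]) (5 * (a * w) + 5)
        (fun m' => G m'.output) ≤ p true * G 1 + p false * G 0 := by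
  have h4 := ha.four_le
  have hN : 0 < (a - 2) * w := Nat.mul_pos (by omega) hw
  set N := (a - 2) * w with hNdef
  have haN : a * w = N + 2 * w := by
    rw [hNdef, ← add_mul]; congr 1; omega
  have hN0 : (N : ℝ≥0∞) ≠ 0 := by exact_mod_cast hN.ne'
  have hNt : (N : ℝ≥0∞) ≠ ⊤ := ENNReal.natCast_ne_top _
  -- `φ` and `ψ` are the probabilities of the outcomes `1` and `0` given `K` successes.
  set φ : ℕ → ℝ≥0∞ := fun K => (min (K - w) N : ℕ) / N with hφ
  set ψ : ℕ → ℝ≥0∞ := fun K => (N - (K - w) : ℕ) / N with hψ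
  refine ⟨fun c => tossSum β (if c then φ else ψ) (a * w) 0, ?_, ?_, ?_⟩
  · have := tossSum_linear (β := β) φ ψ 1 1 (a * w) 0
    simp only [one_mul] at this
    simp only [if_true, Bool.false_eq_true, if_false]
    rw [← this]
    rw [show (fun K => φ K + ψ K) = fun _ => 1 from ?_, tossSum_const]
    funext K
    rw [hφ, hψ, ← ENNReal.add_div, ← Nat.cast_add, show min (K - w) N + (N - (K - w)) = N by omega,
      ENNReal.div_self hN0 hNt]
  · have hcast : ((a - 2 : ℕ) : ℝ≥0∞) * w = N := by rw [hNdef]; push_cast; rfl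
    have key : ∀ (F : ℕ), w ≤ F → (w : ℝ≥0∞) ≤ F + w * 2 ^ w * 2⁻¹ ^ F := fun F h =>
      le_add_right (by exact_mod_cast h)
    have key2 : ∀ F : ℕ, F ≤ w → (w : ℝ≥0∞) ≤ w * 2 ^ w * 2⁻¹ ^ F := by
      intro F h
      calc (w : ℝ≥0∞) = w * (2 ^ F * 2⁻¹ ^ F) := by
            rw [← mul_pow, ENNReal.mul_inv_cancel (by norm_num) (by norm_num)]; simp
        _ ≤ w * (2 ^ w * 2⁻¹ ^ F) := by gcongr; norm_num
        _ = _ := by ring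
    intro c
    cases c with
    | true =>
      refine tossSum_le hw (ha.pow_le true) fun F => ?_
      simp only [if_true]
      rw [hcast, hφ, ENNReal.mul_div_cancel hN0 hNt]
      rcases le_total w F with h | h
      · refine le_add_right ?_
        exact_mod_cast (by omega : min (F - w) N + w ≤ F)
      · rw [show min (F - w) N = 0 by omega]
        simpa using le_add_left (key2 F h)
    | false =>
      simp only [Bool.false_eq_true, if_false]
      rw [tossSum_map_not ψ (a * w) (a * w) 0 (by omega), show a * w - 0 - a * w = 0 by omega]
      have hm : ∀ c, (β.map not) c = β (!c) := by
        intro c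
        rw [PMF.map_apply, tsum_bool]
        cases c <;> simp
      have := tossSum_le (β := β.map not) (h := fun F => ψ (a * w - F)) hw (a := a)
        (by rw [hm, hm]; exact ha.pow_le false) fun F => ?_
      · rwa [hm] at this
      · rw [hcast, hψ, ENNReal.mul_div_cancel hN0 hNt, haN]
        rcases le_total w F with h | h
        · refine le_add_right ?_
          exact_mod_cast (by omega : N - (N + 2 * w - F - w) + w ≤ F)
        · rw [show N - (N + 2 * w - F - w) = 0 by omega]
          simpa using le_add_left (key2 F h)
  · intro G
    have h0 : 0 < S := by omega
    have hc := lt_two_pow_of_le_hundred hS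
    have ha' : a < 2 ^ S := lt_of_le_of_lt (Nat.le_mul_of_pos_right a hw) haw
    have hw' : w < 2 ^ S := lt_of_le_of_lt (Nat.le_mul_of_pos_left w (by omega)) haw
    have hB : Bdd S (Mem.ofInput [w]) := Bdd.ofInput (by simp [hw'])
    refine wpc_budget (k := 0 + 1 + 1 + 1 + (a * w * (4 + 1) + 1) + 1) (by omega) ?_
    refine wpc_assign h0 0 (a * w) hB (Nat.le_of_ble_eq_true rfl) (by simp [hc, ha']) rfl
      (by simp [Mem.ofInput]) haw fun hB => ?_
    have hsum := tossSum_linear (β := β) φ ψ (G 1) (G 0) (a * w) 0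
    simp only [if_true, Bool.false_eq_true, if_false]
    rw [mul_comm _ (G 1), mul_comm _ (G 0), ← hsum]
    set h := fun K => G 1 * φ K + G 0 * ψ K with hh
    have hV := wpc_loop (β := β) h0 (N := a * w) (kb := 4) (k := 0 + 1 + 1 + 1) (e := cell 2 0)
      (p := block [.coin 3 0, .assign 1 0 (cell 1 0 + cell 3 0), .assign 2 0 (cell 2 0 - 1)])
      (ps := [.rand 3 0 (.const (a - 2) * cell 0 0),
        .assign 1 0 (.op .lt (cell 3 0) (cell 1 0 - cell 0 0))])
      (m := (Mem.ofInput [w]).set 2 0 (a * w)) (F := fun m' => G m'.output)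
      (fun j m => Bdd S m ∧ m 0 0 = w ∧ m 2 0 = j ∧ m 1 0 + j ≤ a * w)
      (fun j m => tossSum β h j (m 1 0)) (by decide) (by simp [hc]) (fun j m h => h.1)
      (fun m h => by simp [h.2.2.1]) (fun j m h => by simp [h.2.2.1]) ?_ ?_ ?_
    · simpa [Mem.set_apply, Mem.ofInput] using hV
    · rintro j m ⟨hB, hm00, hm20, hm10⟩
      refine wpc_coin h0 0 hB (by decide) (by simp [hc]) rfl fun hB => ?_
      refine expect_mono _ fun c => ?_
      have hct : c.toNat ≤ 1 := by cases c <;> simp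
      refine wpc_assign h0 0 (m 1 0 + c.toNat) (hB c) (by decide) (by simp [hc]) rfl
        (by simp [Mem.set_apply]) (by omega) fun hB => ?_
      refine wpc_assign h0 0 j hB (by decide) (by simp [hc]) rfl
        (by simp [Mem.set_apply, hm20]) (by omega) fun hB => ?_
      refine wpc_nil h0 (iInf_le_of_le ⟨hB, ?_, ?_, ?_⟩ ?_)
      all_goals simp [Mem.set_apply, hm00]
      omega
    · rintro m ⟨hB, hm00, hm20, hm10⟩
      have ha2 : a - 2 < 2 ^ S := by omega
      refine wpc_rand h0 0 N hB (Nat.le_of_ble_eq_true rfl) (by simp [hc, ha2]) rfl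
        (by simp [hm00, hNdef]) (by omega) hN fun hB => ?_
      have : ∀ u ∈ Finset.range N, wpc β S
          (block [.assign 1 0 (.op .lt (cell 3 0) (cell 1 0 - cell 0 0))]) (m.set 3 0 u) (0 + 1 + 1)
          (fun m' => G m'.output) ≤ if u < m 1 0 - w then G 1 else G 0 := by
        intro u hu
        refine wpc_assign h0 0 (if u < m 1 0 - w then 1 else 0) (hB u (Finset.mem_range.1 hu))
          (by decide) (by simp [hc]) rfl (by simp [Mem.set_apply, hm00]) ?_ fun hB => ?_
        · split_ifs
          · exact hc 1 (by norm_num)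
          · exact hc 0 (by norm_num)
        · refine wpc_nil h0 ?_
          simp only [Mem.output, Mem.set_apply]
          split_ifs <;> simp_all
      refine (ENNReal.div_le_div_right (Finset.sum_le_sum this) _).trans ?_
      rw [sum_range_ite_lt]
      simp only [tossSum, hh, hφ, hψ]
      rw [ENNReal.add_div, mul_comm (G 1), mul_comm (G 0)]
      simp only [div_eq_mul_inv, mul_right_comm]
      exact le_rfl
    · exact ⟨hB, by simp [Mem.set_apply, Mem.ofInput]⟩

/-! ## Sharing a bit -/

/-- `y` consists of a pattern of `a` bits and of the number of its ones, which has the parity of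
`ρ`. -/
def IsPattern (a ρ y : ℕ) : Prop :=
  y / 2 ^ a % 2 = ρ % 2 ∧ y / 2 ^ a ≤ a ∧
    y / 2 ^ a = ∑ c ∈ Finset.range a, ((y % 2 ^ a).testBit c).toNat

/-- Input `[w, ρ]`, output a random pattern of `a` bits whose number of ones has the parity
of `ρ`, together with that number. -/
def patternProg (a : ℕ) : Prog := block
  [.ite (cell 0 1 % 2) (block
    [.rand 2 0 (.const a),
     .assign 3 0 2,
     .assign 3 1 (cell 2 0),
     .call 4 0 3 2 powProg,
     .call 6 0 0 1 (biasProg a),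
     .ite (cell 6 0)
      (block [.assign 1 0 (.const (2 ^ a * (a - 1)) + (.const (2 ^ a) - (cell 4 0 + 1)))])
      (block [.assign 1 0 (.const (2 ^ a) + cell 4 0)])])
    (block
    [.coin 2 0,
     .assign 1 0 (.const (2 ^ a * a + (2 ^ a - 1)) * cell 2 0)])]

theorem isPattern_of {a ρ K x : ℕ} (hx : x < 2 ^ a) (hK : K % 2 = ρ % 2)
    (h : K = ∑ c ∈ Finset.range a, (x.testBit c).toNat) :
    IsPattern a ρ (2 ^ a * K + x) ∧ (2 ^ a * K + x) % 2 ^ a = x := by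
  have h1 : (2 ^ a * K + x) / 2 ^ a = K := by
    rw [Nat.mul_add_div (by positivity), Nat.div_eq_of_lt hx, add_zero]
  have h2 : (2 ^ a * K + x) % 2 ^ a = x := by
    rw [Nat.mul_add_mod, Nat.mod_eq_of_lt hx]
  refine ⟨⟨by rw [h1, hK], ?_, by rw [h1, h2, h]⟩, h2⟩
  rw [h1, h]
  refine (Finset.sum_le_card_nsmul _ _ 1 fun c _ => ?_).trans (by simp)
  cases x.testBit c <;> simp

theorem sum_testBit_two_pow {a i : ℕ} (hi : i < a) :
    ∑ c ∈ Finset.range a, ((2 ^ i).testBit c).toNat = 1 := by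
  rw [Finset.sum_eq_single_of_mem i (Finset.mem_range.2 hi)]
  · simp
  · intro c _ hc
    simp [hc.symm]

theorem sum_testBit_compl {a x : ℕ} (hx : x < 2 ^ a) :
    ∑ c ∈ Finset.range a, ((2 ^ a - (x + 1)).testBit c).toNat +
      ∑ c ∈ Finset.range a, (x.testBit c).toNat = a := by
  rw [← Finset.sum_add_distrib]
  rw [Finset.sum_congr rfl (g := fun _ => 1), Finset.sum_const, Finset.card_range, smul_eq_mul, mul_one]
  intro c hc
  rw [Nat.testBit_two_pow_sub_succ hx]
  cases x.testBit c <;> simp [Finset.mem_range.1 hc]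

/-- For even parity all bits equal one toss, which is legitimate as `a` is even, and the marginal is
exact. For odd parity, bit `c` shows `b` with probability `((a - 1) * p b + p !b) / a = ((a - 2) * p
b + 1) / a`, which would be `β b` for the ideal bias; the additive error becomes a relative one
because `1 ≤ a * β b`. The bits of one pattern are strongly dependent, so only a single bit `c` is
observed. -/
theorem patternProg_spec {S : ℕ} (hS : 7 ≤ S) {a w ρ : ℕ} (ha : Suitable β a) (hw : 0 < w)
    (haw : a * w < 2 ^ S) (hρ : ρ < 2 ^ S) (haS : 2 ^ a * (a + 1) < 2 ^ S) {c : ℕ} (hca : c < a) :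
    ∃ q : Bool → ℝ≥0∞, q true + q false = 1 ∧ (∀ b, q b ≤ (1 + 2⁻¹ ^ w) * β b) ∧
      ∀ G : Bool → ℝ≥0∞, wpc β S (patternProg a) (Mem.ofInput [w, ρ]) (5 * (a * w) + 4 * a + 25)
        (fun m' => ⨅ _ : IsPattern a ρ m'.output ∧ m'.output < 2 ^ S,
          G ((m'.output % 2 ^ a).testBit c)) ≤ q true * G true + q false * G false := by
  have h0 : 0 < S := by omega
  have hc := lt_two_pow_of_le_hundred hS
  have h4 := ha.four_le
  have ha' : a < 2 ^ S := lt_of_le_of_lt (Nat.le_mul_of_pos_right a hw) haw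
  have hw' : w < 2 ^ S := lt_of_le_of_lt (Nat.le_mul_of_pos_left w (by omega)) haw
  have h2a : 0 < 2 ^ a := by positivity
  have haS1 : 2 ^ a < 2 ^ S := by nlinarith
  have haS2 : 2 ^ a * (a - 1) < 2 ^ S := by
    refine lt_of_le_of_lt (Nat.mul_le_mul_left _ (by omega)) haS
  have haS3 : 2 ^ a * a + (2 ^ a - 1) < 2 ^ S := by
    rw [mul_add, mul_one] at haS; omega
  have ha0 : (a : ℝ≥0∞) ≠ 0 := by exact_mod_cast (by omega : a ≠ 0)
  have hat : (a : ℝ≥0∞) ≠ ⊤ := ENNReal.natCast_ne_top _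
  have hB : Bdd S (Mem.ofInput [w, ρ]) := Bdd.ofInput (by simp [hw', hρ])
  have hpat0 : IsPattern a 0 (2 ^ a * 0 + 0) ∧ _ := isPattern_of (ρ := 0) (K := 0) h2a rfl (by simp)
  have hcompl0 := sum_testBit_compl h2a
  rcases Nat.mod_two_eq_zero_or_one ρ with hρ2 | hρ2
  · refine ⟨β, coin_add β, fun b => le_mul_of_one_le_left (zero_le) (le_add_right le_rfl),
      fun G => ?_⟩
    refine wpc_budget (k := 0 + 1 + (3 + 1)) (by omega) ?_
    refine wpc_ite h0 hB (by decide) (by simp [hc]) (fun h => ?_) (fun _ => ?_)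
    · simp [Mem.ofInput, hρ2] at h
    rw [← expect_bool]
    refine wpc_budget (k := 0 + 1 + 1 + 1) (by omega) ?_
    refine wpc_coin h0 0 hB (by decide) (by simp [hc]) rfl fun hB => ?_
    refine expect_mono _ fun b => ?_
    refine wpc_assign h0 0 ((2 ^ a * a + (2 ^ a - 1)) * b.toNat) (hB b) (Nat.le_of_ble_eq_true rfl)
      (by simp [hc, haS3]) rfl (by simp [Mem.set_apply]) ?_ fun hB => ?_
    · cases b <;> simp [haS3]
    refine wpc_nil h0 (wpc_nil h0 ?_)
    have hout : (((Mem.ofInput [w, ρ]).set 2 0 b.toNat).set 1 0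
        ((2 ^ a * a + (2 ^ a - 1)) * b.toNat)).output = (2 ^ a * a + (2 ^ a - 1)) * b.toNat := by
      simp [Mem.output, Mem.set_apply]
    rw [hout]
    cases b with
    | false =>
      refine iInf_le_of_le ⟨?_, by simp⟩ ?_
      · have := hpat0.1
        simp [IsPattern] at this ⊢
        omega
      · simp
    | true =>
      simp only [Nat.zero_testBit, Bool.toNat_false, Finset.sum_const_zero, add_zero, zero_add] at hcompl0
      obtain ⟨g1, g2⟩ := isPattern_of (a := a) (ρ := ρ) (K := a) (x := 2 ^ a - 1) (by omega)
        (by rw [hρ2, Nat.even_iff.1 ha.even]) hcompl0.symm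
      refine iInf_le_of_le ⟨by simpa using g1, by simpa using haS3⟩ ?_
      rw [Bool.toNat_true, mul_one, g2, Nat.testBit_two_pow_sub_one]
      simp [hca]
  · obtain ⟨p, hp1, hpb, hp⟩ := biasProg_spec hS ha hw haw
    have hsplit : ((a - 1 : ℕ) : ℝ≥0∞) = (a - 2 : ℕ) + 1 := by
      exact_mod_cast (by omega : a - 1 = a - 2 + 1)
    have hsum : ∀ b, ((a - 1 : ℕ) * p b + p !b) / a = ((a - 2 : ℕ) * p b + 1) / a := by
      intro b
      have : p b + p (!b) = 1 := by cases b <;> simp [← hp1, add_comm]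
      congr 1
      calc _ = (a - 2 : ℕ) * p b + (p b + p !b) := by rw [hsplit]; ring
        _ = _ := by rw [this]
    refine ⟨fun b => ((a - 1 : ℕ) * p b + p !b) / a, ?_, fun b => ?_, fun G => ?_⟩
    · simp only [Bool.not_true, Bool.not_false]
      rw [← ENNReal.add_div, show ((a - 1 : ℕ) : ℝ≥0∞) * p true + p false + ((a - 1 : ℕ) * p false + p true) =
        ((a - 1 : ℕ) + 1) * (p true + p false) by ring, hp1, mul_one,
        show (((a - 1 : ℕ) : ℝ≥0∞) + 1) = a by exact_mod_cast (by omega : a - 1 + 1 = a),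
        ENNReal.div_self ha0 hat]
    · dsimp only
      rw [hsum]
      refine ENNReal.div_le_of_le_mul ((hpb b).trans ?_)
      calc _ ≤ a * β b + 2⁻¹ ^ w * (a * β b) := by
            gcongr
            exact le_mul_of_one_le_right (zero_le) (ha.one_le b)
        _ = _ := by ring
    · refine wpc_budget (k := 0 + 1 + ((5 * (a * w) + 4 * a + 22) + 1)) (by omega) ?_
      refine wpc_ite h0 hB (by decide) (by simp [hc]) (fun _ => ?_) (fun h => ?_)
      swap
      · simp [Mem.ofInput, hρ2] at h
      refine wpc_budget (k := 0 + 1 + (3 + 1) + ((5 * (a * w) + 5) + 1 + 1) + ((4 * a + 3) + 2 + 1)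
        + 1 + 1 + 1) (by omega) ?_
      refine wpc_rand h0 0 a hB (Nat.le_of_ble_eq_true rfl) (by simp [hc, ha']) rfl rfl ha' (by omega)
        fun hB => ?_
      set q1 := p true * G true + p false * G false with hq1
      set q2 := p true * G false + p false * G true with hq2
      have key : ∀ i ∈ Finset.range a, wpc β S (block
        [.assign 3 0 2, .assign 3 1 (cell 2 0), .call 4 0 3 2 powProg, .call 6 0 0 1 (biasProg a),
         .ite (cell 6 0)
          (block [.assign 1 0 (.const (2 ^ a * (a - 1)) + (.const (2 ^ a) - (cell 4 0 + 1)))])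
          (block [.assign 1 0 (.const (2 ^ a) + cell 4 0)])]) ((Mem.ofInput [w, ρ]).set 2 0 i)
          (0 + 1 + (3 + 1) + ((5 * (a * w) + 5) + 1 + 1) + ((4 * a + 3) + 2 + 1) + 1 + 1)
          (fun m' => wpc β S (block []) m' (0 + 1)
            fun m' => ⨅ _ : IsPattern a ρ m'.output ∧ m'.output < 2 ^ S,
            G ((m'.output % 2 ^ a).testBit c)) ≤ if i = c then q2 else q1 := by
        intro i hi
        rw [Finset.mem_range] at hi
        have h2i : 2 ^ i < 2 ^ a := Nat.pow_lt_pow_right (by norm_num) hi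
        refine wpc_assign h0 0 2 (hB i hi) (by decide) (by simp [hc]) rfl rfl (hc 2 (by norm_num))
          fun hB => ?_
        refine wpc_assign h0 1 i hB (by decide) (by simp [hc]) rfl
          (by simp [Mem.set_apply]) (hi.trans ha') fun hB => ?_
        refine wpc_budget (k := 0 + 1 + (3 + 1) + ((5 * (a * w) + 5) + 1 + 1) + ((4 * i + 3) + 2 + 1))
          (by omega) ?_
        refine wpc_call_of_evaluates h0 0 2 [2, i] (2 ^ i) hB (by decide)
          (by simp [hc]) rfl rfl (by simp [List.range_succ, Mem.set_apply])
          (powProg_evaluates hS (hc 2 (by norm_num)) (by norm_num) (hi.trans ha') (h2i.trans haS1))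
          (h2i.trans haS1) fun hB => ?_
        refine wpc_call h0 0 1 [w] hB (by decide) (by simp [hc]) rfl rfl
          (by simp [List.range_succ, Mem.set_apply, Mem.ofInput]) fun hB => ?_
        set m₀ := ((((Mem.ofInput [w, ρ]).set 2 0 i).set 3 0 2).set 3 1 i).set 4 0 (2 ^ i) with hm₀
        refine (hp fun y => ⨅ _ : y < 2 ^ S, wpc β S (block [.ite (cell 6 0)
          (block [.assign 1 0 (.const (2 ^ a * (a - 1)) + (.const (2 ^ a) - (cell 4 0 + 1)))])
          (block [.assign 1 0 (.const (2 ^ a) + cell 4 0)])]) (m₀.set 6 0 y) (0 + 1 + (3 + 1))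
          (fun m' => wpc β S (block []) m' (0 + 1)
            fun m' => ⨅ _ : IsPattern a ρ m'.output ∧ m'.output < 2 ^ S,
            G ((m'.output % 2 ^ a).testBit c))).trans ?_
        have e1 : ∀ b : Bool, (⨅ _ : b.toNat < 2 ^ S, wpc β S (block [.ite (cell 6 0)
          (block [.assign 1 0 (.const (2 ^ a * (a - 1)) + (.const (2 ^ a) - (cell 4 0 + 1)))])
          (block [.assign 1 0 (.const (2 ^ a) + cell 4 0)])]) (m₀.set 6 0 b.toNat) (0 + 1 + (3 + 1))
          (fun m' => wpc β S (block []) m' (0 + 1)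
            fun m' => ⨅ _ : IsPattern a ρ m'.output ∧ m'.output < 2 ^ S,
            G ((m'.output % 2 ^ a).testBit c))) ≤ G (if i = c then !b else b) := by
          intro b
          have hb : b.toNat < 2 ^ S := by cases b <;> simp [hc]
          refine iInf_le_of_le hb ?_
          refine wpc_ite h0 (hB _ hb) (by decide) (by simp [hc]) (fun h => ?_) (fun h => ?_)
          · have hbt : b = true := by
              cases b
              · simp [Mem.set_apply] at h
              · rfl
            subst hbt
            have hs := sum_testBit_compl h2i
            rw [sum_testBit_two_pow hi] at hs
            obtain ⟨g1, g2⟩ := isPattern_of (a := a) (ρ := ρ) (K := a - 1) (x := 2 ^ a - (2 ^ i + 1))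
              (Nat.sub_lt h2a (Nat.succ_pos _)) (by have := Nat.even_iff.1 ha.even; omega) (by omega)
            have g3 : 2 ^ a * (a - 1) + (2 ^ a - (2 ^ i + 1)) < 2 ^ S := by
              refine lt_of_le_of_lt ?_ haS
              calc _ ≤ 2 ^ a * (a - 1) + 2 ^ a := by omega
                _ = 2 ^ a * (a - 1 + 1) := by ring
                _ ≤ _ := Nat.mul_le_mul_left _ (by omega)
            refine wpc_budget (k := 0 + 1 + 1) (by omega) ?_
            refine wpc_assign h0 0 (2 ^ a * (a - 1) + (2 ^ a - (2 ^ i + 1))) (hB _ hb)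
              (Nat.le_of_ble_eq_true rfl) (by simp [hc, haS1, haS2]) rfl
              (by simp [Mem.set_apply, hm₀]) g3 fun hB => ?_
            refine wpc_nil h0 (wpc_nil h0 (wpc_nil h0 ?_))
            have hout : ((m₀.set 6 0 (true.toNat)).set 1 0
              (2 ^ a * (a - 1) + (2 ^ a - (2 ^ i + 1)))).output =
              2 ^ a * (a - 1) + (2 ^ a - (2 ^ i + 1)) := by simp [Mem.output, Mem.set_apply]
            rw [hout]
            refine iInf_le_of_le ⟨g1, g3⟩ ?_
            rw [g2, Nat.testBit_two_pow_sub_succ h2i, Nat.testBit_two_pow]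
            by_cases hic : i = c <;> simp [hic, hca]
          · have hbt : b = false := by
              cases b
              · rfl
              · simp [Mem.set_apply] at h
            subst hbt
            obtain ⟨g1, g2⟩ := isPattern_of (a := a) (ρ := ρ) (K := 1) (x := 2 ^ i)
              h2i (by omega) (sum_testBit_two_pow hi).symm
            have g3 : 2 ^ a * 1 + 2 ^ i < 2 ^ S := by
              refine lt_of_le_of_lt ?_ haS
              calc _ ≤ 2 ^ a * 2 := by omega
                _ ≤ _ := Nat.mul_le_mul_left _ (by omega)
            refine wpc_budget (k := 0 + 1 + 1) (by omega) ?_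
            refine wpc_assign h0 0 (2 ^ a * 1 + 2 ^ i) (hB _ hb)
              (Nat.le_of_ble_eq_true rfl) (by simp [hc, haS1]) rfl
              (by simp [Mem.set_apply, hm₀]) g3 fun hB => ?_
            refine wpc_nil h0 (wpc_nil h0 (wpc_nil h0 ?_))
            have hout : ((m₀.set 6 0 (false.toNat)).set 1 0
              (2 ^ a * 1 + 2 ^ i)).output = 2 ^ a * 1 + 2 ^ i := by simp [Mem.output, Mem.set_apply]
            rw [hout]
            refine iInf_le_of_le ⟨g1, g3⟩ ?_
            rw [g2, Nat.testBit_two_pow]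
            by_cases hic : i = c <;> simp [hic]
        have e2 := e1 true
        have e3 := e1 false
        simp only [Bool.toNat_true, Bool.toNat_false] at e2 e3
        refine (add_le_add (mul_le_mul_right e2 _) (mul_le_mul_right e3 _)).trans ?_
        split_ifs <;> simp [hq1, hq2]
      refine (ENNReal.div_le_div_right (Finset.sum_le_sum key) _).trans ?_
      rw [Finset.sum_ite, Finset.filter_eq', if_pos (Finset.mem_range.2 hca), Finset.sum_singleton,
        Finset.sum_const, Finset.filter_ne', Finset.card_erase_of_mem (Finset.mem_range.2 hca),
        Finset.card_range, nsmul_eq_mul, ← ENNReal.mul_div_right_comm, ← ENNReal.mul_div_right_comm,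
        ← ENNReal.add_div]
      refine ENNReal.div_le_div_right (le_of_eq ?_) _
      simp only [hq1, hq2, Bool.not_true, Bool.not_false]
      ring

/-! ### Shares of a number over several levels. -/

/-- Input `[r, m]`, output the bits of random shares of `r`. -/
def shareProg (a : ℕ) : Prog := block
  [.assign 2 0 (cell 0 1),
   .assign 3 0 1,
   .assign 4 0 (cell 0 1),
   .loop (cell 2 0) (block
    [.assign 4 1 (cell 0 0),
     .call 5 0 4 2 (patternProg a),
     .assign 0 0 ((cell 0 0 - cell 5 0 / .const (2 ^ a)) / 2),
     .assign 1 0 (cell 3 0 * (cell 5 0 % .const (2 ^ a)) + cell 1 0),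
     .assign 3 0 (cell 3 0 * .const (2 ^ a)),
     .assign 2 0 (cell 2 0 - 1)])]

/-- The linear combination of the `a * i` lowest bits of `Z` in which every power of two occurs `a`
times. -/
def shareSum (a i Z : ℕ) : ℕ :=
  ∑ l ∈ Finset.range i, 2 ^ l * ∑ c ∈ Finset.range a, (Z.testBit (a * l + c)).toNat

theorem testBit_shift_add {A Z x j : ℕ} (hZ : Z < 2 ^ A) :
    (2 ^ A * x + Z).testBit j = if j < A then Z.testBit j else x.testBit (j - A) := by
  rw [Nat.testBit_two_pow_mul_add _ hZ]

theorem shareSum_succ {a i Z x : ℕ} (hZ : Z < 2 ^ (a * i)) :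
    shareSum a (i + 1) (2 ^ (a * i) * x + Z) =
      shareSum a i Z + 2 ^ i * ∑ c ∈ Finset.range a, (x.testBit c).toNat := by
  rw [shareSum, Finset.sum_range_succ, shareSum]
  congr 1
  · refine Finset.sum_congr rfl fun l hl => ?_
    congr 1
    refine Finset.sum_congr rfl fun c hc => ?_
    rw [testBit_shift_add hZ, if_pos]
    rw [Finset.mem_range] at hl hc
    calc a * l + c < a * l + a := by omega
      _ = a * (l + 1) := by ring
      _ ≤ a * i := Nat.mul_le_mul_left _ hl
  · congr 1
    refine Finset.sum_congr rfl fun c hc => ?_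
    rw [testBit_shift_add hZ, if_neg (by omega), Nat.add_sub_cancel_left]

/-- This is binary expansion with the numbers of ones of the patterns as digits, up to a final rest
that is a multiple of `2 ^ m`. Share `t` is decided at level `t / a` alone; the other levels
contribute only their total mass one, so the factor `1 + 2⁻¹ ^ m` is paid once. -/
theorem shareProg_spec {S : ℕ} (hS : 7 ≤ S) {a m x : ℕ} (ha : Suitable β a) (hm : 0 < m)
    (ham : a * m < S) (hr : x + a * 2 ^ m < 2 ^ S) (haS : 2 ^ a * (a + 1) < 2 ^ S) {t : ℕ}
    (ht : t < a * m) (b : Bool) {C : ℝ≥0∞} :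
    wpc β S (shareProg a) (Mem.ofInput [x + a * 2 ^ m, m]) (40 * S * S)
      (fun m' => ⨅ _ : m'.output < 2 ^ (a * m) ∧ shareSum a m m'.output ≡ x [MOD 2 ^ m],
        if m'.output.testBit t = b then C else 0) ≤ (1 + 2⁻¹ ^ m) * β b * C := by
  have h0 : 0 < S := by omega
  have hc := lt_two_pow_of_le_hundred hS
  have h4 := ha.four_le
  have hSS : S < 2 ^ S := Nat.lt_two_pow_self
  have haS' : a ≤ S := (Nat.le_mul_of_pos_right a hm).trans ham.le
  have hmS : m ≤ S := (Nat.le_mul_of_pos_left m (by omega)).trans ham.le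
  have hm2 : m < 2 ^ S := by omega
  have h2a : 0 < 2 ^ a := by positivity
  have haS1 : 2 ^ a < 2 ^ S := by nlinarith
  have hB : Bdd S (Mem.ofInput [x + a * 2 ^ m, m]) := Bdd.ofInput (by simp [hr, hm2])
  set v := (1 + 2⁻¹ ^ m) * β b * C with hv
  set kb := 5 * (a * m) + 4 * a + 35 with hkb
  refine wpc_budget (k := 0 + 1 + (m * (kb + 1) + 1) + 1 + 1 + 1) ?_ ?_
  · have h1 : m * (kb + 1) ≤ m * (5 * S + 36 + 4 * a) := Nat.mul_le_mul_left _ (by omega)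
    have h2 : m * (5 * S + 36 + 4 * a) ≤ 5 * S * S + 36 * S + 4 * S := by nlinarith
    nlinarith
  refine wpc_assign h0 0 m hB (by decide) (by simp [hc]) rfl (by simp [Mem.ofInput]) hm2
    fun hB => ?_
  refine wpc_assign h0 0 1 hB (by decide) (by simp [hc]) rfl rfl (hc 1 (by norm_num)) fun hB => ?_
  refine wpc_assign h0 0 m hB (by decide) (by simp [hc]) rfl (by simp [Mem.ofInput, Mem.set_apply])
    hm2 fun hB => ?_
  -- The bound `a * 2 ^ j ≤ rest + a` explains the start at `x + a * 2 ^ m`: while levels remain,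
  -- the rest is at least `a`, so the number of ones can be subtracted without truncation.
  set I : ℕ → Mem → Prop := fun j mm => Bdd S mm ∧ mm 2 0 = j ∧ mm 4 0 = m ∧
    a * 2 ^ j ≤ mm 0 0 + a ∧ ∃ i, i + j = m ∧ mm 3 0 = 2 ^ (a * i) ∧ mm 1 0 < 2 ^ (a * i) ∧
      mm 0 0 * 2 ^ i + shareSum a i (mm 1 0) = x + a * 2 ^ m with hI
  -- The potential is the claimed bound until share `t` has been drawn, and from then on the actual
  -- value of the postcondition.
  set V : ℕ → Mem → ℝ≥0∞ := fun j mm =>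
    if t < a * (m - j) then (if (mm 1 0).testBit t = b then C else 0) else v with hV
  have hfin := wpc_loop (β := β) h0 (N := m) (kb := kb) (k := 0 + 1) (e := cell 2 0)
    (p := block
    [.assign 4 1 (cell 0 0),
     .call 5 0 4 2 (patternProg a),
     .assign 0 0 ((cell 0 0 - cell 5 0 / .const (2 ^ a)) / 2),
     .assign 1 0 (cell 3 0 * (cell 5 0 % .const (2 ^ a)) + cell 1 0),
     .assign 3 0 (cell 3 0 * .const (2 ^ a)),
     .assign 2 0 (cell 2 0 - 1)]) (ps := [])
    (m := (((Mem.ofInput [x + a * 2 ^ m, m]).set 2 0 m).set 3 0 1).set 4 0 m)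
    (F := fun m' => ⨅ _ : m'.output < 2 ^ (a * m) ∧ shareSum a m m'.output ≡ x [MOD 2 ^ m],
        if m'.output.testBit t = b then C else 0) I V (by decide) (by simp [hc])
    (fun j m h => h.1) (fun m h => by simp [h.2.1]) (fun j m h => by simp [h.2.1]) ?_ ?_ ?_
  · simpa [hV] using hfin
  · rintro j mm ⟨hB, hm20, hm40, hge, i, hij, hm30, hm10, hsum⟩
    have hil : i < m := by omega
    have hail : a * i < a * m := Nat.mul_lt_mul_of_pos_left hil (by omega)
    have hZS : ∀ l, l ≤ a * m → 2 ^ l < 2 ^ S := fun l hl =>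
      Nat.pow_lt_pow_right (by norm_num) (by omega)
    have hai1 : a * (i + 1) ≤ a * m := Nat.mul_le_mul_left _ hil
    have hai1' : a * (i + 1) = a * i + a := by ring
    have hr00 := hB 0 0
    have hge2 : 2 * (a * 2 ^ j) ≤ mm 0 0 + a := by
      rw [pow_succ] at hge
      calc _ = a * (2 ^ j * 2) := by ring
        _ ≤ _ := hge
    have h3 : a ≤ a * 2 ^ j := Nat.le_mul_of_pos_right _ (by positivity)
    refine wpc_budget (k := 0 + 1 + 1 + 1 + 1 + 1 + ((5 * (a * m) + 4 * a + 25) + 2 + 1) + 1)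
      (by omega) ?_
    refine wpc_assign h0 1 (mm 0 0) hB (by decide) (by simp [hc]) rfl (by simp) hr00 fun hB => ?_
    refine wpc_call h0 0 2 [m, mm 0 0] hB (by decide) (by simp [hc]) rfl rfl
      (by simp [List.range_succ, Mem.set_apply, hm40]) fun hB => ?_
    have step : ∀ y (G : Bool → ℝ≥0∞) (c : ℕ), IsPattern a (mm 0 0) y → y < 2 ^ S →
        (∀ (m' : Mem), m' 1 0 = 2 ^ (a * i) * (y % 2 ^ a) + mm 1 0 →
          V j m' ≤ G ((y % 2 ^ a).testBit c)) →
        wpc β S (block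
          [.assign 0 0 ((cell 0 0 - cell 5 0 / .const (2 ^ a)) / 2),
           .assign 1 0 (cell 3 0 * (cell 5 0 % .const (2 ^ a)) + cell 1 0),
           .assign 3 0 (cell 3 0 * .const (2 ^ a)),
           .assign 2 0 (cell 2 0 - 1)]) ((mm.set 4 1 (mm 0 0)).set 5 0 y) (0 + 1 + 1 + 1 + 1 + 1)
          (fun m' => ⨅ _ : I j m', V j m') ≤ G ((y % 2 ^ a).testBit c) := by
      rintro y G c ⟨hy1, hy2, hy3⟩ hyS hVG
      have hB := hB y hyS
      set K := y / 2 ^ a with hK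
      have hmod : y % 2 ^ a < 2 ^ a := Nat.mod_lt _ h2a
      have hnew : 2 ^ (a * i) * (y % 2 ^ a) + mm 1 0 < 2 ^ (a * (i + 1)) := by
        rw [hai1', pow_add]
        calc _ < 2 ^ (a * i) * (y % 2 ^ a) + 2 ^ (a * i) := by omega
          _ = 2 ^ (a * i) * (y % 2 ^ a + 1) := by ring
          _ ≤ _ := Nat.mul_le_mul_left _ hmod
      refine wpc_assign h0 0 ((mm 0 0 - K) / 2) hB (Nat.le_of_ble_eq_true rfl) (by simp [hc, haS1])
        rfl (by simp [Mem.set_apply, hK])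
        (((Nat.div_le_self _ _).trans (Nat.sub_le _ _)).trans_lt hr00) fun hB => ?_
      refine wpc_assign h0 0 (2 ^ (a * i) * (y % 2 ^ a) + mm 1 0) hB (Nat.le_of_ble_eq_true rfl)
        (by simp [hc, haS1]) rfl (by simp [Mem.set_apply, hm30])
        (hnew.trans (hZS _ hai1)) fun hB => ?_
      refine wpc_assign h0 0 (2 ^ (a * (i + 1))) hB (Nat.le_of_ble_eq_true rfl)
        (by simp [hc, haS1]) rfl (by simp [Mem.set_apply, hm30, hai1', pow_add])
        (hZS _ hai1) fun hB => ?_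
      refine wpc_assign h0 0 j hB (by decide) (by simp [hc]) rfl (by simp [Mem.set_apply, hm20])
        (by omega) fun hB => ?_
      refine wpc_nil h0 (iInf_le_of_le ⟨hB, ?_, ?_, ?_, i + 1, by omega, ?_, ?_, ?_⟩ (hVG _ ?_))
      all_goals simp [Mem.set_apply]
      · exact hm40
      · omega
      · exact hnew
      · rw [shareSum_succ hm10, ← hy3, ← hsum]
        -- Nothing is lost in rounding: `K ≤ a ≤ mm 0 0`, and `K` has the parity of `mm 0 0`.
        have e1 : (mm 0 0 - K) / 2 * 2 + K = mm 0 0 := by omega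
        calc _ = ((mm 0 0 - K) / 2 * 2 + K) * 2 ^ i + shareSum a i (mm 1 0) := by ring
          _ = _ := by rw [e1]
    have ham2 : a * m < 2 ^ S := by omega
    -- Share `t` was drawn at an earlier level, is being drawn now, or will be drawn later; only the
    -- middle case uses the marginal bound.
    rcases lt_trichotomy (t / a) i with hti | hti | hti
    · have hta : t < a * i := by rwa [Nat.div_lt_iff_lt_mul (by omega), mul_comm] at hti
      obtain ⟨q, hq1, -, hq⟩ := patternProg_spec hS ha hm ham2 hr00 haS (c := 0) (by omega)
      have hVv : V (j + 1) mm = if (mm 1 0).testBit t = b then C else 0 := by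
        rw [hV]; exact if_pos (by rwa [show m - (j + 1) = i by omega])
      rw [hVv]
      refine le_trans (wpc_mono fun m' => le_iInf fun h' => iInf_le_of_le h'.2 ?_)
        ((hq fun _ => if (mm 1 0).testBit t = b then C else 0).trans (le_of_eq ?_))
      · refine step _ (fun _ => if (mm 1 0).testBit t = b then C else 0) 0 h'.1 h'.2 fun mz hmz => ?_
        rw [hV]
        dsimp only
        rw [if_pos (by rw [show m - j = i + 1 by omega]; omega), hmz, testBit_shift_add hm10,
          if_pos hta]
      · rw [← add_mul, hq1, one_mul]
    · have hta : a * i ≤ t := by rw [← hti]; exact Nat.mul_div_le _ _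
      have hta2 : t - a * i < a := by
        have := Nat.lt_mul_div_succ t (show 0 < a by omega)
        rw [hti, mul_add, mul_one] at this
        omega
      obtain ⟨q, hq1, hqb, hq⟩ := patternProg_spec hS ha hm ham2 hr00 haS hta2
      have hVv : V (j + 1) mm = v := by
        rw [hV]; exact if_neg (by rw [show m - (j + 1) = i by omega]; omega)
      rw [hVv]
      refine le_trans (wpc_mono fun m' => le_iInf fun h' => iInf_le_of_le h'.2 ?_)
        ((hq fun b' => if b' = b then C else 0).trans ?_)
      · refine step _ (fun b' => if b' = b then C else 0) _ h'.1 h'.2 fun mz hmz => ?_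
        rw [hV]
        dsimp only
        rw [if_pos (by rw [show m - j = i + 1 by omega]; omega), hmz, testBit_shift_add hm10,
          if_neg (show ¬ t < a * i by omega)]
      · refine le_trans (le_of_eq ?_) (mul_le_mul_left (hqb b) C)
        cases b <;> simp
    · have hta : a * (i + 1) ≤ t := by
        rwa [Nat.lt_iff_add_one_le, Nat.le_div_iff_mul_le (by omega), mul_comm] at hti
      obtain ⟨q, hq1, -, hq⟩ := patternProg_spec hS ha hm ham2 hr00 haS (c := 0) (by omega)
      have hVv : V (j + 1) mm = v := by
        rw [hV]; exact if_neg (by rw [show m - (j + 1) = i by omega]; omega)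
      rw [hVv]
      refine le_trans (wpc_mono fun m' => le_iInf fun h' => iInf_le_of_le h'.2 ?_)
        ((hq fun _ => v).trans (le_of_eq ?_))
      · refine step _ (fun _ => v) 0 h'.1 h'.2 fun mz hmz => ?_
        rw [hV]
        dsimp only
        rw [if_neg (by rw [show m - j = i + 1 by omega]; omega)]
      · rw [← add_mul, hq1, one_mul]
  · rintro mm ⟨hB, hm20, hm40, hge, i, hij, hm30, hm10, hsum⟩
    obtain rfl : i = m := by omega
    refine wpc_nil h0 (iInf_le_of_le ⟨hm10, ?_⟩ ?_)
    · have e : shareSum a i (mm 1 0) + mm 0 0 * 2 ^ i = x + a * 2 ^ i := by rw [← hsum]; ring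
      have := congrArg (· % 2 ^ i) e
      simpa [Nat.ModEq, Mem.output] using this
    · rw [hV]
      dsimp only
      rw [Nat.sub_zero, if_pos ht]
      exact le_rfl
  · refine ⟨hB, ?_, ?_, ?_, 0, ?_⟩ <;> simp [Mem.set_apply, Mem.ofInput, shareSum]
    omega

/-! ## The positions of the entries of an instance -/

/-- The pairs of parts in the order of the encoding. -/
def pairs (k : ℕ) : List (Pair k) :=
  (List.finRange k ×ˢ List.finRange k).filterMap fun q => if h : q.1 < q.2 then some ⟨q, h⟩ else none

theorem pairs_nodup (k : ℕ) : (pairs k).Nodup := by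
  refine List.Nodup.filterMap ?_ ((List.nodup_finRange k).product (List.nodup_finRange k))
  intro q q' p hp hp'
  simp only [Option.mem_def, Option.dite_none_right_eq_some, Option.some_inj] at hp hp'
  obtain ⟨_, rfl⟩ := hp
  obtain ⟨_, h⟩ := hp'
  exact (congrArg Subtype.val h).symm

theorem mem_pairs {k : ℕ} (p : Pair k) : p ∈ pairs k := by
  rw [pairs, List.mem_filterMap]
  exact ⟨p.1, List.pair_mem_product.2 ⟨List.mem_finRange _, List.mem_finRange _⟩, by simp [p.2]⟩

theorem pairs_length (k : ℕ) : (pairs k).length = Fintype.card (Pair k) := by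
  rw [← List.toFinset_card_of_nodup (pairs_nodup k), ← Finset.card_univ]
  congr 1
  ext p
  simp [mem_pairs]

/-- The bit strings in the order of the encoding. -/
def bitStrings (b : ℕ) : List (BitString b) := (List.range (2 ^ b)).map fun s j => s.testBit j

theorem bitStrings_nodup (b : ℕ) : (bitStrings b).Nodup := by
  refine List.Nodup.map_on ?_ List.nodup_range
  intro s hs s' hs' h
  rw [List.mem_range] at hs hs'
  refine Nat.eq_of_testBit_eq fun i => ?_
  rcases lt_or_ge i b with hi | hi
  · exact congrFun h ⟨i, hi⟩
  · have := Nat.pow_le_pow_right (n := 2) (by norm_num) hi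
    rw [Nat.testBit_lt_two_pow (hs.trans_le this), Nat.testBit_lt_two_pow (hs'.trans_le this)]

theorem mem_bitStrings {b : ℕ} (w : BitString b) : w ∈ bitStrings b := by
  have h : (bitStrings b).toFinset = Finset.univ := by
    refine Finset.eq_univ_of_card _ ?_
    rw [List.toFinset_card_of_nodup (bitStrings_nodup b)]
    simp [bitStrings]
  have := Finset.mem_univ w
  rwa [← h, List.mem_toFinset] at this

/-- The positions of the entries of an instance: `none` stands for the bit that tells whether the
edge is present. -/
abbrev Tag (k n g b : ℕ) := Pair k × Fin n × Fin n × Option (Fin g × BitString b)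

/-- The positions in the label of an edge in the order of the encoding. -/
def edgeTags (g b : ℕ) : List (Option (Fin g × BitString b)) :=
  none :: (List.finRange g ×ˢ bitStrings b).map some

/-- The positions in the order of the encoding. -/
def tags (k n g b : ℕ) : List (Tag k n g b) :=
  pairs k ×ˢ (List.finRange n ×ˢ (List.finRange n ×ˢ edgeTags g b))

theorem edgeTags_length (g b : ℕ) : (edgeTags g b).length = 1 + g * 2 ^ b := by
  simp [edgeTags, bitStrings, List.length_product, add_comm]

theorem tags_length (k n g b : ℕ) :
    (tags k n g b).length = (pairs k).length * n * n * (1 + g * 2 ^ b) := by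
  simp [tags, List.length_product, edgeTags_length, mul_assoc]

theorem tags_nodup (k n g b : ℕ) : (tags k n g b).Nodup := by
  refine (pairs_nodup k).product ((List.nodup_finRange n).product
    ((List.nodup_finRange n).product ?_))
  rw [edgeTags, List.nodup_cons]
  refine ⟨by simp, List.Nodup.map (Option.some_injective _) ?_⟩
  exact (List.nodup_finRange g).product (bitStrings_nodup b)

theorem mem_tags {k n g b : ℕ} (τ : Tag k n g b) : τ ∈ tags k n g b := by
  obtain ⟨p, x, y, z⟩ := τ
  refine List.pair_mem_product.2 ⟨mem_pairs p, List.pair_mem_product.2 ⟨List.mem_finRange _,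
    List.pair_mem_product.2 ⟨List.mem_finRange _, ?_⟩⟩⟩
  rcases z with _ | ⟨i, w⟩
  · simp [edgeTags]
  · simp [edgeTags, mem_bitStrings]

/-- The entry of an instance at a position. -/
def tagVal {k n g b : ℕ} (G : LabeledGraph k n g b) : Tag k n g b → ℕ
  | (p, x, y, none) => if (G p x y).isSome then 1 else 0
  | (p, x, y, some (i, w)) => if w ∈ (G p x y).getD (fun _ => ∅) i then 1 else 0

theorem flatMap_filterMap {α β γ : Type*} (l : List α) (f : α → Option β) (h : β → List γ) :
    (l.filterMap f).flatMap h = l.flatMap fun a => ((f a).map h).getD [] := by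
  induction l with
  | nil => rfl
  | cons a l ih =>
    rw [List.flatMap_cons, List.filterMap_cons, ← ih]
    cases f a <;> simp

theorem flatMap_product {α β γ : Type*} (l₁ : List α) (l₂ : List β) (h : α × β → List γ) :
    (l₁ ×ˢ l₂).flatMap h = l₁.flatMap fun a => l₂.flatMap fun b => h (a, b) := by
  simp only [SProd.sprod, List.product, List.flatMap_assoc, List.flatMap_map]

theorem map_product {α β γ : Type*} (l₁ : List α) (l₂ : List β) (h : α × β → γ) :
    (l₁ ×ˢ l₂).map h = l₁.flatMap fun a => l₂.map fun b => h (a, b) := by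
  simp only [SProd.sprod, List.product, List.map_flatMap, List.map_map, Function.comp_def]

theorem encodeEdge_eq {k n g b : ℕ} (G : LabeledGraph k n g b) (p : Pair k) (x y : Fin n) :
    encodeEdge (G p x y) = (edgeTags g b).map fun z => tagVal G (p, x, y, z) := by
  rw [edgeTags, List.map_cons, List.map_map]
  rcases h : G p x y with _ | v
  · simp only [encodeEdge, tagVal, h]
    refine congrArg₂ _ rfl ?_
    rw [eq_comm, List.eq_replicate_iff]
    refine ⟨by simp [bitStrings, List.length_product], ?_⟩
    intro c hc
    obtain ⟨⟨i, w⟩, -, rfl⟩ := List.mem_map.1 hc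
    simp [h]
  · simp only [encodeEdge, tagVal, h]
    refine congrArg₂ _ rfl ?_
    rw [map_product]
    refine List.flatMap_congr fun i _ => ?_
    simp only [encodeSet, bitStrings, List.map_map, Function.comp_def, h, Option.getD_some]

theorem encode_eq {k n g b : ℕ} (G : LabeledGraph k n g b) :
    encode G = [n, g, b] ++ (tags k n g b).map (tagVal G) := by
  rw [encode, tags, map_product, pairs, flatMap_filterMap, flatMap_product]
  congr 1
  refine List.flatMap_congr fun a _ => List.flatMap_congr fun c _ => ?_
  by_cases h : a < c
  · simp only [h, dite_true, Option.map_some, Option.getD_some]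
    rw [map_product]
    refine List.flatMap_congr fun x _ => ?_
    rw [map_product]
    refine List.flatMap_congr fun y _ => ?_
    exact encodeEdge_eq G _ x y
  · simp [h]

theorem getElem?_product {α β : Type*} (l₁ : List α) (l₂ : List β) (o : ℕ) :
    (l₁ ×ˢ l₂)[o]? =
      l₁[o / l₂.length]?.bind fun a => l₂[o % l₂.length]?.map (Prod.mk a) := by
  rcases l₂.length.eq_zero_or_pos with h0 | h0
  · rw [List.length_eq_zero_iff.1 h0]
    simp [SProd.sprod, List.product]
  induction l₁ generalizing o with
  | nil => simp [SProd.sprod, List.product]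
  | cons a l₁ ih =>
    have : (a :: l₁) ×ˢ l₂ = l₂.map (Prod.mk a) ++ l₁ ×ˢ l₂ := by
      simp [SProd.sprod, List.product]
    rw [this]
    rcases lt_or_ge o l₂.length with h | h
    · rw [List.getElem?_append_left (by simpa using h), Nat.div_eq_of_lt h, Nat.mod_eq_of_lt h]
      simp
    · rw [List.getElem?_append_right (by simpa using h), List.length_map, ih,
        Nat.div_eq_sub_div h0 h, Nat.mod_eq_sub_mod h]
      simp

theorem tags_getElem? {k n g b o : ℕ} {p : Pair k} {x y : Fin n} {z : Option (Fin g × BitString b)}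
    (h : (tags k n g b)[o]? = some (p, x, y, z)) :
    (pairs k)[o / (1 + g * 2 ^ b) / (n * n)]? = some p ∧
      (edgeTags g b)[o % (1 + g * 2 ^ b)]? = some z := by
  rw [tags, getElem?_product] at h
  simp only [getElem?_product, List.length_product, List.length_finRange, edgeTags_length,
    Option.bind_eq_some_iff, Option.map_eq_some_iff, Prod.mk.injEq] at h
  obtain ⟨p', hp, _, ⟨x', hx, _, ⟨y', hy, z', hz, rfl⟩, rfl⟩, rfl, rfl, rfl, rfl⟩ := h
  constructor
  · rw [Nat.div_div_eq_div_mul]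
    rwa [show (1 + g * 2 ^ b) * (n * n) = n * (n * (1 + g * 2 ^ b)) by ring]
  · rwa [Nat.mod_mod_of_dvd _ (Dvd.intro_left _ rfl), Nat.mod_mod_of_dvd _ (Dvd.intro_left _ (mul_assoc n n _))] at hz

/-- The number of a pair of parts. -/
def pairIdx {k : ℕ} (p : Pair k) : ℕ := (pairs k).idxOf p

theorem pairIdx_lt {k : ℕ} (p : Pair k) : pairIdx p < (pairs k).length :=
  List.idxOf_lt_length_of_mem (mem_pairs p)

theorem mod_eq_zero_of_tag_none {k n g b o : ℕ} {p : Pair k} {x y : Fin n}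
    (h : (tags k n g b)[o]? = some (p, x, y, none)) : o % (1 + g * 2 ^ b) = 0 := by
  have h2 := (tags_getElem? h).2
  rcases h3 : o % (1 + g * 2 ^ b) with _ | r
  · rfl
  · rw [h3, edgeTags, List.getElem?_cons_succ] at h2
    simp at h2

theorem partAt_of_tag_some {k n g b o : ℕ} {p : Pair k} {x y : Fin n} {i : Fin g} {w : BitString b}
    (h : (tags k n g b)[o]? = some (p, x, y, some (i, w))) :
    o % (1 + g * 2 ^ b) ≠ 0 ∧ partAt n g (2 ^ b) o = pairIdx p * g + i := by
  obtain ⟨h1, h2⟩ := tags_getElem? h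
  have hidx : pairIdx p = o / (1 + g * 2 ^ b) / (n * n) := by
    obtain ⟨hlt, h1⟩ := List.getElem?_eq_some_iff.1 h1
    rw [pairIdx, ← h1]
    exact (pairs_nodup k).idxOf_getElem _ _
  rcases h3 : o % (1 + g * 2 ^ b) with _ | r
  · rw [h3, edgeTags] at h2
    simp at h2
  · refine ⟨by simp, ?_⟩
    rw [h3, edgeTags, List.getElem?_cons_succ, List.getElem?_map, Option.map_eq_some_iff] at h2
    obtain ⟨_, h2, h4⟩ := h2
    rw [Option.some_inj] at h4
    subst h4
    rw [getElem?_product, Option.bind_eq_some_iff] at h2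
    obtain ⟨i', hi, h2⟩ := h2
    rw [Option.map_eq_some_iff] at h2
    obtain ⟨w', -, h2⟩ := h2
    obtain ⟨rfl, rfl⟩ := Prod.mk.inj h2
    rw [show (bitStrings b).length = 2 ^ b by simp [bitStrings]] at hi
    obtain ⟨hlt, hi⟩ := List.getElem?_eq_some_iff.1 hi
    rw [List.getElem_finRange] at hi
    rw [partAt, h3, Nat.add_sub_cancel, ← hidx]
    congr 1
    exact congrArg Fin.val hi

/-- The labels selected from the shares `Z` by `J`. -/
def queryLabels {k n g b : ℕ} (t J : ℕ) (Z : ℕ → ℕ) : Labels k n g b := fun p x y i =>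
  Finset.univ.filter fun w =>
    (Z ((tags k n g b).idxOf (p, x, y, some (i, w)))).testBit (digit t J (pairIdx p * g + i)) = true

/-- What `A` receives is the genuine encoding of a complete instance, so its guarantees apply. -/
theorem encode_queryLabels {k n g b : ℕ} (t J : ℕ) (Z : ℕ → ℕ) :
    encode (completeGraph (queryLabels t J Z : Labels k n g b)) = [n, g, b] ++
      (List.range (tags k n g b).length).map fun o => entryAt n g (2 ^ b) t J o (Z o) := by
  rw [encode_eq]
  congr 1
  refine List.ext_getElem (by simp) fun o h1 h2 => ?_
  simp only [List.length_map, List.length_range] at h1 h2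
  rw [List.getElem_map, List.getElem_map, List.getElem_range]
  have hidx := (tags_nodup k n g b).idxOf_getElem o h1
  have ho : (tags k n g b)[o]? = some (tags k n g b)[o] := List.getElem?_eq_getElem h1
  generalize (tags k n g b)[o] = τ at *
  obtain ⟨p, x, y, _ | ⟨i, w⟩⟩ := τ
  · rw [entryAt, if_pos (mod_eq_zero_of_tag_none ho)]
    simp [tagVal, completeGraph]
  · obtain ⟨h3, h4⟩ := partAt_of_tag_some ho
    rw [entryAt, if_neg h3, h4]
    simp only [tagVal, completeGraph, Option.getD_some, queryLabels, Finset.mem_filter,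
      Finset.mem_univ, true_and, hidx]
    simp only [Nat.testBit_eq_decide_div_mod_eq, decide_eq_true_eq]
    split_ifs with h5
    · exact h5.symm
    · omega

/-! ## The count as a polynomial -/

/-- The polynomial that computes the count from the indicators of the membership of bit strings in
the sets of an instance. -/
def countPoly {R : Type*} [CommSemiring R] {k n g b : ℕ} (f : (Pair k → BitString b) → Bool)
    (X : Pair k → Fin n → Fin n → Fin g → BitString b → R) : R :=
  ∑ v : Fin k → Fin n, ∏ i : Fin g, ∑ w : Pair k → BitString b,
    ((f w).toNat : R) * ∏ p : Pair k, X p (v p.1.1) (v p.1.2) i (w p)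

/-- A tuple that leaves one of the labels has a vanishing factor, so the inner sums may run over all
tuples. The clique condition disappears for the same reason, an absent edge being encoded with empty
sets. -/
theorem count_eq_countPoly {R : Type*} [CommSemiring R] {k n g b : ℕ} (hg : 1 ≤ g)
    (f : (Pair k → BitString b) → Bool) (G : LabeledGraph k n g b) :
    (count f G : R) = countPoly f fun p x y i w => ((tagVal G (p, x, y, some (i, w)) : ℕ) : R) := by
  have key : ∀ (v : Fin k → Fin n) (i : Fin g),
      ((acceptCount f fun p => (G p (v p.1.1) (v p.1.2)).getD (fun _ => ∅) i : ℕ) : R) =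
      ∑ w : Pair k → BitString b, ((f w).toNat : R) *
        ∏ p : Pair k, ((tagVal G (p, v p.1.1, v p.1.2, some (i, w p)) : ℕ) : R) := by
    intro v i
    rw [acceptCount, Nat.cast_sum, ← Finset.sum_subset (Finset.subset_univ _)]
    · refine Finset.sum_congr rfl fun w hw => ?_
      rw [Fintype.mem_piFinset] at hw
      rw [Finset.prod_eq_one, mul_one]
      intro p _
      simp [tagVal, hw p]
    · intro w _ hw
      rw [Fintype.mem_piFinset] at hw
      push Not at hw
      obtain ⟨p, hp⟩ := hw
      rw [Finset.prod_eq_zero (Finset.mem_univ p), mul_zero]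
      simp [tagVal, hp]
  rw [count, Nat.cast_sum, countPoly]
  refine Finset.sum_congr rfl fun v _ => ?_
  rw [← Finset.prod_congr rfl fun i _ => key v i, cliqueCount]
  split_ifs with h
  · rw [Nat.cast_prod]
  · rw [IsClique] at h
    push Not at h
    obtain ⟨p, hp⟩ := h
    have h0 : ∀ i, (acceptCount f fun p => (G p (v p.1.1) (v p.1.2)).getD (fun _ => ∅) i) = 0 := by
      intro i
      rw [acceptCount]
      refine Finset.sum_eq_zero fun w hw => ?_
      have := Fintype.mem_piFinset.1 hw p
      simp [hp] at this
    -- Here `g ≥ 1` is essential: an empty product would count a non-clique.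
    rw [Finset.prod_eq_zero (Finset.mem_univ ⟨0, hg⟩), Nat.cast_zero]
    rw [h0, Nat.cast_zero]

/-- Every monomial contains exactly one variable of each class `(i, p)`. Expansion therefore needs
one share index per class rather than per entry, which keeps the number of queries at `t ^ (l * g)`.
-/
theorem countPoly_share {R : Type*} [CommSemiring R] {k n g b t : ℕ}
    (f : (Pair k → BitString b) → Bool) (c : Fin t → R)
    (z : Pair k → Fin n → Fin n → Fin g → BitString b → Fin t → R) :
    countPoly f (fun p x y i w => ∑ j, c j * z p x y i w j) =
      ∑ J : Fin g → Pair k → Fin t, (∏ i, ∏ p, c (J i p)) *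
        countPoly f fun p x y i w => z p x y i w (J i p) := by
  simp only [countPoly, Finset.mul_sum]
  rw [Finset.sum_comm]
  refine Finset.sum_congr rfl fun v _ => ?_
  have h1 : ∀ i : Fin g, (∑ w : Pair k → BitString b, ((f w).toNat : R) *
      ∏ p : Pair k, ∑ j, c j * z p (v p.1.1) (v p.1.2) i (w p) j) =
      ∑ J : Pair k → Fin t, (∏ p, c (J p)) * ∑ w : Pair k → BitString b, ((f w).toNat : R) *
        ∏ p : Pair k, z p (v p.1.1) (v p.1.2) i (w p) (J p) := by
    intro i
    simp only [Finset.mul_sum]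
    rw [Finset.sum_comm]
    refine Finset.sum_congr rfl fun w _ => ?_
    rw [Finset.prod_univ_sum, Fintype.piFinset_univ, Finset.mul_sum]
    refine Finset.sum_congr rfl fun J _ => ?_
    rw [Finset.prod_mul_distrib]
    ring
  rw [Finset.prod_congr rfl fun i _ => h1 i, Finset.prod_univ_sum, Fintype.piFinset_univ]
  refine Finset.sum_congr rfl fun J _ => ?_
  rw [Finset.prod_mul_distrib]

/-! ## Digits -/

/-- The pairs of parts and coordinates are numbered by the natural numbers below `g * l`. -/
def partEquiv (k g : ℕ) : Fin g × Pair k ≃ Fin ((pairs k).length * g) :=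
  ((Equiv.prodComm _ _).trans (Equiv.prodCongrLeft fun _ =>
    ((pairs_nodup k).getEquivOfForallMemList _ mem_pairs).symm)).trans finProdFinEquiv

theorem partEquiv_apply (k g : ℕ) (i : Fin g) (p : Pair k) :
    (partEquiv k g (i, p) : ℕ) = pairIdx p * g + i := by
  simp [partEquiv, pairIdx, List.Nodup.getEquivOfForallMemList, mul_comm, add_comm]
  exact Or.inl (by congr!)

/-- Base `t` expansion identifies the assignments of a share index to each class with the numbers
over which the program loops. -/
theorem sum_digits {R : Type*} [CommSemiring R] {k g t : ℕ} (ht : 0 < t)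
    (F : (Fin g → Pair k → ℕ) → R) :
    ∑ J : Fin g → Pair k → Fin t, F (fun i p => J i p) =
      ∑ J ∈ Finset.range (t ^ ((pairs k).length * g)),
        F fun i p => digit t J (pairIdx p * g + i) := by
  have : NeZero t := ⟨ht.ne'⟩
  rw [Finset.sum_range]
  refine Fintype.sum_equiv ((Equiv.curry _ _ _).symm.trans
    (((partEquiv k g).arrowCongr (Equiv.refl _)).trans finFunctionFinEquiv)) _ _ fun J => ?_
  congr 1
  funext i p
  set φ := ((partEquiv k g).arrowCongr (Equiv.refl (Fin t))) ((Equiv.curry _ _ _).symm J) with hφ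
  have h1 : (finFunctionFinEquiv.symm (finFunctionFinEquiv φ)) (partEquiv k g (i, p)) = J i p := by
    rw [Equiv.symm_apply_apply, hφ]
    simp [Equiv.arrowCongr, Equiv.curry]
  rw [← h1]
  rw [← partEquiv_apply]
  rfl

theorem shareSum_eq (a m Z : ℕ) (ha : 0 < a) :
    shareSum a m Z = ∑ j ∈ Finset.range (a * m), 2 ^ (j / a) * (Z.testBit j).toNat := by
  induction m with
  | zero => simp [shareSum]
  | succ m ih =>
    rw [shareSum, Finset.sum_range_succ, ← shareSum, ih, mul_add, mul_one, Finset.sum_range_add,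
      Finset.mul_sum]
    congr 1
    refine Finset.sum_congr rfl fun c hc => ?_
    rw [Nat.mul_add_div ha, Nat.div_eq_of_lt (Finset.mem_range.1 hc), add_zero]

theorem levelSum_eq {k g : ℕ} (a t J : ℕ) :
    levelSum a t ((pairs k).length * g) J =
      ∑ i : Fin g, ∑ p : Pair k, digit t J (pairIdx p * g + i) / a := by
  rw [levelSum, Finset.sum_range, ← Fintype.sum_prod_type', ← (partEquiv k g).sum_comp]
  refine Finset.sum_congr rfl fun q _ => ?_
  rw [← partEquiv_apply]

/-- In `ZMod (2 ^ m)` each membership bit may be replaced by the linear form in its shares, and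
`countPoly_share` expands the result. Presence bits do not occur in the polynomial, so their shares
are without influence. -/
theorem count_eq_sum_queries {k n g b a m : ℕ} (hg : 1 ≤ g) (ha : 0 < a) (hm : 0 < m)
    (f : (Pair k → BitString b) → Bool) (G : LabeledGraph k n g b) (Z : ℕ → ℕ)
    (hZ : ∀ o (ho : o < (tags k n g b).length),
      shareSum a m (Z o) ≡ tagVal G (tags k n g b)[o] [MOD 2 ^ m]) :
    count f G ≡ ∑ J ∈ Finset.range ((a * m) ^ ((pairs k).length * g)),
      2 ^ levelSum a (a * m) ((pairs k).length * g) J *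
        count f (completeGraph (queryLabels (a * m) J Z : Labels k n g b)) [MOD 2 ^ m] := by
  rw [← ZMod.natCast_eq_natCast_iff, count_eq_countPoly hg]
  have hX : (fun (p : Pair k) x y i w => ((tagVal G (p, x, y, some (i, w)) : ℕ) : ZMod (2 ^ m))) =
      fun p x y i w => ∑ j : Fin (a * m), ((2 ^ ((j : ℕ) / a) : ℕ) : ZMod (2 ^ m)) *
        (((Z ((tags k n g b).idxOf (p, x, y, some (i, w)))).testBit j).toNat : ZMod (2 ^ m)) := by
    funext p x y i w
    have hmem := mem_tags (p, x, y, some (i, w))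
    have hlt := List.idxOf_lt_length_of_mem hmem
    have := (ZMod.natCast_eq_natCast_iff _ _ _).2 (hZ _ hlt)
    rw [List.getElem_idxOf] at this
    rw [← this, shareSum_eq _ _ _ ha, Nat.cast_sum, Finset.sum_range]
    push_cast
    rfl
  rw [hX, countPoly_share]
  set F : (Fin g → Pair k → ℕ) → ZMod (2 ^ m) := fun D =>
    (∏ i, ∏ p, ((2 ^ (D i p / a) : ℕ) : ZMod (2 ^ m))) * countPoly f fun p x y i w =>
      (((Z ((tags k n g b).idxOf (p, x, y, some (i, w)))).testBit (D i p)).toNat : ZMod (2 ^ m))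
    with hF
  refine Eq.trans (Finset.sum_congr rfl fun J _ => ?_)
    ((sum_digits (Nat.mul_pos ha hm) F).trans ?_)
  · rfl
  rw [Nat.cast_sum]
  refine Finset.sum_congr rfl fun J _ => ?_
  rw [Nat.cast_mul, levelSum_eq, count_eq_countPoly hg]
  refine congrArg₂ (· * ·) ?_ (congrArg (countPoly f) ?_)
  · simp only [← Finset.prod_pow_eq_pow_sum, Nat.cast_prod]
  · funext p x y i w
    simp only [tagVal, completeGraph, queryLabels, Option.getD_some, Finset.mem_filter,
      Finset.mem_univ, true_and]
    generalize (Z ((tags k n g b).idxOf (p, x, y, some (i, w)))).testBit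
      (digit (a * m) J (pairIdx p * g + i)) = c
    cases c <;> simp

/-! ## The number of queries and the size of the count -/

/-- The summand `k` is the gap between the exponents in the number of queries and in the threshold.
-/
theorem two_mul_pairs_length (k : ℕ) : 2 * (pairs k).length + k = k ^ 2 := by
  have h : ∑ q : Fin k × Fin k, ((if q.1 < q.2 then 1 else 0) + (if q.2 < q.1 then 1 else 0) +
      if q.1 = q.2 then 1 else 0) = k ^ 2 := by
    rw [Finset.sum_congr rfl (g := fun _ => 1)]
    · simp [sq]
    · intro q _
      rcases lt_trichotomy q.1 q.2 with h | h | h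
      · simp [h, h.ne, h.not_gt]
      · simp [h]
      · simp [h, h.ne', h.not_gt]
  rw [Finset.sum_add_distrib, Finset.sum_add_distrib] at h
  have h2 : ∑ q : Fin k × Fin k, (if q.2 < q.1 then 1 else 0) =
      ∑ q : Fin k × Fin k, (if q.1 < q.2 then 1 else 0) :=
    Fintype.sum_equiv (Equiv.prodComm _ _) _ _ fun q => rfl
  have h3 : ∑ q : Fin k × Fin k, (if q.1 = q.2 then 1 else 0) = k := by
    rw [Fintype.sum_prod_type]; simp
  have h4 : ∑ q : Fin k × Fin k, (if q.1 < q.2 then 1 else 0) = (pairs k).length := by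
    rw [pairs_length, Fintype.card_subtype, Finset.card_filter]
  rw [h2, h3, h4] at h
  omega

theorem count_lt {k n g b : ℕ} (hk : 0 < k) {s : ℕ} (hn : n < 2 ^ s) (f : (Pair k → BitString b) → Bool)
    (G : LabeledGraph k n g b) : count f G < 2 ^ (k * s + (pairs k).length * b * g) := by
  have h1 : ∀ v, cliqueCount f G v ≤ 2 ^ ((pairs k).length * b * g) := by
    intro v
    rw [cliqueCount]
    split_ifs
    · rw [pow_mul]
      refine (Finset.prod_le_pow_card _ _ (2 ^ ((pairs k).length * b)) fun i _ => ?_).trans (by simp)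
      rw [acceptCount]
      refine (Finset.sum_le_card_nsmul _ _ 1 fun w _ => ?_).trans ?_
      · cases f w <;> simp
      · refine (Nat.mul_le_mul_right _ (Finset.card_le_univ _)).trans ?_
        simp [pairs_length, ← pow_mul, mul_comm]
    · positivity
  calc count f G ≤ (Finset.univ : Finset (Fin k → Fin n)).card • 2 ^ ((pairs k).length * b * g) :=
        Finset.sum_le_card_nsmul _ _ _ fun v _ => h1 v
    _ = n ^ k * 2 ^ ((pairs k).length * b * g) := by simp
    _ < (2 ^ s) ^ k * 2 ^ ((pairs k).length * b * g) :=
        Nat.mul_lt_mul_of_pos_right (Nat.pow_lt_pow_left hn hk.ne') (by positivity)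
    _ = _ := by rw [← pow_mul, ← pow_add, mul_comm s k]

/-! ## The distribution of the random instances -/

theorem iid_apply {ι α : Type} [Fintype ι] [Fintype α] (p : PMF α) (x : ι → α) :
    iid p x = ∏ i, p (x i) := rfl

theorem biasedCoin_apply (μ : ℝ≥0) (hμ : μ ≤ 1) (c : Bool) :
    biasedCoin μ hμ c = if c then (μ : ℝ≥0∞) else (1 - μ : ℝ≥0) := rfl

theorem randomSet_apply (μ : ℝ≥0) (hμ : μ ≤ 1) (b : ℕ) (Z : Finset (BitString b)) :
    randomSet μ hμ b Z = ∏ w, biasedCoin μ hμ (decide (w ∈ Z)) := by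
  rw [randomSet, PMF.map_apply, tsum_eq_single fun w => decide (w ∈ Z)]
  · rw [if_pos (by ext w; simp), iid_apply]
  · intro x hx
    refine if_neg fun h => hx ?_
    funext w
    rw [h]
    simp

/-- The probability of the entry of a random instance at a position. -/
def tagProb {k n g b : ℕ} (β : PMF Bool) (L : Labels k n g b) : Tag k n g b → ℝ≥0∞
  | (_, _, _, none) => 1
  | (p, x, y, some (i, w)) => β (decide (w ∈ L p x y i))

theorem prod_map_tags {M : Type*} [CommMonoid M] {k n g b : ℕ} (F : Tag k n g b → M) :
    ((tags k n g b).map F).prod = ∏ τ, F τ := by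
  classical
  rw [← List.prod_toFinset _ (tags_nodup k n g b)]
  refine Finset.prod_congr ?_ fun _ _ => rfl
  ext τ
  simp [mem_tags]

/-- Presence bits contribute a factor one. This makes the probability of a labeling a product over
all cells of the encoding, which matches the sampling of shares cell by cell. -/
theorem randomLabels_apply (μ : ℝ≥0) (hμ : μ ≤ 1) {k n g b : ℕ} (L : Labels k n g b) :
    randomLabels μ hμ k n g b L = ((tags k n g b).map (tagProb (biasedCoin μ hμ) L)).prod := by
  rw [prod_map_tags, Fintype.prod_prod_type]
  simp only [randomLabels, labelsOfSets, iid_apply]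
  refine Finset.prod_congr rfl fun p _ => ?_
  rw [Fintype.prod_prod_type]
  refine Finset.prod_congr rfl fun x _ => ?_
  rw [Fintype.prod_prod_type]
  refine Finset.prod_congr rfl fun y _ => ?_
  rw [Fintype.prod_option, Fintype.prod_prod_type]
  simp only [tagProb, one_mul, randomSet_apply]

theorem randomSet_half (h : (1 / 2 : ℝ≥0) ≤ 1) (b : ℕ) :
    randomSet (1 / 2) h b = PMF.uniformOfFintype (Finset (BitString b)) := by
  have h1 : ∀ c, biasedCoin (1 / 2) h c = 2⁻¹ := by
    intro c
    have h2 : (1 - 1 / 2 : ℝ≥0) = 1 / 2 := by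
      rw [tsub_eq_iff_eq_add_of_le h, add_halves]
    have h3 : ((1 / 2 : ℝ≥0) : ℝ≥0∞) = 2⁻¹ := by simp
    rw [biasedCoin_apply, h2, h3, ite_self]
  ext Z
  rw [randomSet_apply, PMF.uniformOfFintype_apply]
  simp only [h1]
  simp [ENNReal.inv_pow]

theorem randomLabels_half (h : (1 / 2 : ℝ≥0) ≤ 1) (k n g b : ℕ) :
    randomLabels (1 / 2) h k n g b = uniformLabels k n g b := by
  rw [randomLabels, uniformLabels, randomSet_half]

/-- Since `0 < μ < 1`, both outcomes have positive probability and `β c * 2⁻¹ + β (!c) < 1`, so all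
conditions except parity hold for every large `a`. -/
theorem exists_suitable {μ : ℝ≥0} (h0 : 0 < μ) (h1 : μ < 1) : ∃ a, Suitable (biasedCoin μ h1.le) a := by
  set β := biasedCoin μ h1.le with hβ
  have hpos : ∀ c, 0 < β c := by
    intro c
    rw [hβ, biasedCoin_apply]
    cases c
    · simpa using h1
    · simpa using h0
  have hadd : ∀ c, β c + β (!c) = 1 := by
    intro c
    cases c
    · rw [add_comm]; exact coin_add β
    · exact coin_add β
  have e1 : ∀ c, ∀ᶠ a : ℕ in atTop, 2 * (β c * 2⁻¹ + β !c) ^ a ≤ 2⁻¹ := by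
    intro c
    have hlt : β c * 2⁻¹ + β (!c) < 1 := by
      have ht : β (!c) ≠ ⊤ := PMF.apply_ne_top _ _
      calc β c * 2⁻¹ + β (!c) < β c + β (!c) := by
            refine ENNReal.add_lt_add_right ht ?_
            rw [← div_eq_mul_inv]
            exact ENNReal.half_lt_self (hpos c).ne' (PMF.apply_ne_top _ _)
        _ = 1 := hadd c
    have h2 := ENNReal.tendsto_pow_atTop_nhds_zero_of_lt_one hlt
    have h3 : (0 : ℝ≥0∞) < 4⁻¹ := by simp
    filter_upwards [h2.eventually_le_const h3] with a ha
    calc _ ≤ 2 * (4 : ℝ≥0∞)⁻¹ := by gcongr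
      _ = 2⁻¹ := by
        rw [show (4 : ℝ≥0∞) = 2 * 2 by norm_num, ENNReal.mul_inv (by simp) (by simp), ← mul_assoc,
          ENNReal.mul_inv_cancel (by simp) (by simp), one_mul]
  have e2 : ∀ c, ∀ᶠ a : ℕ in atTop, 1 ≤ a * β c := by
    intro c
    obtain ⟨N, hN⟩ := ENNReal.exists_nat_mul_gt (hpos c).ne' (b := 1) (by simp)
    filter_upwards [eventually_ge_atTop N] with a ha
    refine hN.le.trans ?_
    gcongr
  have e3 := (((e1 true).and (e1 false)).and ((e2 true).and (e2 false))).and (eventually_ge_atTop 4)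
  obtain ⟨N, hN⟩ := eventually_atTop.1 e3
  -- Doubling `N` secures evenness.
  obtain ⟨⟨⟨h1, h2⟩, h3, h4⟩, h5⟩ := hN (2 * N) (by omega)
  exact ⟨2 * N, even_two_mul N, h5, fun c => by cases c <;> assumption,
    fun c => by cases c <;> assumption⟩

/-! ## One query -/

theorem Mem.set_of_ne (m : Mem) {a a' : ℕ} (i v : ℕ) (h : a' ≠ a) : m.set a i v a' = m a' := by
  funext i'
  simp [Mem.set_apply, h]

theorem ofInput_map_range {N i : ℕ} (h : ℕ → ℕ) (hi : i < N) :
    Mem.ofInput ((List.range N).map h) 0 i = h i := by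
  rw [ofInput_zero, List.getD_eq_getElem?_getD, List.getElem?_map, List.getElem?_range hi]
  rfl

/-- The numbers of an instance with parameters `k`, `n`, `g`, `b` and of the shares of its entries,
`a` for each of `m` levels, are less than `2 ^ S`. -/
structure Fits (k n g b a m S : ℕ) : Prop where
  seven_le : 7 ≤ S
  g_pos : 1 ≤ g
  a_pos : 0 < a
  m_pos : 0 < m
  n_lt : n < 2 ^ S
  g_lt : g < 2 ^ S
  b_lt : b < 2 ^ S
  two_pow_b_lt : 2 ^ b < 2 ^ S
  edge_lt : 1 + g * 2 ^ b < 2 ^ S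
  length_lt : (tags k n g b).length + 8 < 2 ^ S
  a_const_lt : 2 ^ a * (a + 1) < 2 ^ S
  shares_lt : a * m < S
  start_lt : 1 + a * 2 ^ m < 2 ^ S
  parts_le : (pairs k).length * g ≤ S
  queries_lt : (a * m) ^ ((pairs k).length * g) < 2 ^ S
  level_lt : (pairs k).length * g * m < S
  total_lt : (a * m) ^ ((pairs k).length * g) * (2 ^ ((pairs k).length * g * m) * 2 ^ m) < 2 ^ S

/-- Input `[n, g, b, 2 ^ b, N, t, M, J]` and the shares of the `N` entries, output the output of `A`
on the instance with number `J`, modulo `M`. -/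
def queryProg (A : Prog) : Prog := block
  [.assign 5 1 (cell 0 0), .assign 5 2 (cell 0 1), .assign 5 3 (cell 0 3),
   .assign 5 5 (cell 0 7), .assign 5 6 (cell 0 5),
   .assign 6 0 (cell 0 0), .assign 6 1 (cell 0 1), .assign 6 2 (cell 0 2),
   .assign 2 0 (cell 0 4),
   .loop (cell 2 0) (block
    [.assign 2 0 (cell 2 0 - 1),
     .assign 5 0 (cell 2 0),
     .assign 5 4 (cell 0 (8 + cell 2 0)),
     .call 6 (3 + cell 2 0) 5 7 entryProg]),
   .call 7 0 6 (3 + cell 0 4) A,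
   .assign 1 0 (cell 7 0 % cell 0 6)]

/-- The answer of `A` may be far larger than `2 ^ S`, so the memory is unbounded between the call
and the reduction modulo `2 ^ m`. Both statements are treated together with explicit costs, the bit
length of the answer being bounded by the running time. -/
theorem wpc_call_mod {S : ℕ} (hS : 7 ≤ S) {A : Prog} {m : Mem} (hm : Bdd S m) {x : List ℕ} {T : ℝ}
    {D : PMF ℕ} (hA : Computes β A x T D) (hx : callInput 6 (3 + cell 0 4) m = x)
    (F : Mem → ℝ≥0∞) :
    wpc β S (block [.call 7 0 6 (3 + cell 0 4) A, .assign 1 0 (cell 7 0 % cell 0 6)]) m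
      (5 * ⌊T⌋₊ + 5) F ≤ expect D fun y => F ((m.set 7 0 y).set 1 0 (y % m 0 6)) := by
  have h0 : 0 < S := by omega
  have hc := lt_two_pow_of_le_hundred hS
  refine (wp_seq_le _ _ _ _).trans ((wp_call_le _ _ _ _ _ _ _).trans ?_)
  rw [hx]
  refine hA.wp_le _ _ fun m' c hcT hy => ?_
  refine (wp_seq_le _ _ _ _).trans ((wp_assign_le _ _ _ _ _).trans ((wp_skip_le _ _).trans ?_))
  refine iInf_le_of_le ?_ (le_of_eq ?_)
  · have hT := Nat.le_floor hcT
    have h1 := (3 + cell 0 4 : Expr).cost_le h0 hm (by simp [hc])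
    have h2 : (3 + cell 0 4 : Expr).weight = 10 := rfl
    have h3 : (m 0 6).size ≤ S := Nat.size_le.2 (hm _ _)
    have h4 : (m'.output % m 0 6).size ≤ m'.output.size := Nat.size_le_size (Nat.mod_le _ _)
    have h5 : (5 * ⌊T⌋₊ + 5) * (100 * S) = 500 * (⌊T⌋₊ * S) + 500 * S := by ring
    have h6 : ⌊T⌋₊ ≤ ⌊T⌋₊ * S := Nat.le_mul_of_pos_right _ h0
    have e1 : ∀ m'' : Mem, (cell 7 0 % cell 0 6 : Expr).cost m'' = 1 + (1 + 1 + 0 + (m'' 7 0).size) +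
      (1 + 4 + 3 + (m'' 0 6).size) + (m'' 7 0).size + (m'' 0 6).size := fun m'' => by
      have h6 : Nat.size 6 = 3 := by simp [Nat.size, Nat.binaryRec]
      have : (cell 7 0 % cell 0 6 : Expr).cost m'' = 1 + (1 + (1 + Nat.size 0) + Nat.size 0 +
        (m'' 7 0).size) + (1 + (1 + Nat.size 6) + Nat.size 6 + (m'' 0 6).size) + (m'' 7 0).size +
        (m'' 0 6).size := rfl
      rw [this, h6, Nat.size_zero]
    have e2 : ∀ m'' : Mem, (0 : Expr).val m'' = 0 := fun _ => rfl
    have e3 : ∀ m'' : Mem, (0 : Expr).cost m'' = 1 := fun _ => rfl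
    rw [e1]
    simp only [e3, e2, val_mod, val_read, val_ofNat, Mem.set_apply, Nat.size_zero]
    norm_num
    rw [h2] at h1
    omega
  · simp [Mem.set_apply]

theorem queryProg_spec {k n g b a m S : ℕ} (hf : Fits k n g b a m S) {J : ℕ}
    (hJ : J < 2 ^ S) (h : ℕ → ℕ) (hh : ∀ i, h i < 2 ^ S)
    (h0 : h 0 = n) (h1 : h 1 = g) (h2 : h 2 = b) (h3 : h 3 = 2 ^ b)
    (h4 : h 4 = (tags k n g b).length) (h5 : h 5 = a * m) (h7 : h 7 = J)
    {A : Prog} {T : ℝ} {D : PMF ℕ}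
    (hA : Computes β A (encode (completeGraph
      (queryLabels (a * m) J (fun o => h (8 + o)) : Labels k n g b))) T D) (G : ℕ → ℝ≥0∞) :
    wpc β S (queryProg A) (Mem.ofInput ((List.range (8 + (tags k n g b).length)).map h))
      (5 * ⌊T⌋₊ + (tags k n g b).length * (10 * S + 40) + 20)
      (fun m' => G m'.output) ≤ expect D fun y => G (y % h 6) := by
  have hS := hf.seven_le
  have hS0 : 0 < S := by omega
  have hc := lt_two_pow_of_le_hundred hS
  set N := (tags k n g b).length with hN
  have hN2 : N + 8 < 2 ^ S := hf.length_lt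
  set inp := (List.range (8 + N)).map h with hinp
  have hin : ∀ i, i < 8 + N → Mem.ofInput inp 0 i = h i := fun i hi => ofInput_map_range h hi
  have hin8 : ∀ i, i < 8 → Mem.ofInput inp 0 i = h i := fun i hi => hin i (by omega)
  have hB : Bdd S (Mem.ofInput inp) := Bdd.ofInput fun v hv => by
    obtain ⟨i, -, rfl⟩ := List.mem_map.1 hv
    exact hh i
  set e := fun o => entryAt n g (2 ^ b) (a * m) J o (h (8 + o)) with he
  refine wpc_budget (k := (5 * ⌊T⌋₊ + 5) + (N * ((10 * S + 20 + 7 + 1 + 4) + 1) + 1) + 1 + 1 + 1 + 1 + 1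
    + 1 + 1 + 1 + 1) ?_ ?_
  · have : N * (10 * S + 40) = N * (10 * S + 20 + 7 + 1 + 4 + 1) + N * 7 := by ring
    omega
  refine wpc_assign hS0 1 n hB (by decide) (by simp [hc]) rfl (by simp [hin8, h0]) hf.n_lt
    fun hB => ?_
  refine wpc_assign hS0 2 g hB (by decide) (by simp [hc]) rfl
    (by simp [Mem.set_of_ne, hin8, h1]) hf.g_lt fun hB => ?_
  refine wpc_assign hS0 3 (2 ^ b) hB (by decide) (by simp [hc]) rfl
    (by simp [Mem.set_of_ne, hin8, h3]) hf.two_pow_b_lt fun hB => ?_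
  refine wpc_assign hS0 5 J hB (by decide) (by simp [hc]) rfl
    (by simp [Mem.set_of_ne, hin8, h7]) hJ fun hB => ?_
  refine wpc_assign hS0 6 (a * m) hB (by decide) (by simp [hc]) rfl
    (by simp [Mem.set_of_ne, hin8, h5]) (hf.shares_lt.trans Nat.lt_two_pow_self) fun hB => ?_
  refine wpc_assign hS0 0 n hB (by decide) (by simp [hc]) rfl
    (by simp [Mem.set_of_ne, hin8, h0]) hf.n_lt fun hB => ?_
  refine wpc_assign hS0 1 g hB (by decide) (by simp [hc]) rfl
    (by simp [Mem.set_of_ne, hin8, h1]) hf.g_lt fun hB => ?_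
  refine wpc_assign hS0 2 b hB (by decide) (by simp [hc]) rfl
    (by simp [Mem.set_of_ne, hin8, h2]) hf.b_lt fun hB => ?_
  refine wpc_assign hS0 0 N hB (by decide) (by simp [hc]) rfl
    (by simp [Mem.set_of_ne, hin8, h4]) (by omega) fun hB => ?_
  -- The instance is filled in from its end: with `j` iterations left, the entries from `j` on are
  -- in place.
  refine wpc_loop hS0 (fun j mm => Bdd S mm ∧ j ≤ N ∧ mm 2 0 = j ∧ mm 0 = Mem.ofInput inp 0 ∧
    (mm 5 1 = n ∧ mm 5 2 = g ∧ mm 5 3 = 2 ^ b ∧ mm 5 5 = J ∧ mm 5 6 = a * m) ∧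
    (mm 6 0 = n ∧ mm 6 1 = g ∧ mm 6 2 = b) ∧ ∀ o, j ≤ o → o < N → mm 6 (3 + o) = e o)
    (fun _ _ => expect D fun y => G (y % h 6)) (by decide) (by simp [hc]) (fun j m h => h.1)
    (fun m h => by simp [h.2.2.1]) (fun j m h => by simp [h.2.2.1]) ?_ ?_ ?_
  · rintro j mm ⟨hB, hjN, hm2, hm0, ⟨hm51, hm52, hm53, hm55, hm56⟩, ⟨hm60, hm61, hm62⟩, hmo⟩
    have hlt : j < (tags k n g b).length := by omega
    have hEv : Evaluates β S entryProg [j, n, g, 2 ^ b, h (8 + j), J, a * m] (10 * S + 20) (e j) := by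
      refine entryProg_evaluates hS (by omega) hf.n_lt hf.g_lt hf.two_pow_b_lt (hh _) hJ
        hf.shares_lt.le (Nat.mul_pos hf.a_pos hf.m_pos) hf.edge_lt fun hne => ?_
      have ho : (tags k n g b)[j]? = some (tags k n g b)[j] := List.getElem?_eq_getElem hlt
      generalize (tags k n g b)[j] = τ at ho
      obtain ⟨p, x, y, _ | ⟨i, w⟩⟩ := τ
      · exact absurd (mod_eq_zero_of_tag_none ho) hne
      · rw [(partAt_of_tag_some ho).2]
        have hpi : pairIdx p * g + i < (pairs k).length * g := by
          have := pairIdx_lt p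
          calc _ < pairIdx p * g + g := by omega
            _ = (pairIdx p + 1) * g := by ring
            _ ≤ _ := Nat.mul_le_mul_right _ this
        exact ⟨(hpi.trans_le hf.parts_le).le, lt_of_le_of_lt
          (Nat.pow_le_pow_right (Nat.mul_pos hf.a_pos hf.m_pos) hpi.le) hf.queries_lt⟩
    have hej : e j < 2 ^ S := by
      refine lt_of_lt_of_le (b := 2) ?_ ((hc 2 (by norm_num)).le)
      rw [he]
      dsimp only
      rw [entryAt]
      split_ifs
      · norm_num
      · exact Nat.mod_lt _ (by norm_num)
    refine wpc_budget (k := 0 + 1 + (10 * S + 20 + 7 + 1) + 1 + 1 + 1) (by omega) ?_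
    refine wpc_assign hS0 0 j hB (by decide) (by simp [hc]) rfl (by simp [hm2]) (by omega)
      fun hB => ?_
    refine wpc_assign hS0 0 j hB (by decide) (by simp [hc]) rfl (by simp [Mem.set_apply]) (by omega)
      fun hB => ?_
    refine wpc_assign hS0 4 (h (8 + j)) hB (by decide) (by simp [hc]) rfl
      (by simp [Mem.set_apply, hm0, hin _ (by omega : 8 + j < 8 + N)]) (hh _) fun hB => ?_
    refine wpc_call_of_evaluates hS0 (3 + j) 7 _ (e j) hB (by decide) (by simp [hc])
      (by simp [Mem.set_apply]) rfl
      (by simp [List.range_succ, Mem.set_apply, hm51, hm52, hm53, hm55, hm56]) hEv hej fun hB => ?_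
    refine wpc_nil hS0 (iInf_le_of_le ⟨hB, by omega, ?_, ?_, ⟨?_, ?_, ?_, ?_, ?_⟩, ⟨?_, ?_, ?_⟩, ?_⟩ le_rfl)
    · simp [Mem.set_apply]
    · simp [Mem.set_of_ne, hm0]
    all_goals try simp [Mem.set_apply, *]
    · omega
    · omega
    · omega
    intro o hjo hoN
    rcases Nat.eq_or_lt_of_le hjo with rfl | hlt
    · simp
    · rw [if_neg hlt.ne']
      exact hmo o hlt hoN
  · rintro mm ⟨hB, hjN, hm2, hm0, -, ⟨hm60, hm61, hm62⟩, hmo⟩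
    refine (wpc_call_mod hS hB hA ?_ _).trans (le_of_eq ?_)
    · rw [encode_queryLabels, callInput]
      have hlen : (3 + cell 0 4 : Expr).val mm = 3 + N := by
        simp [hm0, hin8, h4]
      rw [hlen, List.range_add, List.map_append, List.map_map]
      refine congrArg₂ _ (by simp [List.range_succ, hm60, hm61, hm62]) ?_
      refine List.map_congr_left fun o ho => ?_
      exact hmo o (Nat.zero_le _) (List.mem_range.1 ho)
    · congr 1
      funext y
      simp [Mem.output, Mem.set_apply, hm0, hin8]
  · refine ⟨hB, le_rfl, ?_, ?_, ⟨?_, ?_, ?_, ?_, ?_⟩, ⟨?_, ?_, ?_⟩, fun o h1 h2 => by omega⟩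
    · simp [Mem.set_apply]
    · simp [Mem.set_of_ne]
    all_goals simp [Mem.set_apply]

/-! ## One trial -/

/-- The program of a trial has computed its parameters. -/
structure Ready (k n g b a m S : ℕ) (mm : Mem) : Prop where
  bdd : Bdd S mm
  n_eq : mm 5 0 = n
  g_eq : mm 5 1 = g
  b_eq : mm 5 2 = b
  two_pow_b_eq : mm 5 3 = 2 ^ b
  length_eq : mm 5 4 = (tags k n g b).length
  shares_eq : mm 5 5 = a * m
  modulus_eq : mm 5 6 = 2 ^ m
  levels_eq : mm 4 1 = m
  shares_eq' : mm 3 1 = a * m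
  parts_eq : mm 3 2 = (pairs k).length * g
  queries_eq : mm 3 3 = (a * m) ^ ((pairs k).length * g)

theorem Ready.set {k n g b a m S : ℕ} {mm : Mem} (h : Ready k n g b a m S mm) {a' i v : ℕ}
    (h5 : a' = 5 → 7 ≤ i) (h4 : a' = 4 → i ≠ 1) (h3 : a' = 3 → i = 0) (hB : Bdd S (mm.set a' i v)) :
    Ready k n g b a m S (mm.set a' i v) := by
  have e : ∀ c j, (c = 5 ∧ j < 7 ∨ c = 4 ∧ j = 1 ∨ c = 3 ∧ j ≠ 0) → mm.set a' i v c j = mm c j := by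
    intro c j hcj
    rw [Mem.set_apply, if_neg]
    rintro ⟨rfl, rfl⟩
    omega
  constructor
  · exact hB
  all_goals rw [e _ _ (by norm_num)]
  exacts [h.n_eq, h.g_eq, h.b_eq, h.two_pow_b_eq, h.length_eq, h.shares_eq, h.modulus_eq,
    h.levels_eq, h.shares_eq', h.parts_eq, h.queries_eq]

def queryBody (A : Prog) (a : ℕ) : Prog := block
  [.assign 2 0 (cell 2 0 - 1),
   .assign 5 7 (cell 2 0),
   .assign 3 0 (cell 2 0),
   .call 6 0 5 (8 + cell 5 4) (queryProg A),
   .call 7 0 3 3 (weightProg a),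
   .assign 8 0 (cell 8 0 + cell 6 0 * cell 7 0)]

theorem digit_lt {t J q : ℕ} (ht : 0 < t) : digit t J q < t := Nat.mod_lt _ ht

theorem levelSum_le {a m d J : ℕ} (ha : 0 < a) (hm : 0 < m) : levelSum a (a * m) d J ≤ d * m := by
  rw [levelSum]
  refine (Finset.sum_le_card_nsmul _ _ m fun q _ => ?_).trans (by simp)
  have : digit (a * m) J q < a * m := digit_lt (Nat.mul_pos ha hm)
  exact (Nat.div_lt_of_lt_mul this).le

/-- The probability of a wrong answer. -/
def errProb {k n g b : ℕ} (f : (Pair k → BitString b) → Bool) (D : Labels k n g b → PMF ℕ)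
    (L : Labels k n g b) : ℝ≥0∞ :=
  expect (D L) fun y => if y = count f (completeGraph L) then 0 else 1

/-- This is the union bound over the queries for fixed shares. The accumulator holds a sum of
reduced answers and is itself reduced only at the end; `total_lt` ensures that it fits into a cell.
-/
theorem queryLoop_spec {k n g b a m S : ℕ} (hf : Fits k n g b a m S)
    {A : Prog} {T : ℝ} {f : (Pair k → BitString b) → Bool} {D : Labels k n g b → PMF ℕ}
    (hA : ∀ L, Computes β A (encode (completeGraph L)) T (D L)) {x y : ℝ≥0∞} (hxy : x ≤ y)
    {C : ℕ} (hC : C < 2 ^ m) (Z : ℕ → ℕ)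
    (hCZ : C ≡ ∑ J ∈ Finset.range ((a * m) ^ ((pairs k).length * g)),
      2 ^ levelSum a (a * m) ((pairs k).length * g) J *
        count f (completeGraph (queryLabels (a * m) J Z : Labels k n g b)) [MOD 2 ^ m])
    {mm : Mem} (hR : Ready k n g b a m S mm) (hZ : ∀ o, mm 5 (8 + o) = Z o) (h8 : mm 8 0 = 0)
    (h2 : mm 2 0 = (a * m) ^ ((pairs k).length * g)) :
    wpc β S (block [.loop (cell 2 0) (queryBody A a), .assign 1 0 (cell 8 0 % cell 5 6)]) mm
      ((a * m) ^ ((pairs k).length * g) *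
        (5 * ⌊T⌋₊ + (tags k n g b).length * (10 * S + 41) + 10 * S + 40) + 3)
      (fun m' => ⨅ _ : m'.output < 2 ^ S, if m'.output = C then x else y) ≤
      x + y * ∑ J ∈ Finset.range ((a * m) ^ ((pairs k).length * g)),
        errProb f D (queryLabels (a * m) J Z) := by
  have hS := hf.seven_le
  have hS0 : 0 < S := by omega
  have hc := lt_two_pow_of_le_hundred hS
  set N := (tags k n g b).length with hN
  set d := (pairs k).length * g with hd
  set Q := (a * m) ^ d with hQ
  have hN2 : N + 8 < 2 ^ S := hf.length_lt
  set c : ℕ → ℕ := fun J => count f (completeGraph (queryLabels (a * m) J Z : Labels k n g b)) with hcdef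
  set W : ℕ → ℕ := fun J => 2 ^ levelSum a (a * m) d J with hW
  have hWle : ∀ J, W J ≤ 2 ^ (d * m) := fun J =>
    Nat.pow_le_pow_right (by norm_num) (levelSum_le hf.a_pos hf.m_pos)
  have hWlt : ∀ J, W J < 2 ^ S := fun J => (hWle J).trans_lt
    (Nat.pow_lt_pow_right (by norm_num) hf.level_lt)
  have hMpos : 0 < 2 ^ m := by positivity
  -- The first summand is the value if all remaining answers are correct; the second reserves `y`
  -- for each remaining answer that may be wrong.
  set V : ℕ → Mem → ℝ≥0∞ := fun j mm => (if mm 8 0 ≡ ∑ J ∈ Finset.Ico j Q, W J * c J [MOD 2 ^ m] then x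
    else y) + y * ∑ J ∈ Finset.range j, errProb f D (queryLabels (a * m) J Z) with hV
  refine wpc_budget (k := (0 + 1 + 1) + (Q * ((0 + 1 + 1 + (10 * S + 3 + 1) +
    ((5 * ⌊T⌋₊ + N * (10 * S + 40) + 20) + (8 + N) + 1) + 1 + 1 + 1) + 1) + 1)) ?_ ?_
  · have : N * (10 * S + 41) = N * (10 * S + 40) + N := by ring
    rw [show 0 + 1 + 1 + (Q * (0 + 1 + 1 + (10 * S + 3 + 1) + ((5 * ⌊T⌋₊ + N * (10 * S + 40) + 20) +
      (8 + N) + 1) + 1 + 1 + 1 + 1) + 1) = Q * (0 + 1 + 1 + (10 * S + 3 + 1) + ((5 * ⌊T⌋₊ +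
      N * (10 * S + 40) + 20) + (8 + N) + 1) + 1 + 1 + 1 + 1) + 3 by ring]
    exact Nat.add_le_add_right (Nat.mul_le_mul_left _ (by omega)) _
  refine (wpc_loop hS0 (fun j mm => Ready k n g b a m S mm ∧ j ≤ Q ∧ mm 2 0 = j ∧
    (∀ o, mm 5 (8 + o) = Z o) ∧ mm 8 0 ≤ (Q - j) * (2 ^ (d * m) * 2 ^ m)) V (by decide) (by simp [hc])
    (fun j m h => h.1.bdd) (fun m h => by simp [h.2.2.1]) (fun j m h => by simp [h.2.2.1]) ?_ ?_
    ⟨hR, le_rfl, h2, hZ, by simp [h8]⟩).trans ?_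
  · rintro j mm ⟨hR, hjQ, hm2, hZ, h8⟩
    have hB := hR.bdd
    have hj : j < 2 ^ S := (by omega : j < Q).trans hf.queries_lt
    refine wpc_assign hS0 0 j hB (by decide) (by simp [hc]) rfl (by simp [hm2]) hj fun hB => ?_
    have hR := hR.set (by norm_num) (by norm_num) (by norm_num) hB
    refine wpc_assign hS0 7 j hB (by decide) (by simp [hc]) rfl (by simp [Mem.set_apply]) hj
      fun hB => ?_
    have hR := hR.set (by norm_num) (by norm_num) (by norm_num) hB
    refine wpc_assign hS0 0 j hB (by decide) (by simp [hc]) rfl (by simp [Mem.set_apply]) hj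
      fun hB => ?_
    have hR := hR.set (by norm_num) (by norm_num) (by norm_num) hB
    set m3 := ((mm.set 2 0 j).set 5 7 j).set 3 0 j with hm3
    have hZ3 : ∀ o, m3 5 (8 + o) = Z o := fun o => by
      have : 8 + o ≠ 7 := by omega
      simp [hm3, Mem.set_apply, hZ, this]
    have h57 : m3 5 7 = j := by simp [hm3, Mem.set_apply]
    have h20 : m3 2 0 = j := by simp [hm3, Mem.set_apply]
    have h30 : m3 3 0 = j := by simp [hm3, Mem.set_apply]
    have h80 : m3 8 0 = mm 8 0 := by simp [hm3, Mem.set_apply]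
    refine wpc_call hS0 0 (8 + N) _ hB (by decide) (by simp [hc]) rfl (by simp [hR.length_eq, hN]) rfl
      fun hB => ?_
    have hA' := hA (queryLabels (a * m) j Z)
    refine (queryProg_spec hf hj (m3 5) (fun i => hR.bdd _ _) hR.n_eq hR.g_eq hR.b_eq hR.two_pow_b_eq
      hR.length_eq hR.shares_eq h57 (D := D (queryLabels (a * m) j Z)) (T := T) (A := A)
      (by simpa only [hZ3] using hA') (fun y' => ⨅ _ : y' < 2 ^ S, wpc β S (block _) (m3.set 6 0 y') _ _)).trans ?_
    refine le_trans (expect_mono (h' := fun y' => (if mm 8 0 ≡ ∑ J ∈ Finset.Ico (j + 1) Q, W J * c J [MOD 2 ^ m]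
      then x else y) + y * ∑ J ∈ Finset.range j, errProb f D (queryLabels (a * m) J Z) +
        y * (if y' = c j then 0 else 1)) _ fun y' => ?_) (le_of_eq ?_)
    · have hylt : y' % 2 ^ m < 2 ^ m := Nat.mod_lt _ hMpos
      have hmlt : 2 ^ m < 2 ^ S := by
        refine lt_of_le_of_lt ?_ hf.start_lt
        have := Nat.le_mul_of_pos_left (2 ^ m) hf.a_pos
        omega
      rw [hR.modulus_eq]
      refine iInf_le_of_le (hylt.trans hmlt) ?_
      have hB := hB _ (hylt.trans hmlt)
      have hR := hR.set (by norm_num) (by norm_num) (by norm_num) hB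
      refine wpc_call_of_evaluates hS0 0 3 [j, a * m, d] (W j) hB (by decide) (by simp [hc]) rfl rfl
        ?_ (weightProg_evaluates hS ?_ ?_ hf.parts_le hj ?_) (hWlt j) fun hB => ?_
      · simp only [List.range_succ, List.range_zero, List.nil_append, List.map_append, List.map_cons, List.map_nil,
          hR.shares_eq', hR.parts_eq]
        simp [Mem.set_apply, h30, hd]
      · exact (Nat.lt_two_pow_self).trans_le (Nat.pow_le_pow_right (by norm_num)
          ((Nat.le_mul_of_pos_right a hf.m_pos).trans hf.shares_lt.le))
      · exact hf.shares_lt.trans Nat.lt_two_pow_self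
      · exact (levelSum_le hf.a_pos hf.m_pos).trans_lt hf.level_lt
      have hR := hR.set (by norm_num) (by norm_num) (by norm_num) hB
      have hle : mm 8 0 + y' % 2 ^ m * W j ≤ (Q - j) * (2 ^ (d * m) * 2 ^ m) := by
        have e : Q - j = Q - (j + 1) + 1 := by omega
        rw [e, add_mul, one_mul]
        refine Nat.add_le_add h8 ?_
        rw [mul_comm]
        exact Nat.mul_le_mul (hWle j) hylt.le
      refine wpc_assign hS0 0 (mm 8 0 + y' % 2 ^ m * W j) hB (by decide) (by simp [hc]) rfl
        (by simp [Mem.set_apply, h80]) ?_ fun hB => ?_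
      · exact lt_of_le_of_lt (hle.trans (Nat.mul_le_mul_right _ (Nat.sub_le _ _))) hf.total_lt
      have hR := hR.set (by norm_num) (by norm_num) (by norm_num) hB
      refine wpc_nil hS0 (iInf_le_of_le ⟨hR, by omega, ?_, ?_, ?_⟩ ?_)
      · simp [Mem.set_apply, h20]
      · intro o
        simp [Mem.set_apply, hZ3]
      · simpa [Mem.set_apply] using hle
      · simp only [hV, Mem.set_apply]
        norm_num
        have hsum : ∑ J ∈ Finset.Ico j Q, W J * c J = W j * c j + ∑ J ∈ Finset.Ico (j + 1) Q, W J * c J :=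
          Finset.sum_eq_sum_Ico_succ_bot (by omega) _
        rw [hsum]
        rw [add_right_comm]
        refine add_le_add ?_ le_rfl
        -- A correct answer preserves the congruence; for a wrong one the reserved `y` pays.
        by_cases hy : y' = c j
        · rw [if_pos hy, add_zero]
          by_cases hok : mm 8 0 ≡ ∑ J ∈ Finset.Ico (j + 1) Q, W J * c J [MOD 2 ^ m]
          · rw [if_pos hok, if_pos]
            rw [add_comm, mul_comm]
            exact Nat.ModEq.add (Nat.ModEq.mul_left _ (by rw [hy]; exact Nat.mod_modEq _ _)) hok
          · rw [if_neg hok]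
            split_ifs
            exacts [hxy, le_rfl]
        · rw [if_neg hy]
          refine le_trans ?_ le_add_self
          split_ifs
          exacts [hxy, le_rfl]
    · rw [expect_add, expect_const, expect_const_mul, hV]
      dsimp only
      rw [Finset.sum_range_succ, mul_add, ← add_assoc]
      rfl
  · rintro mm ⟨hR, -, hm2, -, h8⟩
    have hB := hR.bdd
    refine wpc_assign hS0 0 (mm 8 0 % 2 ^ m) hB (by decide) (by simp [hc]) rfl
      (by simp [hR.modulus_eq]) ((Nat.mod_le _ _).trans_lt (hB _ _)) fun hB' => ?_
    refine wpc_nil hS0 (iInf_le_of_le ?_ ?_)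
    · exact hB' _ _
    · simp only [hV, Mem.output, Mem.set_apply]
      norm_num
      split_ifs with h1 h2 h2
      · exact le_rfl
      · exact hxy
      · exact absurd ((Nat.mod_eq_of_lt hC).symm.trans (hCZ.trans h2.symm)).symm h1
      · exact le_rfl
  · simp [hV, h8]
    split_ifs with h
    · exact le_rfl
    · exact absurd rfl h

/-! ## Sampling the shares -/

/-- Linearity under a common guard: bounds for single failure events add up to a bound for all of
them. -/
theorem wpc_iInf_add_sum {ι : Type*} {S k : ℕ} {p : Prog} {m : Mem} {I : Mem → Prop} {x v : ℝ≥0∞}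
    {F : ι → Mem → ℝ≥0∞} {w : ι → ℝ≥0∞} (s : Finset ι)
    (h0 : wpc β S p m k (fun m' => ⨅ _ : I m', x) ≤ v)
    (h : ∀ i ∈ s, wpc β S p m k (fun m' => ⨅ _ : I m', F i m') ≤ w i) :
    wpc β S p m k (fun m' => ⨅ _ : I m', (x + ∑ i ∈ s, F i m')) ≤ v + ∑ i ∈ s, w i := by
  classical
  induction s using Finset.induction_on with
  | empty => simpa using h0
  | insert i s hi ih =>
    rw [Finset.sum_insert hi, add_left_comm]
    refine le_trans (wpc_mono fun m' => ?_) ((wpc_add p m k (fun m' => ⨅ _ : I m', F i m')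
      fun m' => ⨅ _ : I m', (x + ∑ i ∈ s, F i m')).le.trans
      (add_le_add (h i (Finset.mem_insert_self _ _))
        (ih fun j hj => h j (Finset.mem_insert_of_mem hj))))
    by_cases hI : I m'
    · simp only [hI, iInf_pos, Finset.sum_insert hi]
      rw [add_left_comm]
    · simp [hI]

theorem prod_range_getElem? {α M : Type*} [CommMonoid M] (F : α → M) : ∀ l : List α,
    ∏ o ∈ Finset.range l.length, ((l[o]?).map F).getD 1 = (l.map F).prod
  | [] => rfl
  | x :: l => by
    rw [List.length_cons, Finset.prod_range_succ', List.map_cons, List.prod_cons, mul_comm,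
      ← prod_range_getElem? F l]
    simp

/-- The share `digit t J q` of the entry at position `o`, where `q` is the part to which the entry
belongs, agrees with the labels `L`. -/
def Agrees {k n g b : ℕ} (t J : ℕ) (L : Labels k n g b) (o Z : ℕ) : Prop :=
  ∀ p x y i w, (tags k n g b)[o]? = some (p, x, y, some (i, w)) →
    Z.testBit (digit t J (pairIdx p * g + i)) = decide (w ∈ L p x y i)

theorem agrees_of_queryLabels_eq {k n g b t J : ℕ} {L : Labels k n g b} {Z : ℕ → ℕ}
    (h : queryLabels t J Z = L) (o : ℕ) : Agrees t J L o (Z o) := by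
  intro p x y i w ho
  have hidx : (tags k n g b).idxOf (p, x, y, some (i, w)) = o := by
    obtain ⟨ho', h2⟩ := List.getElem?_eq_some_iff.1 ho
    rw [← h2]
    exact (tags_nodup k n g b).idxOf_getElem _ ho'
  subst h
  simp [queryLabels, hidx]

/-- The probability of the entry at position `o`. -/
def posProb {k n g b : ℕ} (β : PMF Bool) (L : Labels k n g b) (o : ℕ) : ℝ≥0∞ :=
  (((tags k n g b)[o]?).map (tagProb β L)).getD 1

/-- Adding the bounds for the two values of share `0` costs the factor `1 + 2⁻¹ ^ m`. Being crude
here does no harm, and it gives presence bits the same factor as all other entries. -/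
theorem shareProg_const {S : ℕ} (hS : 7 ≤ S) {a m x : ℕ} (ha : Suitable β a) (hm : 0 < m)
    (ham : a * m < S) (hr : x + a * 2 ^ m < 2 ^ S) (haS : 2 ^ a * (a + 1) < 2 ^ S) (C : ℝ≥0∞) :
    wpc β S (shareProg a) (Mem.ofInput [x + a * 2 ^ m, m]) (40 * S * S)
      (fun m' => ⨅ _ : m'.output < 2 ^ (a * m) ∧ shareSum a m m'.output ≡ x [MOD 2 ^ m], C) ≤
      (1 + 2⁻¹ ^ m) * C := by
  have ham0 : 0 < a * m := Nat.mul_pos (by have := ha.four_le; omega) hm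
  refine le_trans (wpc_mono fun m' => ?_) ((wpc_add _ _ _ _ _).le.trans ((add_le_add
    (shareProg_spec hS ha hm ham hr haS ham0 true (C := C))
    (shareProg_spec hS ha hm ham hr haS ham0 false (C := C))).trans (le_of_eq ?_)))
  · by_cases hI : m'.output < 2 ^ (a * m) ∧ shareSum a m m'.output ≡ x [MOD 2 ^ m]
    · simp only [hI, true_and, iInf_pos]
      cases m'.output.testBit 0 <;> simp
    · simp [hI]
  · rw [← add_mul, ← mul_add, coin_add, mul_one]

open Classical in
-- Query `J` looks at only one share of the entry, so one marginal bound suffices. Presence bits and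
-- offsets past the end impose no condition.
theorem shareProg_agrees {S : ℕ} (hS : 7 ≤ S) {a m x : ℕ} (ha : Suitable β a) (hm : 0 < m)
    (ham : a * m < S) (hr : x + a * 2 ^ m < 2 ^ S) (haS : 2 ^ a * (a + 1) < 2 ^ S)
    {k n g b : ℕ} (J : ℕ) (L : Labels k n g b) (o : ℕ) (C : ℝ≥0∞) :
    wpc β S (shareProg a) (Mem.ofInput [x + a * 2 ^ m, m]) (40 * S * S)
      (fun m' => ⨅ _ : m'.output < 2 ^ (a * m) ∧ shareSum a m m'.output ≡ x [MOD 2 ^ m],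
        if Agrees (a * m) J L o m'.output then C else 0) ≤ (1 + 2⁻¹ ^ m) * posProb β L o * C := by
  have ham0 : 0 < a * m := Nat.mul_pos (by have := ha.four_le; omega) hm
  have hnone := shareProg_const hS ha hm ham hr haS C
  rcases ho : (tags k n g b)[o]? with _ | ⟨p, x', y, _ | ⟨i, w⟩⟩
  · refine (wpc_mono fun m' => iInf_mono fun _ => ?_).trans (hnone.trans (le_of_eq ?_))
    · split_ifs <;> simp
    · simp [posProb, ho]
  · refine (wpc_mono fun m' => iInf_mono fun _ => ?_).trans (hnone.trans (le_of_eq ?_))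
    · split_ifs <;> simp
    · simp [posProb, ho, tagProb]
  · refine (wpc_mono fun m' => iInf_mono fun _ => le_of_eq ?_).trans
      ((shareProg_spec hS ha hm ham hr haS (digit_lt ham0 : digit (a * m) J (pairIdx p * g + i) < _)
        (decide (w ∈ L p x' y i)) (C := C)).trans (le_of_eq ?_))
    · refine if_congr ⟨fun h => h p x' y i w ho, fun h => ?_⟩ rfl rfl
      intro p2 x2 y2 i2 w2 ho2
      obtain ⟨rfl, rfl, rfl, h4⟩ : p = p2 ∧ x' = x2 ∧ y = y2 ∧ some (i, w) = some (i2, w2) := by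
        rw [ho] at ho2
        simpa using ho2
      obtain ⟨rfl, rfl⟩ : i = i2 ∧ w = w2 := by simpa using h4
      exact h
    · simp [posProb, ho, tagProb]

def sampleBody (a : ℕ) : Prog := block
  [.assign 2 0 (cell 2 0 - 1),
   .assign 4 0 (cell 0 (3 + cell 2 0) + .const a * cell 5 6),
   .call 5 (8 + cell 2 0) 4 2 (shareProg a)]

/-- The state of the sampling loop when the shares of the entries from `j` on are available. -/
structure Sampled {k n g b : ℕ} (G : LabeledGraph k n g b) (a m S j : ℕ) (mm : Mem) : Prop where
  ready : Ready k n g b a m S mm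
  le_length : j ≤ (tags k n g b).length
  counter_eq : mm 2 0 = j
  input_eq : ∀ o (ho : o < (tags k n g b).length), mm 0 (3 + o) = tagVal G (tags k n g b)[o]
  sum_eq : mm 8 0 = 0
  shareSum_modEq : ∀ o (ho : o < (tags k n g b).length), j ≤ o →
    shareSum a m (mm 5 (8 + o)) ≡ tagVal G (tags k n g b)[o] [MOD 2 ^ m]

theorem tagVal_le_one {k n g b : ℕ} (G : LabeledGraph k n g b) : ∀ τ, tagVal G τ ≤ 1
  | (p, x, y, none) => by rw [tagVal]; split_ifs <;> simp
  | (p, x, y, some (i, w)) => by rw [tagVal]; split_ifs <;> simp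

theorem sampleBody_spec {k n g b a m S : ℕ} (hf : Fits k n g b a m S) (G : LabeledGraph k n g b)
    {j : ℕ} {mm : Mem} (h : Sampled G a m S (j + 1) mm) {V : Mem → ℝ≥0∞} {c : ℕ → ℝ≥0∞} {v : ℝ≥0∞}
    (hV : ∀ (m' : Mem) (Z : ℕ), m' 5 = mm 5 → V (m'.set 5 (8 + j) Z) ≤ c Z)
    (hv : ∀ x, x ≤ 1 → wpc β S (shareProg a) (Mem.ofInput [x + a * 2 ^ m, m]) (40 * S * S)
      (fun m' => ⨅ _ : m'.output < 2 ^ (a * m) ∧ shareSum a m m'.output ≡ x [MOD 2 ^ m],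
        c m'.output) ≤ v) :
    wpc β S (sampleBody a) mm (40 * S * S + 6) (fun m' => ⨅ _ : Sampled G a m S j m', V m') ≤ v := by
  have hS := hf.seven_le
  have hS0 : 0 < S := by omega
  have hc := lt_two_pow_of_le_hundred hS
  have hj : j < (tags k n g b).length := h.le_length
  have hjS : j < 2 ^ S := by have := hf.length_lt; omega
  have hx := tagVal_le_one G (tags k n g b)[j]
  have hxr : tagVal G (tags k n g b)[j] + a * 2 ^ m < 2 ^ S := by
    have := hf.start_lt
    omega
  have haS : a < 2 ^ S := Nat.lt_two_pow_self.trans_le (Nat.pow_le_pow_right (by norm_num)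
    ((Nat.le_mul_of_pos_right a hf.m_pos).trans hf.shares_lt.le))
  refine wpc_budget (k := 0 + 1 + (40 * S * S + 2 + 1) + 1 + 1) (by omega) ?_
  refine wpc_assign hS0 0 j h.ready.bdd (by decide) (by simp [hc]) rfl (by simp [h.counter_eq]) hjS
    fun hB => ?_
  have hR := h.ready.set (by norm_num) (by norm_num) (by norm_num) hB
  refine wpc_assign hS0 0 (tagVal G (tags k n g b)[j] + a * 2 ^ m) hB
    (Nat.le_of_ble_eq_true rfl) (by simp [hc, haS]) rfl ?_ hxr fun hB => ?_
  · have h1 := hR.modulus_eq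
    have h2 := h.input_eq j hj
    simp [h1, Mem.set_apply, h2]
  have hR := hR.set (by norm_num) (by norm_num) (by norm_num) hB
  set m2 := (mm.set 2 0 j).set 4 0 (tagVal G (tags k n g b)[j] + a * 2 ^ m) with hm2
  have h5 : m2 5 = mm 5 := by simp [hm2, Mem.set_of_ne]
  refine wpc_call hS0 (8 + j) 2 [tagVal G (tags k n g b)[j] + a * 2 ^ m, m] hB (by decide)
    (by simp [hc]) (by simp [hm2, Mem.set_apply]) rfl ?_ fun hB => ?_
  · have := hR.levels_eq
    have h3 : m2 4 0 = tagVal G (tags k n g b)[j] + a * 2 ^ m := by simp [hm2, Mem.set_apply]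
    simp [List.range_succ, this, h3]
  refine le_trans (wpc_mono fun m' => le_iInf fun hm' => ?_) (hv _ hx)
  have hlt : m'.output < 2 ^ S := hm'.1.trans (Nat.pow_lt_pow_right (by norm_num) hf.shares_lt)
  refine iInf_le_of_le hlt ?_
  have hB := hB _ hlt
  refine wpc_nil hS0 (iInf_le_of_le ⟨hR.set ?_ ?_ ?_ hB, by omega, ?_, ?_, ?_, ?_⟩ (hV _ _ h5))
  · omega
  · omega
  · omega
  · simp [hm2, Mem.set_apply]
  · intro o ho
    simpa [hm2, Mem.set_apply] using h.input_eq o ho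
  · simpa [hm2, Mem.set_apply] using h.sum_eq
  · intro o ho hjo
    rcases Nat.eq_or_lt_of_le hjo with rfl | hlt'
    · simpa [Mem.set_apply] using hm'.2
    · have h6 : o ≠ j := hlt'.ne'
      have h7 := h.shareSum_modEq o ho hlt'
      simpa [hm2, Mem.set_apply, h6] using h7

theorem sampleLoop_spec {k n g b a m S : ℕ} (hf : Fits k n g b a m S)
    (G : LabeledGraph k n g b) (V : ℕ → Mem → ℝ≥0∞)
    (c : ℕ → Mem → ℕ → ℝ≥0∞)
    (hV : ∀ (j : ℕ) (mm m' : Mem) (Z : ℕ), m' 5 = mm 5 → V j (m'.set 5 (8 + j) Z) ≤ c j mm Z)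
    (hv : ∀ j mm x, j < (tags k n g b).length → x ≤ 1 →
      wpc β S (shareProg a) (Mem.ofInput [x + a * 2 ^ m, m]) (40 * S * S)
      (fun m' => ⨅ _ : m'.output < 2 ^ (a * m) ∧ shareSum a m m'.output ≡ x [MOD 2 ^ m],
        c j mm m'.output) ≤ V (j + 1) mm) {mm : Mem}
    (hmm : Sampled G a m S (tags k n g b).length mm) :
    wpc β S (.loop (cell 2 0) (sampleBody a)) mm ((tags k n g b).length * (40 * S * S + 7) + 1)
      (fun m' => ⨅ _ : Sampled G a m S 0 m', V 0 m') ≤ V (tags k n g b).length mm := by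
  have hS := hf.seven_le
  have hc := lt_two_pow_of_le_hundred hS
  exact wpc_loop_one (by omega) (Sampled G a m S) V (by decide) (by simp [hc])
    (fun j m h => h.ready.bdd) (fun m h => by simp [h.counter_eq])
    (fun j m h => by simp [h.counter_eq])
    (fun j m h => sampleBody_spec hf G h (hV j m) fun x hx => hv j m x h.le_length hx)
    (fun m h => iInf_le_of_le h le_rfl) _ _ hmm

theorem sampleLoop_const {k n g b a m S : ℕ} (hf : Fits k n g b a m S) (ha : Suitable β a)
    (G : LabeledGraph k n g b) (x : ℝ≥0∞) {mm : Mem}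
    (hmm : Sampled G a m S (tags k n g b).length mm) :
    wpc β S (.loop (cell 2 0) (sampleBody a)) mm ((tags k n g b).length * (40 * S * S + 7) + 1)
      (fun m' => ⨅ _ : Sampled G a m S 0 m', x) ≤ (1 + 2⁻¹ ^ m) ^ (tags k n g b).length * x := by
  have h := sampleLoop_spec (β := β) hf G (fun j _ => (1 + 2⁻¹ ^ m) ^ j * x)
    (fun j _ _ => (1 + 2⁻¹ ^ m) ^ j * x) (fun _ _ _ _ _ => le_rfl) (fun j _ y hj hy => ?_) hmm
  · simpa using h
  · refine (shareProg_const hf.seven_le ha hf.m_pos hf.shares_lt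
      (lt_of_le_of_lt (Nat.add_le_add_right hy _) hf.start_lt) hf.a_const_lt _).trans (le_of_eq ?_)
    rw [pow_succ]
    ring

open Classical in
-- Query `J` equals `L` only if one prescribed share of every membership entry has a prescribed
-- value, and the entries are shared independently. The bounds multiply to the average-case
-- probability of `L` times `(1 + 2⁻¹ ^ m) ^ N`.
theorem sampleLoop_agrees {k n g b a m S : ℕ} (hf : Fits k n g b a m S) (ha : Suitable β a)
    (G : LabeledGraph k n g b) (J : ℕ) (L : Labels k n g b) (C : ℝ≥0∞) {mm : Mem}
    (hmm : Sampled G a m S (tags k n g b).length mm) :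
    wpc β S (.loop (cell 2 0) (sampleBody a)) mm ((tags k n g b).length * (40 * S * S + 7) + 1)
      (fun m' => ⨅ _ : Sampled G a m S 0 m',
        if queryLabels (a * m) J (fun o => m' 5 (8 + o)) = L then C else 0) ≤
      (1 + 2⁻¹ ^ m) ^ (tags k n g b).length * ((tags k n g b).map (tagProb β L)).prod * C := by
  set N := (tags k n g b).length with hN
  -- The potential is zero once an entry already sampled disagrees with `L`; otherwise it is the
  -- product of the bounds for the entries still to come.
  have h := sampleLoop_spec (β := β) hf G
    (fun j mm => if ∀ o, j ≤ o → o < N → Agrees (a * m) J L o (mm 5 (8 + o)) then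
      (∏ o ∈ Finset.range j, (1 + 2⁻¹ ^ m) * posProb β L o) * C else 0)
    (fun j mm Z => if Agrees (a * m) J L j Z then
      (if ∀ o, j + 1 ≤ o → o < N → Agrees (a * m) J L o (mm 5 (8 + o)) then
      (∏ o ∈ Finset.range j, (1 + 2⁻¹ ^ m) * posProb β L o) * C else 0) else 0)
    (fun j mm m' Z h5 => ?_) (fun j mm y hj hy => ?_) hmm
  · refine (wpc_mono fun m' => iInf_mono fun _ => ?_).trans (h.trans (le_of_eq ?_))
    · split_ifs with h1 h2 h2
      · simp
      · exact absurd (fun o _ _ => agrees_of_queryLabels_eq h1 o) h2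
      · simp
      · simp
    · rw [if_pos fun o h1 h2 => absurd h2 (by omega), Finset.prod_mul_distrib, Finset.prod_const,
        Finset.card_range, ← prod_range_getElem?]
      rfl
  · by_cases h1 : ∀ o, j ≤ o → o < N → Agrees (a * m) J L o (m'.set 5 (8 + j) Z 5 (8 + o))
    · have h2 : Agrees (a * m) J L j Z := by
        by_cases hj : j < N
        · simpa [Mem.set_apply] using h1 j le_rfl hj
        · intro p x y i w ho
          rw [List.getElem?_eq_none (by omega)] at ho
          cases ho
      have h3 : ∀ o, j + 1 ≤ o → o < N → Agrees (a * m) J L o (mm 5 (8 + o)) := by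
        intro o hjo ho
        have h4 : o ≠ j := by omega
        simpa [Mem.set_apply, h4, h5] using h1 o (by omega) ho
      rw [if_pos h1, if_pos h2, if_pos h3]
    · rw [if_neg h1]
      exact zero_le
  · refine (shareProg_agrees hf.seven_le ha hf.m_pos hf.shares_lt
      (lt_of_le_of_lt (Nat.add_le_add_right hy _) hf.start_lt) hf.a_const_lt J L j _).trans ?_
    rw [Finset.prod_range_succ]
    split_ifs
    · refine le_of_eq ?_
      ring
    · simp

/-! ## A trial -/

/-- On an instance with `n` nodes in each of the parts, `l` pairs of parts, compute a guess of the
count from answers of `A` on random instances. -/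
def trialProg (A : Prog) (a c l : ℕ) : Prog := block
  [.assign 5 0 (cell 0 0), .assign 5 1 (cell 0 1), .assign 5 2 (cell 0 2),
   .assign 3 0 2, .assign 3 1 (cell 0 2), .call 5 3 3 2 powProg,
   .assign 5 4 (.const l * cell 0 0 * cell 0 0 * (1 + cell 0 1 * cell 5 3)),
   .call 4 0 0 1 sizeProg,
   .assign 4 1 (.const c * cell 4 0 * cell 0 1),
   .assign 3 1 (cell 4 1), .call 5 6 3 2 powProg,
   .assign 5 5 (.const a * cell 4 1),
   .assign 3 0 (cell 5 5), .assign 3 1 (.const l * cell 0 1), .call 3 3 3 2 powProg,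
   .assign 3 1 (cell 5 5), .assign 3 2 (.const l * cell 0 1),
   .assign 2 0 (cell 5 4),
   .loop (cell 2 0) (sampleBody a),
   .assign 2 0 (cell 3 3),
   .loop (cell 2 0) (queryBody A a),
   .assign 1 0 (cell 8 0 % cell 5 6)]

theorem one_add_pow_le_two {u : ℝ≥0∞} {N : ℕ} (h : 2 * N * u ≤ 1) : (1 + u) ^ N ≤ 2 := by
  have key : ∀ j ≤ N, (1 + u) ^ j ≤ 1 + 2 * j * u := by
    intro j
    induction j with
    | zero => simp
    | succ j ih =>
      intro hj
      have h1 : 2 * j * u ≤ 1 := le_trans (by gcongr; exact_mod_cast (by omega : j ≤ N)) h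
      calc (1 + u) ^ (j + 1) = (1 + u) ^ j * (1 + u) := pow_succ _ _
        _ ≤ (1 + 2 * j * u) * (1 + u) := by gcongr; exact ih (by omega)
        _ = 1 + u + 2 * j * u + 2 * j * u * u := by ring
        _ ≤ 1 + u + 2 * j * u + 1 * u := by gcongr
        _ = 1 + 2 * (j + 1 : ℕ) * u := by push_cast; ring
  refine (key N le_rfl).trans ?_
  calc 1 + 2 * N * u ≤ 1 + 1 := by gcongr
    _ = 2 := by norm_num

instance (k n g b : ℕ) : Fintype (Labels k n g b) :=
  @Pi.instFintype (Pair k) (fun _ => Fin n → Fin n → FactoredVector g b) _ _ fun _ => inferInstance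

/-- The probability that `A` errs on a random instance. -/
def avgErr {k n g b : ℕ} (β : PMF Bool) (f : (Pair k → BitString b) → Bool)
    (D : Labels k n g b → PMF ℕ) : ℝ≥0∞ :=
  ∑ L : Labels k n g b, ((tags k n g b).map (tagProb β L)).prod * errProb f D L

/-- For given shares, `queryLoop_spec` leaves the sum of the error probabilities of the queries.
Splitting it by the labels `L` that a query takes, each `L` has at most twice its average-case
probability, so every query contributes at most `2 * avgErr`. Dependence between queries does not
matter for a union bound. -/
theorem sampleQuery_spec {k n g b a m S : ℕ} (hf : Fits k n g b a m S) (ha : Suitable β a)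
    (hN : 2 * (tags k n g b).length ≤ 2 ^ m) (G : LabeledGraph k n g b)
    {A : Prog} {T : ℝ} {f : (Pair k → BitString b) → Bool} {D : Labels k n g b → PMF ℕ}
    (hA : ∀ L, Computes β A (encode (completeGraph L)) T (D L)) {x y : ℝ≥0∞} (hxy : x ≤ y)
    (hC : count f G < 2 ^ m) {mm : Mem} (hmm : Sampled G a m S (tags k n g b).length mm) :
    wpc β S (block [.loop (cell 2 0) (sampleBody a), .assign 2 0 (cell 3 3),
      .loop (cell 2 0) (queryBody A a), .assign 1 0 (cell 8 0 % cell 5 6)]) mm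
      ((a * m) ^ ((pairs k).length * g) *
        (5 * ⌊T⌋₊ + (tags k n g b).length * (10 * S + 41) + 10 * S + 40) +
        (tags k n g b).length * (40 * S * S + 7) + 5)
      (fun m' => ⨅ _ : m'.output < 2 ^ S, if m'.output = count f G then x else y) ≤
      2 * x + y * ((a * m) ^ ((pairs k).length * g) : ℕ) * (2 * avgErr β f D) := by
  classical
  have hS := hf.seven_le
  have hS0 : 0 < S := by omega
  have hc := lt_two_pow_of_le_hundred hS
  set N := (tags k n g b).length with hNdef
  set Q := (a * m) ^ ((pairs k).length * g) with hQ
  have hpow : (1 + 2⁻¹ ^ m : ℝ≥0∞) ^ N ≤ 2 := by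
    refine one_add_pow_le_two ?_
    rw [← ENNReal.inv_pow, ← div_eq_mul_inv]
    refine ENNReal.div_le_of_le_mul ?_
    rw [one_mul]
    exact_mod_cast hN
  set qs := (Finset.range Q ×ˢ (Finset.univ : Finset (Labels k n g b))) with hqs
  refine wpc_budget (k := (Q * (5 * ⌊T⌋₊ + N * (10 * S + 41) + 10 * S + 40) + 3 + 1) +
    (N * (40 * S * S + 7) + 1)) (by omega) ?_
  refine wpc_cons (le_trans (wpc_mono (G := fun m' => ⨅ _ : Sampled G a m S 0 m', (x +
    ∑ q ∈ qs, if queryLabels (a * m) q.1 (fun o => m' 5 (8 + o)) = q.2 then y * errProb f D q.2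
      else 0)) fun m' => le_iInf fun hm' => ?_) ((wpc_iInf_add_sum qs (sampleLoop_const hf ha G x hmm)
      fun q _ => sampleLoop_agrees hf ha G q.1 q.2 (y * errProb f D q.2) hmm).trans ?_))
  · have hR := hm'.ready
    refine wpc_assign hS0 0 Q hR.bdd (by decide) (by simp [hc]) rfl
      (by simp [hR.queries_eq, hQ])
      hf.queries_lt fun hB => ?_
    have hR' := hR.set (by norm_num) (by norm_num) (by norm_num) hB
    refine (queryLoop_spec hf hA hxy hC (fun o => m' 5 (8 + o))
      (count_eq_sum_queries hf.g_pos hf.a_pos hf.m_pos f G _ fun o ho =>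
        hm'.shareSum_modEq o ho (Nat.zero_le _)) hR' (fun o => by simp [Mem.set_apply])
      (by simpa [Mem.set_apply] using hm'.sum_eq) (by simp [Mem.set_apply, hQ])).trans ?_
    refine add_le_add le_rfl (le_of_eq ?_)
    rw [hqs, Finset.sum_product, Finset.mul_sum]
    refine Finset.sum_congr rfl fun J _ => ?_
    dsimp only
    rw [Finset.sum_ite_eq, if_pos (Finset.mem_univ _)]
  · refine add_le_add (mul_le_mul_left hpow _) ?_
    rw [hqs, Finset.sum_product]
    simp only [Finset.sum_const, Finset.card_range, nsmul_eq_mul]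
    calc _ ≤ (Q : ℝ≥0∞) * ∑ L : Labels k n g b, 2 * ((tags k n g b).map (tagProb β L)).prod *
          (y * errProb f D L) := by gcongr
      _ = y * Q * (2 * avgErr β f D) := by
        rw [avgErr, Finset.mul_sum, Finset.mul_sum, Finset.mul_sum]
        refine Finset.sum_congr rfl fun L _ => ?_
        ring

theorem lt_of_mem_encode {k n g b a m S : ℕ} (hf : Fits k n g b a m S) (G : LabeledGraph k n g b) :
    ∀ v ∈ encode G, v < 2 ^ S := fun v hv => by
  rw [encode_eq] at hv
  simp only [List.cons_append, List.nil_append, List.mem_cons, List.mem_map] at hv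
  rcases hv with rfl | rfl | rfl | ⟨τ, -, rfl⟩
  exacts [hf.n_lt, hf.g_lt, hf.b_lt,
    lt_of_le_of_lt (tagVal_le_one G τ) (lt_two_pow_of_le_hundred hf.seven_le 1 (by norm_num))]

theorem bdd_encode {k n g b a m S : ℕ} (hf : Fits k n g b a m S) (G : LabeledGraph k n g b) :
    Bdd S (Mem.ofInput (encode G)) := Bdd.ofInput (lt_of_mem_encode hf G)

theorem trialProg_spec {k n g b a m S : ℕ} (hf : Fits k n g b a m S) (ha : Suitable β a)
    (hN : 2 * (tags k n g b).length ≤ 2 ^ m) {c : ℕ} (hc100 : c < 2 ^ S) (hl : (pairs k).length < 2 ^ S)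
    (hm : m = c * n.size * g)
    (G : LabeledGraph k n g b)
    {A : Prog} {T : ℝ} {f : (Pair k → BitString b) → Bool} {D : Labels k n g b → PMF ℕ}
    (hA : ∀ L, Computes β A (encode (completeGraph L)) T (D L)) {x y : ℝ≥0∞} (hxy : x ≤ y)
    (hC : count f G < 2 ^ m) :
    wpc β S (trialProg A a c (pairs k).length) (Mem.ofInput (encode G))
      ((a * m) ^ ((pairs k).length * g) *
        (5 * ⌊T⌋₊ + (tags k n g b).length * (10 * S + 41) + 10 * S + 40) +
        (tags k n g b).length * (40 * S * S + 7) + 16 * S + 50)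
      (fun m' => ⨅ _ : m'.output < 2 ^ S, if m'.output = count f G then x else y) ≤
      2 * x + y * ((a * m) ^ ((pairs k).length * g) : ℕ) * (2 * avgErr β f D) := by
  have hS := hf.seven_le
  have hS0 : 0 < S := by omega
  have hc := lt_two_pow_of_le_hundred hS
  have hl2 := tags_length k n g b
  have hlen := hf.length_lt
  set l := (pairs k).length with hldef
  set Q := (a * m) ^ (l * g) with hQ
  have hgm : m < 2 ^ S := lt_of_le_of_lt (Nat.le_mul_of_pos_left m hf.a_pos)
    (hf.shares_lt.trans Nat.lt_two_pow_self)
  have hmS : m ≤ S := (Nat.le_mul_of_pos_left m hf.a_pos).trans hf.shares_lt.le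
  have hbS : b ≤ S := (Nat.pow_le_pow_iff_right (by norm_num)).1 hf.two_pow_b_lt.le
  have hMS : 2 ^ m < 2 ^ S := by
    have := hf.start_lt
    have := Nat.le_mul_of_pos_left (2 ^ m) hf.a_pos
    omega
  have haS : a < 2 ^ S := Nat.lt_two_pow_self.trans_le (Nat.pow_le_pow_right (by norm_num)
    ((Nat.le_mul_of_pos_right a hf.m_pos).trans hf.shares_lt.le))
  have hamS : a * m < 2 ^ S := hf.shares_lt.trans Nat.lt_two_pow_self
  have hlgS : l * g < 2 ^ S := lt_of_le_of_lt hf.parts_le Nat.lt_two_pow_self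
  have hsS : n.size < 2 ^ S := lt_of_le_of_lt (Nat.size_le.2 hf.n_lt) Nat.lt_two_pow_self
  have henc : ∀ i, Mem.ofInput (encode G) 0 i = (encode G).getD i 0 := ofInput_zero _
  have i0 : Mem.ofInput (encode G) 0 0 = n := by rw [henc, encode_eq]; rfl
  have i1 : Mem.ofInput (encode G) 0 1 = g := by rw [henc, encode_eq]; rfl
  have i2 : Mem.ofInput (encode G) 0 2 = b := by rw [henc, encode_eq]; rfl
  have i3 : ∀ o (ho : o < (tags k n g b).length), Mem.ofInput (encode G) 0 (3 + o) =
      tagVal G (tags k n g b)[o] := by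
    intro o ho
    rw [henc, encode_eq, List.getD_eq_getElem?_getD, List.getElem?_append_right (by simp)]
    simp [ho]
  have hB : Bdd S (Mem.ofInput (encode G)) := bdd_encode hf G
  set m0 := Mem.ofInput (encode G) with hm0
  have z : ∀ a i, a ≠ 0 → m0 a i = 0 := fun a i h => ofInput_ne_zero _ h i
  refine wpc_budget (k := (Q * (5 * ⌊T⌋₊ + (tags k n g b).length * (10 * S + 41) + 10 * S + 40) +
        (tags k n g b).length * (40 * S * S + 7) + 5) + 1 + 1 + 1 + ((4 * (l * g) + 3) + 2 + 1) + 1 + 1 + 1 +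
        ((4 * m + 3) + 2 + 1) + 1 + 1 + ((4 * S + 2) + 1 + 1) + 1 + ((4 * b + 3) + 2 + 1) + 1 + 1 + 1 + 1 + 1)
    (by have : l * g ≤ S := hf.parts_le; omega) ?_
  refine wpc_assign hS0 0 n hB (by decide) (by simp [hc]) rfl (by simp [i0]) hf.n_lt fun hB => ?_
  refine wpc_assign hS0 1 g hB (by decide) (by simp [hc]) rfl (by simp [i1, Mem.set_apply]) hf.g_lt fun hB => ?_
  refine wpc_assign hS0 2 b hB (by decide) (by simp [hc]) rfl (by simp [i2, Mem.set_apply]) hf.b_lt fun hB => ?_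
  refine wpc_assign hS0 0 2 hB (by decide) (by simp [hc]) rfl rfl (hc 2 (by norm_num)) fun hB => ?_
  refine wpc_assign hS0 1 b hB (by decide) (by simp [hc]) rfl (by simp [i2, Mem.set_apply]) hf.b_lt fun hB => ?_
  refine wpc_call_of_evaluates hS0 3 2 [2, b] (2 ^ b) hB (by decide) (by simp [hc]) rfl rfl
    (by simp [List.range_succ, Mem.set_apply])
    (powProg_evaluates hS (hc 2 (by norm_num)) (by norm_num) hf.b_lt hf.two_pow_b_lt) hf.two_pow_b_lt fun hB => ?_
  refine wpc_assign hS0 4 (tags k n g b).length hB (Nat.le_of_ble_eq_true rfl) (by simp [hc, hl]) rfl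
    (by simp [i0, i1, Mem.set_apply, hl2]) (by omega) fun hB => ?_
  refine wpc_call_of_evaluates hS0 0 1 [n] n.size hB (by decide) (by simp [hc]) rfl rfl
    (by simp [List.range_succ, Mem.set_apply, i0])
    (sizeProg_evaluates hS hf.n_lt) hsS fun hB => ?_
  refine wpc_assign hS0 1 m hB (Nat.le_of_ble_eq_true rfl) (by simp [hc, hc100]) rfl
    (by simp [i1, Mem.set_apply, hm]) hgm fun hB => ?_
  refine wpc_assign hS0 1 m hB (by decide) (by simp [hc]) rfl (by simp [Mem.set_apply]) hgm fun hB => ?_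
  refine wpc_call_of_evaluates hS0 6 2 [2, m] (2 ^ m) hB (by decide) (by simp [hc]) rfl rfl
    (by simp [List.range_succ, Mem.set_apply])
    (powProg_evaluates hS (hc 2 (by norm_num)) (by norm_num) hgm hMS) hMS fun hB => ?_
  refine wpc_assign hS0 5 (a * m) hB (Nat.le_of_ble_eq_true rfl) (by simp [hc, haS]) rfl
    (by simp [Mem.set_apply]) hamS fun hB => ?_
  refine wpc_assign hS0 0 (a * m) hB (by decide) (by simp [hc]) rfl (by simp [Mem.set_apply]) hamS fun hB => ?_
  refine wpc_assign hS0 1 (l * g) hB (Nat.le_of_ble_eq_true rfl) (by simp [hc, hl]) rfl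
    (by simp [i1, Mem.set_apply]) hlgS fun hB => ?_
  refine wpc_call_of_evaluates hS0 3 2 [a * m, l * g] Q hB (by decide) (by simp [hc]) rfl rfl
    (by simp [List.range_succ, Mem.set_apply])
    (powProg_evaluates hS hamS (Nat.mul_pos hf.a_pos hf.m_pos) hlgS hf.queries_lt) hf.queries_lt fun hB => ?_
  refine wpc_assign hS0 1 (a * m) hB (by decide) (by simp [hc]) rfl (by simp [Mem.set_apply]) hamS fun hB => ?_
  refine wpc_assign hS0 2 (l * g) hB (Nat.le_of_ble_eq_true rfl) (by simp [hc, hl]) rfl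
    (by simp [i1, Mem.set_apply]) hlgS fun hB => ?_
  refine wpc_assign hS0 0 (tags k n g b).length hB (by decide) (by simp [hc]) rfl (by simp [Mem.set_apply])
    (by omega) fun hB => ?_
  refine sampleQuery_spec hf ha hN G hA hxy hC ⟨⟨hB, ?_, ?_, ?_, ?_, ?_, ?_, ?_, ?_, ?_, ?_, ?_⟩, le_rfl,
    ?_, fun o ho => ?_, ?_, fun o h1 h2 => absurd h1 (by omega)⟩
  all_goals simp [Mem.set_apply, z, hQ, hldef]
  exact i3 o ho

/-! ## The majority of many trials -/

/-- A majority vote: cell `0` of array `1` holds the candidate, cell `0` of array `8` its weight. -/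
def voteBody : Prog := block
  [.ite (cell 8 0)
    (block [.ite (.op .eq (cell 7 0) (cell 1 0)) (block [.assign 8 0 (cell 8 0 + 1)])
      (block [.assign 8 0 (cell 8 0 - 1)])])
    (block [.assign 1 0 (cell 7 0), .assign 8 0 1])]

/-- The potential of a vote for the candidate `y` with weight `w`, when `C` is correct. -/
def votePotential (C y w : ℕ) : ℝ≥0∞ := if y = C then 8⁻¹ ^ w else 8 ^ w

theorem votePotential_up (C y w : ℕ) :
    votePotential C y (w + 1) = if y = C then 8⁻¹ * votePotential C y w else 8 * votePotential C y w := by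
  unfold votePotential
  split_ifs <;> rw [pow_succ, mul_comm]

theorem eight_inv_mul_eight_mul (v : ℝ≥0∞) : 8⁻¹ * (8 * v) = v := by
  rw [← mul_assoc, ENNReal.inv_mul_cancel (by norm_num) (by norm_num), one_mul]

theorem eight_mul_eight_inv_mul (v : ℝ≥0∞) : 8 * (8⁻¹ * v) = v := by
  rw [← mul_assoc, ENNReal.mul_inv_cancel (by norm_num) (by norm_num), one_mul]

theorem eight_inv_mul_le (v : ℝ≥0∞) : 8⁻¹ * v ≤ 8 * v := by
  gcongr
  exact (ENNReal.inv_le_one.2 (by norm_num)).trans (by norm_num)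

/-- A correct vote divides the potential by eight, and any other vote multiplies it by at most
eight. Replacing a candidate of weight zero is covered, since at weight zero the potential is one
for every candidate. -/
theorem voteBody_spec {S : ℕ} (hS : 7 ≤ S) {C : ℕ} {mm : Mem} (hB : Bdd S mm)
    (h8 : mm 8 0 + 1 < 2 ^ S) {V : Mem → ℝ≥0∞} {u : ℝ≥0∞}
    (hV : ∀ (m' : Mem), Bdd S m' → (∀ c, c ≠ 1 → c ≠ 8 → m' c = mm c) → m' 8 0 ≤ mm 8 0 + 1 →
      V m' ≤ u * votePotential C (m' 1 0) (m' 8 0)) :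
    wpc β S voteBody mm 10 V ≤ if mm 7 0 = C then u * (8⁻¹ * votePotential C (mm 1 0) (mm 8 0))
      else u * (8 * votePotential C (mm 1 0) (mm 8 0)) := by
  have hS0 : 0 < S := by omega
  have hc := lt_two_pow_of_le_hundred hS
  refine wpc_budget (k := (0 + 1) + ((0 + 1 + ((0 + 1 + 1) + 1)) + 1)) (by omega) ?_
  refine wpc_ite (k := 0 + 1) (k₁ := 0 + 1 + ((0 + 1 + 1) + 1)) hS0 hB (by decide) (by simp [hc])
    (fun h => ?_) fun h => ?_
  · have h : mm 8 0 ≠ 0 := h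
    obtain ⟨w, hw⟩ : ∃ w, mm 8 0 = w + 1 := ⟨mm 8 0 - 1, by omega⟩
    refine wpc_ite (k := 0 + 1) (k₁ := 0 + 1 + 1) hS0 hB (by decide) (by simp [hc]) (fun h1 => ?_)
      fun h1 => ?_
    · have h1 : mm 7 0 = mm 1 0 := by
        by_contra h2
        exact h1 (if_neg h2)
      refine wpc_assign hS0 0 (mm 8 0 + 1) hB (by decide) (by simp [hc]) rfl (by simp) h8 fun hB => ?_
      refine wpc_nil hS0 (wpc_nil hS0 (wpc_nil hS0 ((hV _ hB (fun c h2 h3 => Mem.set_of_ne _ _ _ h3)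
        (by simp [Mem.set_apply])).trans ?_)))
      simp only [Mem.set_apply]
      norm_num
      rw [votePotential_up, h1]
      split_ifs <;> exact le_rfl
    · have h1 : mm 7 0 ≠ mm 1 0 := fun h2 => one_ne_zero ((if_pos h2).symm.trans h1)
      refine wpc_assign hS0 0 w hB (by decide) (by simp [hc]) rfl (by simp [hw]) (by omega) fun hB => ?_
      refine wpc_nil hS0 (wpc_nil hS0 (wpc_nil hS0 ((hV _ hB (fun c h2 h3 => Mem.set_of_ne _ _ _ h3)
        (by simp [Mem.set_apply]; omega)).trans ?_)))
      simp only [Mem.set_apply]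
      norm_num
      rw [hw, votePotential_up]
      by_cases h2 : mm 1 0 = C
      · rw [if_neg (by rwa [← h2]), if_pos h2, eight_mul_eight_inv_mul]
      -- A wrong candidate loses weight whatever the new vote is; two different wrong values cancel,
      -- which only helps.
      · rw [if_neg h2, eight_inv_mul_eight_mul]
        split_ifs
        · exact le_rfl
        · gcongr
          refine le_trans ?_ (eight_inv_mul_le _)
          rw [eight_inv_mul_eight_mul]
  · have h : mm 8 0 = 0 := h
    refine wpc_budget (k := (0 + 1 + 1 + 1)) (by omega) ?_
    refine wpc_assign hS0 0 (mm 7 0) hB (by decide) (by simp [hc]) rfl (by simp) (hB _ _) fun hB => ?_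
    refine wpc_assign hS0 0 1 hB (by decide) (by simp [hc]) rfl rfl (hc 1 (by norm_num)) fun hB => ?_
    refine wpc_nil hS0 (wpc_nil hS0 ((hV _ hB (fun c h2 h3 => ?_) ?_).trans ?_))
    · rw [Mem.set_of_ne _ _ _ h3, Mem.set_of_ne _ _ _ h2]
    · simp [Mem.set_apply]
    · simp only [Mem.set_apply]
      norm_num
      rw [h]
      unfold votePotential
      split_ifs <;> simp

/-- The majority of `(Nat.size n) ^ 2` trials. -/
def mainProg (A : Prog) (a c l : ℕ) : Prog := block
  [.assign 3 0 2, .assign 3 1 (cell 0 2), .call 4 0 3 2 powProg,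
   .assign 5 0 (3 + .const l * cell 0 0 * cell 0 0 * (1 + cell 0 1 * cell 4 0)),
   .call 6 0 0 1 sizeProg,
   .assign 6 1 (cell 6 0 * cell 6 0),
   .loop (cell 6 1) (block
    [.assign 6 1 (cell 6 1 - 1),
     .call 7 0 0 (cell 5 0) (trialProg A a c l),
     voteBody])]

/-- The number of units of cost of a trial. -/
def trialCost (k n g b a m S T : ℕ) : ℕ :=
  (a * m) ^ ((pairs k).length * g) *
    (5 * T + (tags k n g b).length * (10 * S + 41) + 10 * S + 40) +
    (tags k n g b).length * (40 * S * S + 7) + 16 * S + 50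

/-- One trial multiplies the expected potential by at most `2 * 8⁻¹ + 8 * 32⁻¹ = 2⁻¹`. The potential
starts at one and is at least one whenever the final candidate is wrong, so `R` trials fail with
probability at most `2⁻¹ ^ R`. -/
theorem mainProg_spec {k n g b a m S : ℕ} (hf : Fits k n g b a m S) (ha : Suitable β a)
    (hN : 2 * (tags k n g b).length ≤ 2 ^ m) {c : ℕ} (hc100 : c < 2 ^ S) (hl : (pairs k).length < 2 ^ S)
    (hm : m = c * n.size * g) (hR : n.size * n.size + 1 < 2 ^ S)
    (G : LabeledGraph k n g b)
    {A : Prog} {T : ℝ} {f : (Pair k → BitString b) → Bool} {D : Labels k n g b → PMF ℕ}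
    (hA : ∀ L, Computes β A (encode (completeGraph L)) T (D L)) (hC : count f G < 2 ^ m)
    (herr : ((a * m) ^ ((pairs k).length * g) : ℕ) * (2 * avgErr β f D) ≤ 32⁻¹) :
    wpc β S (mainProg A a c (pairs k).length) (Mem.ofInput (encode G))
      (n.size * n.size * (trialCost k n g b a m S ⌊T⌋₊ + (tags k n g b).length + 20) + 8 * S + 40)
      (fun m' => if m'.output = count f G then 0 else 1) ≤ 2⁻¹ ^ (n.size * n.size) := by
  have hS := hf.seven_le
  have hS0 : 0 < S := by omega
  have hc := lt_two_pow_of_le_hundred hS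
  have hl2 := tags_length k n g b
  have hlen := hf.length_lt
  set l := (pairs k).length with hldef
  set C := count f G with hCdef
  set R := n.size * n.size with hRdef
  set kt := trialCost k n g b a m S ⌊T⌋₊ with hkt
  have hbS : b ≤ S := (Nat.pow_le_pow_iff_right (by norm_num)).1 hf.two_pow_b_lt.le
  have hsS : n.size < 2 ^ S := lt_of_le_of_lt (Nat.size_le.2 hf.n_lt) Nat.lt_two_pow_self
  have henc : ∀ i, Mem.ofInput (encode G) 0 i = (encode G).getD i 0 := ofInput_zero _
  have i0 : Mem.ofInput (encode G) 0 0 = n := by rw [henc, encode_eq]; rfl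
  have i1 : Mem.ofInput (encode G) 0 1 = g := by rw [henc, encode_eq]; rfl
  have i2 : Mem.ofInput (encode G) 0 2 = b := by rw [henc, encode_eq]; rfl
  have hlenc : (encode G).length = (tags k n g b).length + 3 := by rw [encode_eq]; simp
  have hB : Bdd S (Mem.ofInput (encode G)) := bdd_encode hf G
  set m0 := Mem.ofInput (encode G) with hm0
  have z : ∀ a i, a ≠ 0 → m0 a i = 0 := fun a i h => ofInput_ne_zero _ h i
  refine wpc_budget (k := (0 + 1) + (R * ((((0 + 1) + 10) + (kt + ((tags k n g b).length + 3) + 1) + 1) + 1) + 1) + 1 +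
    ((4 * S + 2) + 1 + 1) + 1 + ((4 * b + 3) + 2 + 1) + 1 + 1) ?_ ?_
  · have : R * ((((0 + 1) + 10) + (kt + ((tags k n g b).length + 3) + 1) + 1) + 1) ≤
      R * (kt + (tags k n g b).length + 20) := Nat.mul_le_mul_left _ (by omega)
    omega
  refine wpc_assign hS0 0 2 hB (by decide) (by simp [hc]) rfl rfl (hc 2 (by norm_num)) fun hB => ?_
  refine wpc_assign hS0 1 b hB (by decide) (by simp [hc]) rfl (by simp [i2, Mem.set_apply]) hf.b_lt fun hB => ?_
  refine wpc_call_of_evaluates hS0 0 2 [2, b] (2 ^ b) hB (by decide) (by simp [hc]) rfl rfl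
    (by simp [List.range_succ, Mem.set_apply])
    (powProg_evaluates hS (hc 2 (by norm_num)) (by norm_num) hf.b_lt hf.two_pow_b_lt) hf.two_pow_b_lt fun hB => ?_
  refine wpc_assign hS0 0 ((tags k n g b).length + 3) hB (Nat.le_of_ble_eq_true rfl) (by simp [hc, hl]) rfl
    (by simp [i0, i1, Mem.set_apply, hl2, add_comm]) (by omega) fun hB => ?_
  refine wpc_call_of_evaluates hS0 0 1 [n] n.size hB (by decide) (by simp [hc]) rfl rfl
    (by simp [List.range_succ, Mem.set_apply, i0])
    (sizeProg_evaluates hS hf.n_lt) hsS fun hB => ?_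
  refine wpc_assign hS0 1 R hB (by decide) (by simp [hc]) rfl (by simp [Mem.set_apply, hRdef]) (by omega)
    fun hB => ?_
  refine (wpc_loop hS0 (fun j mm => Bdd S mm ∧ mm 6 1 = j ∧ j ≤ R ∧ mm 0 = m0 0 ∧
    mm 5 0 = (tags k n g b).length + 3 ∧ mm 8 0 ≤ R - j)
    (fun j mm => 2⁻¹ ^ j * votePotential C (mm 1 0) (mm 8 0)) (by decide) (by simp [hc])
    (fun j m h => h.1) (fun m h => by simp [h.2.1]) (fun j m h => by simp [h.2.1]) ?_ ?_
    ⟨hB, ?_, le_rfl, ?_, ?_, ?_⟩).trans (le_of_eq ?_)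
  · rintro j mm ⟨hB, h61, hjR, h0, h50, h8⟩
    refine wpc_assign hS0 1 j hB (by decide) (by simp [hc]) rfl (by simp [h61]) (by omega) fun hB => ?_
    refine wpc_call hS0 0 ((tags k n g b).length + 3) (encode G) hB (by decide) (by simp [hc]) rfl
      (by simp [Mem.set_apply, h50]) ?_ fun hB => ?_
    · refine List.ext_getElem (by simp [hlenc]) fun i h1 h2 => ?_
      rw [List.getElem_map, List.getElem_range]
      simp only [Mem.set_of_ne _ _ _ (by norm_num : (0 : ℕ) ≠ 6), h0]
      rw [henc, List.getD_eq_getElem?_getD, List.getElem?_eq_getElem h2]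
      rfl
    set Φ := votePotential C (mm 1 0) (mm 8 0) with hΦ
    refine le_trans (wpc_mono fun m' => iInf_mono fun hlt => ?_) ((trialProg_spec hf ha hN hc100 hl hm G hA
      (x := 2⁻¹ ^ j * (8⁻¹ * Φ)) (y := 2⁻¹ ^ j * (8 * Φ)) (by gcongr 2⁻¹ ^ j * ?_; exact eight_inv_mul_le _) hC).trans ?_)
    · refine wpc_cons ((voteBody_spec hS (hB _ hlt) (C := C) (u := 2⁻¹ ^ j) ?_
        fun m'' hB'' hm'' h8'' => ?_).trans (le_of_eq ?_))
      · simp [Mem.set_apply]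
        omega
      · have h8'' : m'' 8 0 ≤ mm 8 0 + 1 := by simpa [Mem.set_apply] using h8''
        refine wpc_nil hS0 (iInf_le_of_le ⟨hB'', ?_, by omega, ?_, ?_, ?_⟩ le_rfl)
        · rw [hm'' 6 (by norm_num) (by norm_num)]
          simp [Mem.set_apply]
        · rw [hm'' 0 (by norm_num) (by norm_num)]
          simp [Mem.set_of_ne, h0]
        · rw [hm'' 5 (by norm_num) (by norm_num)]
          simp [Mem.set_apply, h50]
        · omega
      · simp only [Mem.set_apply]
        norm_num
        rfl
    · calc 2 * (2⁻¹ ^ j * (8⁻¹ * Φ)) + 2⁻¹ ^ j * (8 * Φ) * ((a * m) ^ (l * g) : ℕ) * (2 * avgErr β f D)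
          = 2⁻¹ ^ j * Φ * (2 * 8⁻¹ + 8 * (((a * m) ^ (l * g) : ℕ) * (2 * avgErr β f D))) := by ring
        _ ≤ 2⁻¹ ^ j * Φ * (2 * 8⁻¹ + 8 * 32⁻¹) := by gcongr
        _ = 2⁻¹ ^ (j + 1) * Φ := by
          have : (2 * 8⁻¹ + 8 * 32⁻¹ : ℝ≥0∞) = 2⁻¹ := by
            have h1 : (8 : ℝ≥0∞) = 2 * 4 := by norm_num
            have h2 : (32 : ℝ≥0∞) = 8 * 4 := by norm_num
            have h3 : (4 : ℝ≥0∞) = 2 * 2 := by norm_num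
            have e1 : (2 * 8⁻¹ : ℝ≥0∞) = 4⁻¹ := by
              rw [h1, ENNReal.mul_inv (by simp) (by simp), ← mul_assoc,
                ENNReal.mul_inv_cancel (by simp) (by simp), one_mul]
            have e2 : (8 * 32⁻¹ : ℝ≥0∞) = 4⁻¹ := by
              rw [h2, ENNReal.mul_inv (by simp) (by simp), ← mul_assoc,
                ENNReal.mul_inv_cancel (by simp) (by simp), one_mul]
            rw [e1, e2, ← two_mul, h3, ENNReal.mul_inv (by simp) (by simp), ← mul_assoc,
                ENNReal.mul_inv_cancel (by simp) (by simp), one_mul]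
          rw [this, pow_succ]
          ring
  · rintro mm ⟨hB, -⟩
    refine wpc_nil hS0 ?_
    rw [pow_zero, one_mul, votePotential, Mem.output]
    split_ifs
    · simp
    · exact one_le_pow₀ (by norm_num)
  · simp [Mem.set_apply]
  · simp [Mem.set_of_ne]
  · simp [Mem.set_apply]
  · simp [Mem.set_apply, z]
  · simp [Mem.set_apply, z, votePotential]

/-! ## The parameters -/

/-- The factor of the number of levels of the shares. -/
def levelFactor (k : ℕ) : ℕ := k + (pairs k).length + 6

/-- The number of levels of the shares. -/
def levels (k n g : ℕ) : ℕ := levelFactor k * n.size * g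

/-- A bound on the bit lengths of the numbers in the computation. -/
def cellSize (k a n g b : ℕ) : ℕ :=
  a * levels k n g * ((pairs k).length * g) + (pairs k).length * g * levels k n g +
    (a + 1) * levels k n g + (pairs k).length * g + 2 * n.size + g + b + 2 * a + levelFactor k +
    (pairs k).length + 20

/-- The number of levels is chosen such that the residue modulo `2 ^ m` is the count itself; the
summands `k` and `l` of `levelFactor` account for the choices of nodes and of bit strings. -/
theorem count_lt_two_pow_levels {k n g b : ℕ} (hk : 0 < k) (hg : 1 ≤ g) (hb : b ≤ n.size)
    (f : (Pair k → BitString b) → Bool) (G : LabeledGraph k n g b) :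
    count f G < 2 ^ levels k n g := by
  refine (count_lt hk (Nat.lt_size_self n) f G).trans_le (Nat.pow_le_pow_right (by norm_num) ?_)
  set l := (pairs k).length
  calc k * n.size + l * b * g ≤ k * n.size * g + l * n.size * g := by
        refine Nat.add_le_add (Nat.le_mul_of_pos_right _ hg) ?_
        gcongr
    _ ≤ levels k n g := by
        rw [levels, levelFactor, ← add_mul, ← add_mul]
        exact Nat.mul_le_mul_right _ (Nat.mul_le_mul_right _ (Nat.le_add_right _ _))

theorem edge_le {g b : ℕ} : 1 + g * 2 ^ b ≤ 2 ^ (1 + g + b) := by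
  have h1 : g < 2 ^ g := Nat.lt_two_pow_self
  have h2 : 0 < 2 ^ b := by positivity
  calc 1 + g * 2 ^ b ≤ (1 + g) * 2 ^ b := by nlinarith
    _ ≤ 2 ^ (1 + g) * 2 ^ b := by
        gcongr
        exact (Nat.lt_two_pow_self).le
    _ = _ := (pow_add _ _ _).symm

/-- This is the condition for `(1 + 2⁻¹ ^ m) ^ N ≤ 2`. The summand `6` of `levelFactor` absorbs the
exponent `2 + 2 * n.size + g + b`. -/
theorem two_mul_tags_length_le {k n g b : ℕ} (hn : 1 ≤ n) (hg : 1 ≤ g) (hgs : g ≤ n.size)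
    (hb : b ≤ n.size) : 2 * (tags k n g b).length ≤ 2 ^ levels k n g := by
  have hs : 1 ≤ n.size := Nat.size_pos.2 hn
  have h1 : n ≤ 2 ^ n.size := (Nat.lt_size_self n).le
  have h2 : (pairs k).length ≤ 2 ^ (pairs k).length := (Nat.lt_two_pow_self).le
  rw [tags_length]
  calc 2 * ((pairs k).length * n * n * (1 + g * 2 ^ b))
      ≤ 2 ^ 1 * (2 ^ (pairs k).length * 2 ^ n.size * 2 ^ n.size * 2 ^ (1 + g + b)) := by
        gcongr
        · norm_num
        · exact edge_le
    _ = 2 ^ (1 + ((pairs k).length + n.size + n.size + (1 + g + b))) := by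
        simp only [← pow_add]
    _ ≤ _ := by
        refine Nat.pow_le_pow_right (by norm_num) ?_
        calc _ ≤ (pairs k).length * n.size + 6 * n.size := by
              have : (pairs k).length ≤ (pairs k).length * n.size := Nat.le_mul_of_pos_right _ hs
              omega
          _ ≤ levelFactor k * n.size := by
              rw [← add_mul, levelFactor]
              gcongr
              omega
          _ ≤ _ := Nat.le_mul_of_pos_right _ hg

/-- The summands of `cellSize` are the exponents of the bounds required by `Fits`. The number of
queries enters through the crude `t ^ d ≤ 2 ^ (t * d)`, which is good enough since the exponent
stays polylogarithmic. -/
theorem fits_cellSize {k n g b a : ℕ} (ha : 0 < a) (hn : 1 ≤ n) (hg : 1 ≤ g) (hgs : g ≤ n.size)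
    (hb : b ≤ n.size) : Fits k n g b a (levels k n g) (cellSize k a n g b) := by
  have hs : 1 ≤ n.size := Nat.size_pos.2 hn
  have hm : 0 < levels k n g := Nat.mul_pos (Nat.mul_pos (by unfold levelFactor; omega) hs) hg
  have hN := two_mul_tags_length_le (k := k) hn hg hgs hb
  have key : ∀ {x y : ℕ}, x ≤ 2 ^ y → y < cellSize k a n g b → x < 2 ^ cellSize k a n g b :=
    fun h1 h2 => h1.trans_lt (Nat.pow_lt_pow_right (by norm_num) h2)
  have hQ : (a * levels k n g) ^ ((pairs k).length * g) ≤
      2 ^ (a * levels k n g * ((pairs k).length * g)) := by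
    rw [pow_mul 2]
    exact Nat.pow_le_pow_left (Nat.lt_two_pow_self).le _
  set m := levels k n g with hmdef
  set l := (pairs k).length with hldef
  have hS : cellSize k a n g b = a * m * (l * g) + l * g * m + (a * m + m) + l * g + 2 * n.size + g + b +
      2 * a + levelFactor k + l + 20 := by
    rw [cellSize, ← hmdef, ← hldef, add_mul, one_mul]
  refine ⟨by omega, hg, ha, hm, key (Nat.lt_size_self n).le (by omega), key Nat.lt_two_pow_self.le
    (by omega : g < _), key Nat.lt_two_pow_self.le (by omega : b < _), key le_rfl (by omega),
    key edge_le (by omega), ?_, ?_, by omega, ?_,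
    (by omega : l * g ≤ _), key hQ (by omega), (by omega : l * g * m < _), ?_⟩
  · refine key (y := m + 4) ?_ (by omega)
    rw [pow_add]
    have : 0 < 2 ^ m := by positivity
    omega
  · refine key (y := a + a) ?_ (by omega)
    rw [pow_add]
    exact Nat.mul_le_mul_left _ Nat.lt_two_pow_self
  · refine key (y := a + m) ?_ (by have := Nat.le_mul_of_pos_left m ha; have := Nat.le_mul_of_pos_right a hm; omega)
    rw [pow_add]
    have h1 : a < 2 ^ a := Nat.lt_two_pow_self
    have h2 : 0 < 2 ^ m := by positivity
    nlinarith
  · refine key (y := a * m * (l * g) + (l * g * m + m)) ?_ (by omega)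
    rw [pow_add, pow_add]
    exact Nat.mul_le_mul_right _ hQ

/-- The dominant terms have degree three in `n.size`; a fourth factor `n.size` absorbs the
constants. -/
theorem cellSize_le {k n g b a : ℕ} (hn : 1 ≤ n) (hgs : g ≤ n.size)
    (hb : b ≤ n.size) (hc : (levelFactor k + a + (pairs k).length + 20) ^ 4 ≤ n.size) :
    cellSize k a n g b ≤ n.size ^ 4 := by
  have hs : 1 ≤ n.size := Nat.size_pos.2 hn
  set s := n.size with hsdef
  set l := (pairs k).length with hldef
  set c := levelFactor k with hcdef
  set q := c + a + l + 20 with hq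
  have hm : levels k n g ≤ c * s ^ 2 := by
    rw [levels, pow_two, mul_assoc]
    gcongr
  have h3 : s ≤ s ^ 3 := Nat.le_self_pow (by norm_num) _
  have h2 : s ^ 2 ≤ s ^ 3 := Nat.pow_le_pow_right hs (by norm_num)
  have h1 : 1 ≤ s ^ 3 := Nat.one_le_pow _ _ hs
  calc cellSize k a n g b
      = a * levels k n g * (l * g) + l * g * levels k n g + (a + 1) * levels k n g + l * g + 2 * s +
        g + b + 2 * a + c + l + 20 := rfl
    _ ≤ a * (c * s ^ 2) * (l * s) + l * s * (c * s ^ 2) + (a + 1) * (c * s ^ 2) + l * s + 2 * s +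
        s + s + 2 * a + c + l + 20 := by gcongr
    _ = (a * c * l + l * c) * s ^ 3 + (a + 1) * c * s ^ 2 + (l + 4) * s + (2 * a + c + l + 20) * 1 := by
        ring
    _ ≤ (a * c * l + l * c) * s ^ 3 + (a + 1) * c * s ^ 3 + (l + 4) * s ^ 3 +
        (2 * a + c + l + 20) * s ^ 3 := by gcongr
    _ = (a * c * l + l * c + a * c + 2 * c + 2 * l + 2 * a + 24) * s ^ 3 := by ring
    _ ≤ q ^ 4 * s ^ 3 := by
        gcongr
        have e1 : a ≤ q := by omega
        have e2 : c ≤ q := by omega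
        have e3 : l ≤ q := by omega
        have e4 : 20 ≤ q := by omega
        have e5 : a * c * l ≤ q * q * q := by gcongr
        have e6 : l * c ≤ q * q := by gcongr
        have e7 : a * c ≤ q * q := by gcongr
        have e8 : 20 * (q * q) ≤ q * (q * q) := by gcongr
        have e9 : 20 * q ≤ q * q := by gcongr
        have e10 : 20 * (q * q * q) ≤ q * (q * q * q) := by gcongr
        have e11 : q ^ 4 = q * (q * q * q) := by ring
        have e12 : q * (q * q) = q * q * q := by ring
        omega
    _ ≤ s * s ^ 3 := by gcongr
    _ = s ^ 4 := by ring

/-- The running time of the majority of the trials. -/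
theorem cost_le_mul_pow {k n g b a T : ℕ} (ha : 0 < a) (hn : 1 ≤ n) (hg : 1 ≤ g) (hgs : g ≤ n.size)
    (hb : b ≤ n.size) (hT : (tags k n g b).length + 3 ≤ T) :
    ((tags k n g b).length + 3) * (2 * cellSize k a n g b) +
      (n.size * n.size * (trialCost k n g b a (levels k n g) (cellSize k a n g b) T +
        (tags k n g b).length + 20) + 8 * cellSize k a n g b + 40) * (100 * cellSize k a n g b) ≤
      T * cellSize k a n g b ^ ((11 + (pairs k).length) * g) := by
  have hf := fits_cellSize (k := k) ha hn hg hgs hb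
  have hs : 1 ≤ n.size := Nat.size_pos.2 hn
  have hsS : n.size ≤ cellSize k a n g b := by unfold cellSize; omega
  have hS7 : 20 ≤ cellSize k a n g b := by unfold cellSize; omega
  have hQ1 : 1 ≤ (a * levels k n g) ^ ((pairs k).length * g) :=
    Nat.one_le_pow _ _ (Nat.mul_pos ha hf.m_pos)
  have hQS : (a * levels k n g) ^ ((pairs k).length * g) ≤ cellSize k a n g b ^ ((pairs k).length * g) :=
    Nat.pow_le_pow_left hf.shares_lt.le _
  unfold trialCost
  set N := (tags k n g b).length
  set Q := (a * levels k n g) ^ ((pairs k).length * g)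
  set S := cellSize k a n g b
  set l := (pairs k).length
  set s := n.size
  have hT1 : 1 ≤ T := by omega
  -- `T` stands for the running time of `A`, which has to load its input. All overhead proportional
  -- to `N` is therefore absorbed by `T`.
  have hN : N ≤ T := by omega
  have hS1 : 1 ≤ S := by omega
  have tc : Q * (5 * T + N * (10 * S + 41) + 10 * S + 40) + N * (40 * S * S + 7) + 16 * S + 50 ≤
      219 * (Q * T * S ^ 2) := by
    calc _ ≤ Q * (5 * T * S ^ 2 + T * (10 * S ^ 2 + 41 * S ^ 2) + 10 * (T * S ^ 2) + 40 * (T * S ^ 2)) +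
          Q * T * (40 * S ^ 2 + 7 * S ^ 2) + 16 * (Q * T * S ^ 2) + 50 * (Q * T * S ^ 2) := by
          have e1 : S ≤ S ^ 2 := Nat.le_self_pow (by norm_num) _
          have e2 : 1 ≤ S ^ 2 := Nat.one_le_pow _ _ hS1
          have e3 : S ^ 2 ≤ T * S ^ 2 := Nat.le_mul_of_pos_left _ hT1
          have e4 : T * S ^ 2 ≤ Q * T * S ^ 2 := by
            rw [mul_assoc]
            exact Nat.le_mul_of_pos_left _ hQ1
          have e5 : T ≤ Q * T := Nat.le_mul_of_pos_left _ hQ1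
          have e6 : 5 * T ≤ 5 * T * S ^ 2 := Nat.le_mul_of_pos_right _ e2
          have e7 : 40 * S * S = 40 * S ^ 2 := by ring
          rw [e7]
          have f1 : 10 * S + 41 ≤ 10 * S ^ 2 + 41 * S ^ 2 := by omega
          have f2 : 40 * S ^ 2 + 7 ≤ 40 * S ^ 2 + 7 * S ^ 2 := by omega
          gcongr ?_ * ?_ + ?_ + ?_ + ?_
          · exact le_rfl
          · have := Nat.mul_le_mul hN f1
            omega
          · exact Nat.mul_le_mul (hN.trans e5) f2
          · omega
          · omega
      _ = _ := by ring
  obtain ⟨X, hX⟩ : ∃ X, X = Q * T * S ^ 2 := ⟨_, rfl⟩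
  rw [← hX] at tc
  have hXT : T ≤ X := by
    calc T = 1 * T * 1 ^ 2 := by ring
      _ ≤ X := by rw [hX]; gcongr
  have hXS : S ≤ X := by
    calc S = 1 * 1 * S := by ring
      _ ≤ 1 * 1 * S ^ 2 := by gcongr; exact Nat.le_self_pow (by norm_num) _
      _ ≤ X := by rw [hX]; gcongr
  have hss : 1 ≤ s * s := Nat.mul_pos hs hs
  have h1 : s * s * (Q * (5 * T + N * (10 * S + 41) + 10 * S + 40) + N * (40 * S * S + 7) + 16 * S + 50 +
      N + 20) + 8 * S + 40 ≤ 290 * (s * s * X) := by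
    have e : X ≤ s * s * X := Nat.le_mul_of_pos_left _ hss
    have e2 : s * s * (Q * (5 * T + N * (10 * S + 41) + 10 * S + 40) + N * (40 * S * S + 7) + 16 * S + 50 +
      N + 20) ≤ s * s * (240 * X) := Nat.mul_le_mul_left _ (by omega)
    have e3 : s * s * (240 * X) = 240 * (s * s * X) := by ring
    linarith
  calc _ ≤ T * (2 * S) + 290 * (s * s * X) * (100 * S) := by gcongr
    _ ≤ 2 * (s * s * X * S) + 29000 * (s * s * X * S) := by
        have e : X ≤ s * s * X := Nat.le_mul_of_pos_left _ hss
        have : T * S ≤ s * s * X * S := Nat.mul_le_mul_right _ (hXT.trans e)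
        nlinarith
    _ = 29002 * (s * s * X * S) := by ring
    -- The constant is traded for powers of `S`, using `S ≥ 20`.
    _ ≤ S ^ 6 * (S * S * X * S) := by
        refine Nat.mul_le_mul ((by norm_num : 29002 ≤ 20 ^ 6).trans (Nat.pow_le_pow_left hS7 6)) ?_
        exact Nat.mul_le_mul_right _ (Nat.mul_le_mul_right _ (Nat.mul_le_mul hsS hsS))
    _ = T * (S ^ 11 * Q) := by rw [hX]; ring
    _ ≤ T * (S ^ (11 * g) * S ^ (l * g)) := by
        gcongr
        omega
    _ = _ := by rw [← pow_add, add_mul]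

/-! ## The reduction -/

theorem avgErr_le {μ : ℝ≥0} (hμ : μ ≤ 1) {k n g b : ℕ} (f : (Pair k → BitString b) → Bool)
    (D : Labels k n g b → PMF ℕ) {θ : ℝ}
    (h : θ ≤ (((randomLabels μ hμ k n g b).bind fun L => (D L).map fun y =>
      decide (y = count f (completeGraph L))) true).toReal) :
    avgErr (biasedCoin μ hμ) f D ≤ ENNReal.ofReal (1 - θ) := by
  set P := (randomLabels μ hμ k n g b).bind fun L => (D L).map fun y =>
      decide (y = count f (completeGraph L)) with hP
  have h1 : avgErr (biasedCoin μ hμ) f D = P false := by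
    have h2 : expect P (fun c => if c then 0 else 1) = P false := by
      rw [expect_bool]
      simp
    rw [← h2, hP, expect_bind, expect_eq_sum, avgErr]
    refine Finset.sum_congr rfl fun L _ => ?_
    rw [randomLabels_apply, expect_map, errProb]
    simp
  have h3 : (P false).toReal = 1 - (P true).toReal := by
    have h4 := congrArg ENNReal.toReal (coin_add P)
    rw [ENNReal.toReal_add (PMF.apply_ne_top _ _) (PMF.apply_ne_top _ _)] at h4
    simp at h4
    linarith
  rw [h1, ← ENNReal.ofReal_toReal (PMF.apply_ne_top P false), h3]
  exact ENNReal.ofReal_le_ofReal (by linarith)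

/-- The `64` is the product of the domination factor `2` and the `32` demanded by the vote. -/
theorem mul_avgErr_le {μ : ℝ≥0} (hμ : μ ≤ 1) {k n g b Q : ℕ} (f : (Pair k → BitString b) → Bool)
    (D : Labels k n g b → PMF ℕ) {θ : ℝ}
    (h : θ ≤ (((randomLabels μ hμ k n g b).bind fun L => (D L).map fun y =>
      decide (y = count f (completeGraph L))) true).toReal) (hθ : 64 * (Q : ℝ) * (1 - θ) ≤ 1) :
    (Q : ℝ≥0∞) * (2 * avgErr (biasedCoin μ hμ) f D) ≤ 32⁻¹ := by
  calc (Q : ℝ≥0∞) * (2 * avgErr (biasedCoin μ hμ) f D)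
      ≤ Q * (2 * ENNReal.ofReal (1 - θ)) := by gcongr; exact avgErr_le hμ f D h
    _ = ENNReal.ofReal (Q * (2 * (1 - θ))) := by
      rw [ENNReal.ofReal_mul (by positivity), ENNReal.ofReal_mul (by norm_num), ENNReal.ofReal_natCast,
        ENNReal.ofReal_ofNat]
    _ ≤ ENNReal.ofReal (32⁻¹) := ENNReal.ofReal_le_ofReal (by linarith)
    _ = 32⁻¹ := by
      rw [ENNReal.ofReal_inv_of_pos (by norm_num), ENNReal.ofReal_ofNat]

theorem length_le_inputCost (x : List ℕ) : x.length ≤ inputCost x := by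
  unfold inputCost
  have := List.length_le_sum_of_one_le (x.map fun v => 1 + v.size) (by simp)
  rwa [List.length_map] at this

theorem Computes.inputCost_le {p : Prog} {x : List ℕ} {t : ℝ} {D : PMF ℕ} (h : Computes β p x t D) :
    (inputCost x : ℝ) ≤ t := by
  obtain ⟨d, E, -, hT, -⟩ := h
  obtain ⟨r, hr⟩ := E.support_nonempty
  refine le_trans ?_ (hT r hr)
  exact_mod_cast Nat.le_add_right _ _

theorem one_sub_le_toReal {D : PMF ℕ} {C : ℕ} {v : ℝ≥0∞} (hv : v ≠ ⊤)
    (h : expect D (fun y => if y = C then 0 else 1) ≤ v) : 1 - v.toReal ≤ (D C).toReal := by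
  have h1 : expect D (fun y => if y = C then 1 else 0) = D C := by
    unfold expect
    rw [tsum_eq_single C]
    · simp
    · intro y hy
      simp [hy]
  have h2 : D C + expect D (fun y => if y = C then 0 else 1) = 1 := by
    rw [← h1, ← expect_add]
    refine Eq.trans (congrArg _ (funext fun y => ?_)) (expect_const D 1)
    split_ifs <;> simp
  have h3 : 1 ≤ D C + v := h2 ▸ add_le_add le_rfl h
  have h4 := ENNReal.toReal_mono (ENNReal.add_ne_top.2 ⟨PMF.apply_ne_top _ _, hv⟩) h3
  rw [ENNReal.toReal_add (PMF.apply_ne_top _ _) hv] at h4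
  simp at h4
  linarith

/-! ### Bit length and binary logarithm. -/

theorem logb_le_size (n : ℕ) : Real.logb 2 n ≤ n.size := by
  rcases Nat.eq_zero_or_pos n with rfl | hn
  · simp
  rw [Real.logb_le_iff_le_rpow (by norm_num) (by exact_mod_cast hn), Real.rpow_natCast]
  exact_mod_cast (Nat.lt_size_self n).le

theorem size_le_logb_add_one {n : ℕ} (hn : 1 ≤ n) : (n.size : ℝ) ≤ Real.logb 2 n + 1 := by
  obtain ⟨s, hs⟩ : ∃ s, n.size = s + 1 := ⟨n.size - 1, by have := Nat.size_pos.2 hn; omega⟩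
  have h1 : 2 ^ s ≤ n := Nat.lt_size.1 (by omega)
  have h2 : (s : ℝ) ≤ Real.logb 2 n := by
    rw [Real.le_logb_iff_rpow_le (by norm_num) (by exact_mod_cast hn), Real.rpow_natCast]
    exact_mod_cast h1
  rw [hs]
  push_cast
  linarith

theorem tendsto_logb_two_natCast : Tendsto (fun n : ℕ => Real.logb 2 n) atTop atTop :=
  (Real.tendsto_logb_atTop (by norm_num)).comp tendsto_natCast_atTop_atTop

/-- The reduction on instances of one size. -/
theorem mainProg_computes {μ : ℝ≥0} {hμ : μ ≤ 1} {k n g b a : ℕ} (ha : Suitable (biasedCoin μ hμ) a)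
    (hk : 0 < k) (hn : 2 ≤ n) (hg : 1 ≤ g) (hgs : g ≤ n.size) (hb : b ≤ n.size)
    {A : Prog} {T θ : ℝ} {f : (Pair k → BitString b) → Bool} {D : Labels k n g b → PMF ℕ}
    (hA : ∀ L, Computes (biasedCoin μ hμ) A (encode (completeGraph L)) T (D L))
    (hD : θ ≤ (((randomLabels μ hμ k n g b).bind fun L => (D L).map fun y =>
      decide (y = count f (completeGraph L))) true).toReal)
    (hθ : 64 * (((a * levels k n g) ^ ((pairs k).length * g) : ℕ) : ℝ) * (1 - θ) ≤ 1)
    (G : LabeledGraph k n g b) :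
    ∃ D' : PMF ℕ, Computes (biasedCoin μ hμ) (mainProg A a (levelFactor k) (pairs k).length) (encode G)
      (T * (cellSize k a n g b : ℝ) ^ ((11 + (pairs k).length) * g)) D' ∧
      1 - 2 * (2 : ℝ) ^ (-(Real.logb 2 n) ^ 2) ≤ (D' (count f G)).toReal := by
  have ha0 : 0 < a := by have := ha.four_le; omega
  have hn1 : 1 ≤ n := by omega
  have hf := fits_cellSize (k := k) ha0 hn1 hg hgs hb
  have hS0 : 0 < cellSize k a n g b := by unfold cellSize; omega
  have hlen : ∀ G : LabeledGraph k n g b, (encode G).length = (tags k n g b).length + 3 := fun G => by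
    rw [encode_eq]; simp
  -- Any instance will do: loading it bounds `T` from below.
  have hT0 := (hA fun _ _ _ _ => ∅).inputCost_le
  have hT : (tags k n g b).length + 3 ≤ ⌊T⌋₊ := by
    rw [← hlen (completeGraph fun _ _ _ _ => ∅)]
    exact (length_le_inputCost _).trans (Nat.le_floor hT0)
  have hTnn : 0 ≤ T := le_trans (Nat.cast_nonneg _) hT0
  have hsize : n.size * n.size + 1 < 2 ^ cellSize k a n g b := by
    have h1 : n.size < 2 ^ n.size := Nat.lt_two_pow_self
    have h2 : n.size * n.size + 1 ≤ 2 ^ (n.size + n.size) := by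
      rw [pow_add]
      exact Nat.mul_self_lt_mul_self h1
    exact h2.trans_lt (Nat.pow_lt_pow_right (by norm_num) (by unfold cellSize; omega))
  have hmain := mainProg_spec hf ha (two_mul_tags_length_le hn1 hg hgs hb)
    (Nat.lt_two_pow_self.trans_le (Nat.pow_le_pow_right (by norm_num)
      (by unfold cellSize; omega : levelFactor k ≤ cellSize k a n g b)))
    (Nat.lt_two_pow_self.trans_le (Nat.pow_le_pow_right (by norm_num)
      (by unfold cellSize; omega : (pairs k).length ≤ cellSize k a n g b)))
    rfl hsize G hA (count_lt_two_pow_levels hk hg hb f G)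
    (mul_avgErr_le hμ f D hD hθ)
  have hcost : ((inputCost (encode G) + (n.size * n.size * (trialCost k n g b a (levels k n g)
      (cellSize k a n g b) ⌊T⌋₊ + (tags k n g b).length + 20) + 8 * cellSize k a n g b + 40) *
      (100 * cellSize k a n g b) : ℕ) : ℝ) ≤
      T * (cellSize k a n g b : ℝ) ^ ((11 + (pairs k).length) * g) := by
    have h1 := inputCost_le hS0 (lt_of_mem_encode hf G)
    rw [hlen] at h1
    have h2 := cost_le_mul_pow (k := k) ha0 hn1 hg hgs hb hT
    calc _ ≤ ((⌊T⌋₊ * cellSize k a n g b ^ ((11 + (pairs k).length) * g) : ℕ) : ℝ) :=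
          Nat.cast_le.2 ((Nat.add_le_add_right h1 _).trans h2)
      _ ≤ _ := by
          push_cast
          gcongr
          exact Nat.floor_le hTnn
  have hv0 : (2⁻¹ : ℝ≥0∞) ^ (n.size * n.size) ≠ 0 := pow_ne_zero _ (by simp)
  have hvt : (2⁻¹ : ℝ≥0∞) ^ (n.size * n.size) ≠ ⊤ := ENNReal.pow_ne_top (by simp)
  -- The factor two only makes the inequality strict, as `computes_of_wp_le` requires; it is the
  -- constant `2` of the final error bound.
  obtain ⟨D', hD', hE⟩ := computes_of_wp_le (v := 2 * 2⁻¹ ^ (n.size * n.size))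
    (F := fun y => if y = count f G then 0 else 1)
    (t := T * (cellSize k a n g b : ℝ) ^ ((11 + (pairs k).length) * g))
    (lt_of_le_of_lt hmain (by
      conv_lhs => rw [← one_mul ((2⁻¹ : ℝ≥0∞) ^ (n.size * n.size))]
      exact ENNReal.mul_lt_mul_left hv0 hvt (by norm_num))) hcost
  · refine ⟨D', hD', le_trans ?_ (one_sub_le_toReal (ENNReal.mul_ne_top (by simp) hvt) hE)⟩
    have hlog : 0 ≤ Real.logb 2 n := Real.logb_nonneg (by norm_num) (by exact_mod_cast hn1)
    have h1 : (2 * 2⁻¹ ^ (n.size * n.size) : ℝ≥0∞).toReal = 2 * (2 : ℝ) ^ (-((n.size : ℝ) ^ 2)) := by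
      rw [ENNReal.toReal_mul, ENNReal.toReal_pow, ENNReal.toReal_inv, ENNReal.toReal_ofNat,
        Real.rpow_neg (by norm_num), inv_pow, ← Real.rpow_natCast]
      push_cast
      rw [pow_two]
    rw [h1]
    have h2 : Real.logb 2 n ^ 2 ≤ (n.size : ℝ) ^ 2 := pow_le_pow_left₀ hlog (logb_le_size n) 2
    have h3 : (2 : ℝ) ^ (-((n.size : ℝ) ^ 2)) ≤ (2 : ℝ) ^ (-(Real.logb 2 n) ^ 2) :=
      Real.rpow_le_rpow_of_exponent_le (by norm_num) (by linarith)
    linarith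

/-! ## Asymptotics -/

theorem tendsto_logb_logb : Tendsto (fun n : ℕ => Real.logb 2 (Real.logb 2 n)) atTop atTop :=
  (Real.tendsto_logb_atTop (by norm_num)).comp tendsto_logb_two_natCast

/-- The hypothesis on `g` in the form that is used: powers of `lg n` with exponent `O(g)` are `n ^
o(1)`. -/
theorem tendsto_mul_logb_div {g : ℕ → ℕ} (hg : (fun n : ℕ => (g n : ℝ)) =o[atTop]
    fun n : ℕ => Real.logb 2 n / Real.logb 2 (Real.logb 2 n)) :
    Tendsto (fun n : ℕ => g n * Real.logb 2 (Real.logb 2 n) / Real.logb 2 n) atTop (𝓝 0) := by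
  refine hg.tendsto_div_nhds_zero.congr fun n => ?_
  rw [div_div_eq_mul_div]

/-- Both success probabilities enter only through `hθ`, where `(lg n) ^ (2 * l * g)` bounds the
number of queries. The overhead is a polylogarithmic number raised to the power `O(g)`. -/
theorem worstCaseSolvable_of_averageCaseSolvable {k : ℕ} (hk : 0 < k) {g b : ℕ → ℕ}
    (hg_pos : ∀ n, 1 ≤ g n)
    (hg : (fun n : ℕ => (g n : ℝ)) =o[atTop]
      fun n : ℕ => Real.logb 2 n / Real.logb 2 (Real.logb 2 n))
    (hb : (fun n : ℕ => (b n : ℝ)) =o[atTop] fun n : ℕ => Real.logb 2 n)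
    {μ : ℝ≥0} (h0 : 0 < μ) (hμ : μ < 1) {f : (c : ℕ) → (Pair k → BitString c) → Bool} {T θ : ℕ → ℝ}
    (hθ : ∀ᶠ n : ℕ in atTop, 64 * Real.logb 2 n ^ (2 * (pairs k).length * g n) * (1 - θ n) ≤ 1)
    (h : AverageCaseSolvable (biasedCoin μ hμ.le) f
        (fun n => randomLabels μ hμ.le k n (g n) (b n)) T θ) :
    WorstCaseSolvable (biasedCoin μ hμ.le) g b f T := by
  obtain ⟨a, ha⟩ := exists_suitable h0 hμ
  obtain ⟨A, hA⟩ := h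
  have hgt := tendsto_mul_logb_div hg
  set l := (pairs k).length with hl
  set C := (levelFactor k + a + l + 20) ^ 4 with hC
  have ha0 : 0 < a := by have := ha.four_le; omega
  have hc0 : 0 < levelFactor k := by unfold levelFactor; omega
  -- The small factor cancels the constants in `a * levels k n g`, leaving at most `lg² n`; any
  -- remaining constant would be raised to the power `l * g`.
  have e1 : ∀ᶠ n : ℕ in atTop, (g n : ℝ) ≤ Real.logb 2 n / (2 * a * levelFactor k) := by
    have hpos : (0 : ℝ) < 1 / (2 * a * levelFactor k) := by positivity
    filter_upwards [hgt.eventually_le_const hpos, tendsto_logb_logb.eventually_ge_atTop 1,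
      tendsto_logb_two_natCast.eventually_ge_atTop 1] with n h1 h2 h3
    rw [div_le_iff₀ (by linarith)] at h1
    calc (g n : ℝ) ≤ g n * Real.logb 2 (Real.logb 2 n) := le_mul_of_one_le_right (by positivity) h2
      _ ≤ _ := h1
      _ = _ := by ring
  have e2 : ∀ᶠ n : ℕ in atTop, (b n : ℝ) ≤ Real.logb 2 n := by
    filter_upwards [hb.bound one_pos, tendsto_logb_two_natCast.eventually_ge_atTop 0] with n h1 h2
    simpa [abs_of_nonneg h2] using h1
  have e3 := tendsto_logb_two_natCast.eventually_ge_atTop (C + 2 : ℝ)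
  have e4 := eventually_ge_atTop 2
  have key : ∀ᶠ n : ℕ in atTop, 2 ≤ n ∧ g n ≤ n.size ∧ b n ≤ n.size ∧ 2 ≤ Real.logb 2 n ∧
      ((a * levels k n (g n) : ℕ) : ℝ) ≤ Real.logb 2 n ^ 2 ∧
      (cellSize k a n (g n) (b n) : ℝ) ≤ Real.logb 2 n ^ 8 := by
    filter_upwards [e1, e2, e3, e4] with n h1 h2 h3 h4
    have hs1 := logb_le_size n
    have hs2 := size_le_logb_add_one (by omega : 1 ≤ n)
    have hC0 : (0 : ℝ) ≤ C := Nat.cast_nonneg _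
    have hlog : 2 ≤ Real.logb 2 n := by linarith
    have hgl : (g n : ℝ) ≤ Real.logb 2 n := by
      refine h1.trans (div_le_self (by linarith) ?_)
      have : 1 ≤ 2 * a * levelFactor k := Nat.mul_pos (by omega) hc0
      exact_mod_cast this
    have hgs : g n ≤ n.size := by exact_mod_cast hgl.trans hs1
    have hbs : b n ≤ n.size := by exact_mod_cast h2.trans hs1
    refine ⟨h4, hgs, hbs, hlog, ?_, ?_⟩
    · rw [levels]
      push_cast
      calc (a : ℝ) * (levelFactor k * n.size * g n)
          ≤ a * (levelFactor k * (2 * Real.logb 2 n) * (Real.logb 2 n / (2 * a * levelFactor k))) := by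
            gcongr
            linarith
        _ = Real.logb 2 n ^ 2 := by
            have : (a : ℝ) ≠ 0 := by positivity
            have : (levelFactor k : ℝ) ≠ 0 := by positivity
            field_simp
    · have hCs : C ≤ n.size := by exact_mod_cast (by linarith : (C : ℝ) ≤ n.size)
      have h5 := cellSize_le (k := k) (a := a) (by omega : 1 ≤ n) hgs hbs hCs
      calc (cellSize k a n (g n) (b n) : ℝ) ≤ (n.size : ℝ) ^ 4 := by exact_mod_cast h5
        _ ≤ (Real.logb 2 n ^ 2) ^ 4 := by
          gcongr
          nlinarith
        _ = _ := by ring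
  have hSpos : ∀ n, 20 ≤ cellSize k a n (g n) (b n) := fun n => by unfold cellSize; omega
  -- The exponent is chosen such that `n ^ ε n` is exactly `cellSize ^ ((11 + l) * g)`.
  refine ⟨mainProg A a (levelFactor k) l, fun n => ((11 + l) * g n : ℕ) *
    Real.log (cellSize k a n (g n) (b n)) / Real.log n, 2, ?_, ?_⟩
  · have hlim := hgt.const_mul ((11 + l : ℝ) * 8)
    rw [mul_zero] at hlim
    refine tendsto_of_tendsto_of_tendsto_of_le_of_le' tendsto_const_nhds hlim ?_ ?_
    · filter_upwards with n
      have h1 : 0 ≤ Real.log (cellSize k a n (g n) (b n)) := Real.log_natCast_nonneg _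
      have h2 : 0 ≤ Real.log n := Real.log_natCast_nonneg _
      positivity
    · filter_upwards [key] with n ⟨hn, _, _, hlog, _, hS⟩
      have hn0 : 0 < Real.log n := Real.log_pos (by exact_mod_cast hn)
      have h1 : Real.log (cellSize k a n (g n) (b n)) ≤ 8 * Real.log (Real.logb 2 n) := by
        have hp : (0 : ℝ) < cellSize k a n (g n) (b n) := by
          have := hSpos n
          exact_mod_cast (by omega : 0 < cellSize k a n (g n) (b n))
        refine (Real.log_le_log hp hS).trans (le_of_eq ?_)
        rw [Real.log_pow]
        norm_num
      have h2 : Real.logb 2 (Real.logb 2 n) / Real.logb 2 n = Real.log (Real.logb 2 n) / Real.log n := by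
        have : Real.log 2 ≠ 0 := (Real.log_pos (by norm_num)).ne'
        rw [show Real.logb 2 (Real.logb 2 n) = Real.log (Real.logb 2 n) / Real.log 2 from rfl,
          show Real.logb 2 n = Real.log n / Real.log 2 from rfl]
        field_simp
      rw [mul_div_assoc, mul_div_assoc, h2]
      push_cast
      calc ((11 : ℝ) + l) * g n * (Real.log (cellSize k a n (g n) (b n)) / Real.log n)
          ≤ (11 + l) * g n * (8 * Real.log (Real.logb 2 n) / Real.log n) := by gcongr
        _ = _ := by ring
  · filter_upwards [hA, key, hθ] with n ⟨D, hD, hDθ⟩ ⟨hn, hgs, hbs, hlog, hlev, hS⟩ hθn G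
    have hQ : 64 * (((a * levels k n (g n)) ^ (l * g n) : ℕ) : ℝ) * (1 - θ n) ≤ 1 := by
      rcases le_total (1 - θ n) 0 with h1 | h1
      · exact (mul_nonpos_of_nonneg_of_nonpos (by positivity) h1).trans zero_le_one
      · refine le_trans ?_ hθn
        gcongr
        calc (((a * levels k n (g n)) ^ (l * g n) : ℕ) : ℝ)
            = ((a * levels k n (g n) : ℕ) : ℝ) ^ (l * g n) := Nat.cast_pow _ _
          _ ≤ (Real.logb 2 n ^ 2) ^ (l * g n) := by gcongr
          _ = _ := by rw [← pow_mul, mul_assoc]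
    obtain ⟨D', hD', hE⟩ := mainProg_computes ha hk hn (hg_pos n) hgs hbs hD hDθ hQ G
    refine ⟨D', ?_, hE⟩
    have hn0 : 0 < Real.log n := Real.log_pos (by exact_mod_cast hn)
    have hp : (0 : ℝ) < cellSize k a n (g n) (b n) := by
      have := hSpos n
      exact_mod_cast (by omega : 0 < cellSize k a n (g n) (b n))
    convert hD' using 2
    rw [Real.rpow_def_of_pos (by positivity), mul_div_cancel₀ _ hn0.ne', mul_comm, ← Real.rpow_def_of_pos hp,
      Real.rpow_natCast]

/-- By `k ^ 2 * g = 2 * l * g + k * g`, the slack `(lg n) ^ (k * g)` covers the constant `64`. Of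
the double logarithm only that it is at least one is needed. -/
theorem threshold_suffices {k : ℕ} (hk : 0 < k) {g : ℕ → ℕ} (hg_pos : ∀ n, 1 ≤ g n) :
    ∀ᶠ n : ℕ in atTop, 64 * Real.logb 2 n ^ (2 * (pairs k).length * g n) * (1 - threshold k g n) ≤ 1 := by
  filter_upwards [tendsto_logb_logb.eventually_ge_atTop 1,
      tendsto_logb_two_natCast.eventually_ge_atTop 64] with n h1 h2
  set x := Real.logb 2 n with hx
  have hx0 : 0 < x := by linarith
  have e : k ^ 2 * g n = 2 * (pairs k).length * g n + k * g n := by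
    rw [← two_mul_pairs_length, add_mul]
  have h3 : 64 ≤ x ^ (k * g n) := h2.trans (le_self_pow₀ (by linarith) (Nat.mul_pos hk (hg_pos n)).ne')
  have h4 : 1 ≤ Real.logb 2 x ^ (k ^ 2 * g n) := one_le_pow₀ h1
  rw [threshold, sub_sub_cancel, mul_one_div, div_le_one (by positivity)]
  calc 64 * x ^ (2 * (pairs k).length * g n) ≤ x ^ (k * g n) * x ^ (2 * (pairs k).length * g n) := by gcongr
    _ = x ^ (k ^ 2 * g n) * 1 := by rw [← pow_add, e, add_comm, mul_one]
    _ ≤ _ := by gcongr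

/-- Both `64` and `(lg n) ^ (2 * l * g)` are eventually at most `n ^ (δ / 2)`. For `64 = 2 ^ 6` this
holds as soon as `lg n ≥ 12 / δ`. -/
theorem power_suffices {k : ℕ} {g : ℕ → ℕ} (hg : (fun n : ℕ => (g n : ℝ)) =o[atTop]
      fun n : ℕ => Real.logb 2 n / Real.logb 2 (Real.logb 2 n)) {δ : ℝ} (hδ : 0 < δ) :
    ∀ᶠ n : ℕ in atTop, 64 * Real.logb 2 n ^ (2 * (pairs k).length * g n) *
      (1 - (1 - 1 / (n : ℝ) ^ δ)) ≤ 1 := by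
  set l := (pairs k).length
  have h1 := (tendsto_mul_logb_div hg).const_mul (2 * l : ℝ)
  rw [mul_zero] at h1
  filter_upwards [h1.eventually_le_const (half_pos hδ), eventually_ge_atTop 2,
    tendsto_logb_two_natCast.eventually_ge_atTop 1, tendsto_logb_two_natCast.eventually_ge_atTop (12 / δ)]
    with n h2 hn h3 h4
  have hn0 : (0 : ℝ) < n := by exact_mod_cast (by omega : 0 < n)
  set x := Real.logb 2 n with hx
  have hx0 : 0 < x := by linarith
  have hnx : (n : ℝ) = 2 ^ x := (Real.rpow_logb (by norm_num) (by norm_num) hn0).symm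
  have h5 : x ^ (2 * l * g n) ≤ (2 : ℝ) ^ (δ / 2 * x) := by
    have e : x ^ (2 * l * g n) = (2 : ℝ) ^ (Real.logb 2 x * (2 * l * g n)) := by
      rw [Real.rpow_mul (by norm_num), Real.rpow_logb (by norm_num) (by norm_num) hx0, ← Real.rpow_natCast]
      push_cast
      rfl
    rw [e]
    refine Real.rpow_le_rpow_of_exponent_le (by norm_num) ?_
    rw [← div_le_iff₀ hx0]
    refine le_trans (le_of_eq ?_) h2
    ring
  have h6 : (64 : ℝ) ≤ 2 ^ (δ / 2 * x) := by
    have : (64 : ℝ) = 2 ^ (6 : ℝ) := by norm_num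
    rw [this]
    refine Real.rpow_le_rpow_of_exponent_le (by norm_num) ?_
    rw [div_le_iff₀ hδ] at h4
    linarith
  rw [sub_sub_cancel, mul_one_div, div_le_one (by positivity), hnx, ← Real.rpow_mul (by norm_num)]
  calc 64 * x ^ (2 * l * g n) ≤ 2 ^ (δ / 2 * x) * 2 ^ (δ / 2 * x) := by gcongr
    _ = 2 ^ (x * δ) := by
      rw [← Real.rpow_add (by norm_num)]
      congr 1
      ring

end FactoredClique

end

open FactoredClique in
theorem mainTheorem3 (k : ℕ) (hk : 2 ≤ k) (g b : ℕ → ℕ) (hg_pos : ∀ n, 1 ≤ g n)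
    (hg : (fun n : ℕ => (g n : ℝ)) =o[atTop]
      fun n : ℕ => Real.logb 2 n / Real.logb 2 (Real.logb 2 n))
    (hb : (fun n : ℕ => (b n : ℝ)) =o[atTop] fun n : ℕ => Real.logb 2 n) :
    (∀ (μ : ℝ≥0) (_ : 0 < μ) (hμ : μ < 1) (f : (c : ℕ) → (Pair k → BitString c) → Bool)
        (T : ℕ → ℝ),
      AverageCaseSolvable (biasedCoin μ hμ.le) f
        (fun n => randomLabels μ hμ.le k n (g n) (b n)) T (threshold k g) →
      WorstCaseSolvable (biasedCoin μ hμ.le) g b f T) ∧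
    (∀ (μ : ℝ≥0) (_ : 0 < μ) (hμ : μ < 1) (f : (c : ℕ) → (Pair k → BitString c) → Bool)
        (T : ℕ → ℝ) (δ : ℝ) (_ : 0 < δ),
      AverageCaseSolvable (biasedCoin μ hμ.le) f
        (fun n => randomLabels μ hμ.le k n (g n) (b n)) T (fun n => 1 - 1 / (n : ℝ) ^ δ) →
      WorstCaseSolvable (biasedCoin μ hμ.le) g b f T) ∧
    (∀ (h : (1 / 2 : ℝ≥0) ≤ 1) (n : ℕ),
      randomLabels (1 / 2) h k n (g n) (b n) = uniformLabels k n (g n) (b n)) ∧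
    (∀ (h : (1 / 2 : ℝ≥0) ≤ 1) (T : ℕ → ℝ),
      AverageCaseSolvable (biasedCoin (1 / 2) h) (sumsToZero k)
        (fun n => uniformLabels k n (g n) (b n)) T (threshold k g) →
      WorstCaseSolvable (biasedCoin (1 / 2) h) g b (sumsToZero k) T) := by
  have hk0 : 0 < k := by omega
  refine ⟨fun μ h0 hμ f T h => worstCaseSolvable_of_averageCaseSolvable hk0 hg_pos hg hb h0 hμ
      (threshold_suffices hk0 hg_pos) h,
    fun μ h0 hμ f T δ hδ h => worstCaseSolvable_of_averageCaseSolvable hk0 hg_pos hg hb h0 hμ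
      (power_suffices hg hδ) h,
    fun h n => randomLabels_half h k n (g n) (b n), fun h T hT => ?_⟩
  simp only [← randomLabels_half h] at hT
  exact worstCaseSolvable_of_averageCaseSolvable hk0 hg_pos hg hb (by positivity)
    (half_lt_self one_pos) (threshold_suffices hk0 hg_pos) hT
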